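/- All graphs are finite and simple. For a graph $G$ let $\alpha(G)$ and $\mu(G)$ be the sizes of a maximum independent set and of a maximum matching; $G$ is König–Egerváry if $\alpha(G)+\mu(G)=|V(G)|$, and almost bipartite if it has exactly one odd cycle. For $X\subseteq V(G)$ let $N(X)$ be the set of vertices having a neighbour in $X$, and let $d(G)=\max_{X\subseteq V(G)}(|X|-|N(X)|)$. A critical independent set is an independent set $X$ for which $|X|-|N(X)|$ is maximum among independent sets; $\ker(G)$ is the intersection of all critical independent sets and $\operatorname{corona}(G)$ is the union of all maximum independent sets. Let $D(G)$ be the set of vertices missed by some maximum matching, $A(G)$ the set of vertices outside $D(G)$ that are adjacent to a vertex of $D(G)$, and $C(G)=V(G)\setminus(D(G)\cup A(G))$. For a matching $M$, an $M$-blossom is an odd cycle of length $2j+1$ with $j$ edges in $M$; its base is the vertex of the cycle not covered by those $j$ edges. An $M$-flower consists of an $M$-blossom and an $M$-alternating path of even length (possibly $0$) from the base to a vertex not saturated by $M$, which meets the blossom only in the base. For an odd cycle $C$ of $G$, the reach set $R(C)$ is the union of the vertex sets of all $M$-flowers with blossom $C$, over all maximum matchings $M$ of $G$. A graph is $R$-disjoint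 if it has an odd cycle, $R(C)\neq\emptyset$ for every odd cycle $C$, and $R(C)\cap R(C')=\emptyset$ for all distinct odd cycles $C,C'$. A graph $G$ is a BAB-graph $(B,G_1,\dots,G_k)$ ($k\ge 0$) if it is obtained from the disjoint union of a (possibly empty) bipartite graph $B$ and almost bipartite non-König–Egerváry graphs $G_1,\dots,G_k$, where in each $G_i$ the reach set of its unique odd cycle is $V(G_i)$, by adding edges between different graphs so that every vertex of $B$ incident with an added edge lies in $A(B)\cup C(B)$ and every vertex of $G_i$ incident with an added edge lies in $A(G_i)$. **Theorem.** (i) For every BAB-graph $G=(B,G_1,\dots,G_k)$, $$|\ker(G)|+|\operatorname{corona}(G)|\le 2\alpha(G)+k=d(G)+|V(G)|.$$ (ii) The bound is tight: every $R$-disjoint graph $G$ with exactly $k$ odd cycles is a BAB-graph $(B,G_1,\dots,G_k)$ for suitable $B,G_1,\dots,G_k$ and satisfies $|\ker(G)|+|\operatorname{corona}(G)|=2\alpha(G)+k$; and for every $k\ge1$ there is an $R$-disjoint graph with exactly $k$ odd cycles. -/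

import Mathlib

namespace BABGraph

open SimpleGraph

variable {V : Type*}

/-- The (open) neighbourhood `N(X)` of a set of vertices. -/
def nbhd (G : SimpleGraph V) (X : Set V) : Set V := {v | ∃ u ∈ X, G.Adj u v}

/-- The vertices of `X` that have a neighbour outside `X`. -/
def boundary (G : SimpleGraph V) (X : Set V) : Set V := {v | v ∈ X ∧ ∃ w, w ∉ X ∧ G.Adj v w}

/-! ### Independent sets, critical sets -/

/-- The difference `|X| - |N(X)|` of a set of vertices. -/
noncomputable def diff (G : SimpleGraph V) (X : Set V) : ℤ :=
  (X.ncard : ℤ) - ((nbhd G X).ncard : ℤ)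

/-- The critical difference `d(G)`: the maximum of `|X| - |N(X)|` over all sets of vertices
(for a finite graph this is a maximum of finitely many integers). -/
noncomputable def critDiff (G : SimpleGraph V) : ℤ := ⨆ X : Set V, diff G X

/-- The critical independence difference: the maximum of `|X| - |N(X)|` over all independent
sets. -/
noncomputable def critIndepDiff (G : SimpleGraph V) : ℤ :=
  ⨆ X : {X : Set V // G.IsIndepSet X}, diff G X.1

/-- Critical independent sets. -/
def IsCriticalIndep (G : SimpleGraph V) (X : Set V) : Prop :=
  G.IsIndepSet X ∧ diff G X = critIndepDiff G

/-- `ker(G)`: the intersection of all critical independent sets. -/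
def kernel (G : SimpleGraph V) : Set V := {v | ∀ X, IsCriticalIndep G X → v ∈ X}

/-- `corona(G)`: the union of all maximum independent sets. -/
def corona [Finite V] (G : SimpleGraph V) : Set V :=
  {v | ∃ S : Finset V, G.IsMaximumIndepSet S ∧ v ∈ S}

/-! ### Matchings. A matching is a subgraph whose vertices are exactly the saturated ones. -/

/-- Matchings with the largest number of edges. -/
def IsMaximumMatching (G : SimpleGraph V) (M : G.Subgraph) : Prop :=
  M.IsMatching ∧ ∀ M' : G.Subgraph, M'.IsMatching → M'.edgeSet.ncard ≤ M.edgeSet.ncard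

/-- The matching number `μ(G)`. -/
noncomputable def matchingNum (G : SimpleGraph V) : ℕ :=
  sSup {n | ∃ M : G.Subgraph, M.IsMatching ∧ M.edgeSet.ncard = n}

/-- König–Egerváry graphs: `α(G) + μ(G) = |V(G)|`. -/
def IsKonigEgervary (G : SimpleGraph V) : Prop :=
  G.indepNum + matchingNum G = Nat.card V

/-- The Gallai–Edmonds set `D(G)`: vertices missed by some maximum matching. -/
def geD (G : SimpleGraph V) : Set V := {v | ∃ M, IsMaximumMatching G M ∧ v ∉ M.verts}

/-- The Gallai–Edmonds set `A(G)`: vertices outside `D(G)` adjacent to a vertex of `D(G)`. -/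
def geA (G : SimpleGraph V) : Set V := {v | v ∉ geD G ∧ ∃ u ∈ geD G, G.Adj v u}

/-- The Gallai–Edmonds set `C(G)`: the remaining vertices. -/
def geC (G : SimpleGraph V) : Set V := (geD G ∪ geA G)ᶜ

/-! ### Odd cycles, flowers and reach sets -/

/-- The subgraph `C` is an odd cycle of `G`. -/
def IsOddCycle (G : SimpleGraph V) (C : G.Subgraph) : Prop :=
  ∃ (v : V) (c : G.Walk v v), c.IsCycle ∧ Odd c.length ∧ c.toSubgraph = C

/-- Almost bipartite graphs: exactly one odd cycle. -/
def IsAlmostBipartite (G : SimpleGraph V) : Prop := ∃! C : G.Subgraph, IsOddCycle G C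

/-- A walk is `M`-alternating if exactly one of any two consecutive edges lies in `M`. -/
def IsAltWalk {G : SimpleGraph V} (M : G.Subgraph) {u v : V} (p : G.Walk u v) : Prop :=
  p.edges.IsChain (fun e f => e ∈ M.edgeSet ↔ f ∉ M.edgeSet)

/-- `C` is an `M`-blossom with base `b`: an odd cycle of length `2j + 1` with `j` edges in `M`,
where `b` is the vertex of `C` that is on no edge of `C` in `M`. -/
def IsBlossom {G : SimpleGraph V} (M C : G.Subgraph) (b : V) : Prop :=
  IsOddCycle G C ∧ C.edgeSet.ncard = 2 * (C.edgeSet ∩ M.edgeSet).ncard + 1 ∧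
    b ∈ C.verts ∧ ∀ w, C.Adj b w → ¬ M.Adj b w

/-- `C` and `p` form an `M`-flower: `C` is an `M`-blossom and `p` is an `M`-stem, that is, an
`M`-alternating path of even length from the base to a vertex (the root) not saturated by `M`,
which meets `C` in the base only. -/
def IsFlower {G : SimpleGraph V} (M C : G.Subgraph) {b r : V} (p : G.Walk b r) : Prop :=
  IsBlossom M C b ∧ p.IsPath ∧ IsAltWalk M p ∧ Even p.length ∧ r ∉ M.verts ∧
    ∀ v, v ∈ p.support → v ∈ C.verts → v = b

/-- The reach set `R(C)`: all vertices of `M`-flowers with blossom `C`, over all maximum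
matchings `M`. -/
def reachSet (G : SimpleGraph V) (C : G.Subgraph) : Set V :=
  {v | ∃ (M : G.Subgraph) (b r : V) (p : G.Walk b r),
    IsMaximumMatching G M ∧ IsFlower M C p ∧ (v ∈ C.verts ∨ v ∈ p.support)}

/-- `R`-disjoint graphs: there is an odd cycle, all reach sets of odd cycles are nonempty, and
those of distinct odd cycles are disjoint. -/
def IsRDisjoint (G : SimpleGraph V) : Prop :=
  (∃ C, IsOddCycle G C) ∧
  (∀ C, IsOddCycle G C → (reachSet G C).Nonempty) ∧
  ∀ C C', IsOddCycle G C → IsOddCycle G C' → C ≠ C' → Disjoint (reachSet G C) (reachSet G C')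

/-- The number of odd cycles of `G` (as subgraphs). -/
noncomputable def numOddCycles (G : SimpleGraph V) : ℕ := {C : G.Subgraph | IsOddCycle G C}.ncard

/-! ### BAB-graphs -/

/-- `G = (B, G₁, …, Gₖ)` is a BAB-graph, where `B` is the subgraph induced on `B` and `Gᵢ` the one
induced on `P i`. A graph obtained from the disjoint union of these graphs by adding edges between
different parts is the same as a graph whose vertex set is partitioned into these sets. -/
structure IsBAB (G : SimpleGraph V) {k : ℕ} (B : Set V) (P : Fin k → Set V) : Prop where
  disjoint_base : ∀ i, Disjoint B (P i)
  disjoint_parts : ∀ i j, i ≠ j → Disjoint (P i) (P j)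
  cover : B ∪ (⋃ i, P i) = Set.univ
  bipartite : (G.induce B).IsBipartite
  almostBipartite : ∀ i, IsAlmostBipartite (G.induce (P i))
  not_konigEgervary : ∀ i, ¬ IsKonigEgervary (G.induce (P i))
  reach : ∀ i, ∀ C, IsOddCycle (G.induce (P i)) C → reachSet (G.induce (P i)) C = Set.univ
  boundary_base :
    boundary G B ⊆ Subtype.val '' (geA (G.induce B) ∪ geC (G.induce B))
  boundary_parts : ∀ i, boundary G (P i) ⊆ Subtype.val '' geA (G.induce (P i))

end BABGraph

/-!
The kernel is itself critical and the corona avoids `N(ker)`, so `|ker| + |corona| ≤ d + |V|` for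
every graph, with equality iff the corona is the whole complement of `N(ker)`.

Let `H` be almost bipartite with odd cycle `C` and `R(C) = V(H)`. Contracting `C` leaves a bipartite
graph; the side `A` without `C` turns out to be `A(H)`, and all other vertices lie in `D(H)`. Hall's
theorem across the bipartition computes `α` and `d`: some maximum independent set avoids `A(H)` and
consists of all of the other side and half of the cycle, which gives `2 α(H) + 1 = d(H) + |H|`.
In a BAB-graph the added edges end in vertices that neither the optimal independent sets nor the
optimal sets for `d` of the parts need, so both `α` and `d` are sums over the parts, and
`2 α(G) + k = d(G) + |V|`.

For an `R`-disjoint graph, grow a subset of `R(C)` from each odd cycle `C`, blossom-style, until it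
cannot be enlarged. A maximum matching that keeps the edges of these parts exists on both sides of
the partition separately, and since the growth is stuck every edge leaving a part starts in its odd
layer, which is `A` of the part, and ends outside `D` of the rest. The tight examples are disjoint
unions of triangles.

Matchings are encoded as involutions that move vertices along edges only, so that they can be
restricted, glued and switched along alternating paths like functions.
-/

namespace BABGraph

open SimpleGraph

variable {V : Type*}

/-! ### Critical sets and maximum independent sets -/

lemma nbhd_mono (G : SimpleGraph V) {X Y : Set V} (h : X ⊆ Y) : nbhd G X ⊆ nbhd G Y :=
  fun _ ⟨u, hu, huv⟩ => ⟨u, h hu, huv⟩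

lemma nbhd_union (G : SimpleGraph V) (X Y : Set V) : nbhd G (X ∪ Y) = nbhd G X ∪ nbhd G Y := by
  ext v
  simp only [nbhd, Set.mem_union, Set.mem_ofPred_eq, or_and_right, exists_or]

lemma isIndepSet_sdiff_nbhd (G : SimpleGraph V) (X : Set V) : G.IsIndepSet (X \ nbhd G X) :=
  fun _ hu _ hv _ huv => hv.2 ⟨_, hu.1, huv⟩

lemma diff_le_critDiff [Finite V] (G : SimpleGraph V) (X : Set V) : diff G X ≤ critDiff G :=
  le_ciSup (Set.finite_range _).bddAbove X

lemma exists_diff_eq_critDiff [Finite V] (G : SimpleGraph V) : ∃ X, diff G X = critDiff G :=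
  exists_eq_ciSup_of_finite

lemma critDiff_eq_of_forall_le [Finite V] (G : SimpleGraph V) {d : ℤ} (hle : ∀ X, diff G X ≤ d)
    (hge : ∃ X, d ≤ diff G X) : critDiff G = d := by
  obtain ⟨X, hX⟩ := hge
  exact le_antisymm (ciSup_le hle) (hX.trans (diff_le_critDiff G X))

lemma diff_le_diff_sdiff_nbhd [Finite V] (G : SimpleGraph V) (X : Set V) :
    diff G X ≤ diff G (X \ nbhd G X) := by
  have nbhd_subset : nbhd G (X \ nbhd G X) ⊆ nbhd G X \ X := by
    rintro v ⟨u, hu, huv⟩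
    exact ⟨⟨u, hu.1, huv⟩, fun hv => hu.2 ⟨v, hv, huv.symm⟩⟩
  have nbhd_ncard_le := Set.ncard_le_ncard nbhd_subset
  have split_X := Set.ncard_inter_add_ncard_sdiff_eq_ncard X (nbhd G X)
  have split_nbhd := Set.ncard_inter_add_ncard_sdiff_eq_ncard (nbhd G X) X
  rw [Set.inter_comm] at split_nbhd
  unfold diff
  omega

lemma critIndepDiff_eq_critDiff [Finite V] (G : SimpleGraph V) :
    critIndepDiff G = critDiff G := by
  have : Nonempty {X : Set V // G.IsIndepSet X} := ⟨∅, Set.pairwise_empty _⟩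
  refine le_antisymm (ciSup_le fun X => diff_le_critDiff G X.1) ?_
  refine ciSup_le fun X => (diff_le_diff_sdiff_nbhd G X).trans ?_
  exact le_ciSup (f := fun X : {X : Set V // G.IsIndepSet X} => diff G X.1)
    (Set.finite_range _).bddAbove ⟨_, isIndepSet_sdiff_nbhd G X⟩

lemma isCriticalIndep_iff [Finite V] (G : SimpleGraph V) (X : Set V) :
    IsCriticalIndep G X ↔ G.IsIndepSet X ∧ diff G X = critDiff G := by
  rw [IsCriticalIndep, critIndepDiff_eq_critDiff]

lemma exists_isCriticalIndep [Finite V] (G : SimpleGraph V) : ∃ X, IsCriticalIndep G X := by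
  obtain ⟨X, hX⟩ := exists_diff_eq_critDiff G
  refine ⟨X \ nbhd G X, (isCriticalIndep_iff G _).2 ⟨isIndepSet_sdiff_nbhd G X, ?_⟩⟩
  exact le_antisymm (diff_le_critDiff G _) (hX ▸ diff_le_diff_sdiff_nbhd G X)

lemma diff_add_diff_le [Finite V] (G : SimpleGraph V) (X Y : Set V) :
    diff G X + diff G Y ≤ diff G (X ∪ Y) + diff G (X ∩ Y) := by
  have card_sets := Set.ncard_union_add_ncard_inter X Y
  have card_nbhds := Set.ncard_union_add_ncard_inter (nbhd G X) (nbhd G Y)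
  have nbhd_inter_le : (nbhd G (X ∩ Y)).ncard ≤ (nbhd G X ∩ nbhd G Y).ncard :=
    Set.ncard_le_ncard (Set.subset_inter (nbhd_mono G Set.inter_subset_left)
      (nbhd_mono G Set.inter_subset_right))
  unfold diff
  rw [nbhd_union]
  omega

lemma IsCriticalIndep.inter [Finite V] {G : SimpleGraph V} {X Y : Set V}
    (hX : IsCriticalIndep G X) (hY : IsCriticalIndep G Y) : IsCriticalIndep G (X ∩ Y) := by
  rw [isCriticalIndep_iff] at hX hY ⊢
  refine ⟨hX.1.mono Set.inter_subset_left, ?_⟩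
  have supermodular := diff_add_diff_le G X Y
  have union_le := diff_le_critDiff G (X ∪ Y)
  have inter_le := diff_le_critDiff G (X ∩ Y)
  omega

lemma isCriticalIndep_kernel [Finite V] (G : SimpleGraph V) : IsCriticalIndep G (kernel G) := by
  obtain ⟨X, hX, hmin⟩ := Set.exists_min_image {X | IsCriticalIndep G X} Set.ncard
    (Set.toFinite _) (exists_isCriticalIndep G)
  have subset_critical : ∀ Y, IsCriticalIndep G Y → X ⊆ Y := fun Y hY =>
    Set.inter_eq_left.1 (Set.eq_of_subset_of_ncard_le Set.inter_subset_left (hmin _ (hX.inter hY)))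
  have kernel_eq : kernel G = X :=
    Set.Subset.antisymm (fun v hv => hv X hX) fun v hv Y hY => subset_critical Y hY hv
  rwa [kernel_eq]

lemma IsCriticalIndep.kernel_subset {G : SimpleGraph V} {X : Set V} (hX : IsCriticalIndep G X) :
    kernel G ⊆ X := fun _ hv => hv X hX

lemma diff_kernel [Finite V] (G : SimpleGraph V) : diff G (kernel G) = critDiff G :=
  ((isCriticalIndep_iff G _).1 (isCriticalIndep_kernel G)).2

/-- Maximum independent sets, as a predicate on `Set V`: Mathlib's `IsMaximumIndepSet` is about
finsets, and sets restrict to and glue from induced subgraphs more directly. -/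
structure IsMaxIndep (G : SimpleGraph V) (S : Set V) : Prop where
  indep : G.IsIndepSet S
  ncard_eq : S.ncard = G.indepNum

lemma ncard_le_indepNum [Finite V] {G : SimpleGraph V} {S : Set V} (hS : G.IsIndepSet S) :
    S.ncard ≤ G.indepNum := by
  classical
  have := Fintype.ofFinite V
  rw [Set.ncard_eq_toFinset_card']
  exact SimpleGraph.IsIndepSet.card_le_indepNum (by simpa using hS)

lemma exists_isMaxIndep (G : SimpleGraph V) : ∃ S, IsMaxIndep G S := by
  obtain ⟨s, hs⟩ := G.exists_isNIndepSet_indepNum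
  exact ⟨s, hs.1, by rw [Set.ncard_coe_finset, hs.2]⟩

lemma mem_corona_iff [Finite V] (G : SimpleGraph V) (v : V) :
    v ∈ corona G ↔ ∃ S, IsMaxIndep G S ∧ v ∈ S := by
  classical
  have := Fintype.ofFinite V
  constructor
  · rintro ⟨S, hS, hv⟩
    exact ⟨S, ⟨hS.1, by rw [Set.ncard_coe_finset, maximumIndepSet_card_eq_indepNum S hS]⟩, hv⟩
  · rintro ⟨S, hS, hv⟩
    refine ⟨S.toFinset, ⟨by simpa using hS.indep, fun t ht => ?_⟩, by simpa using hv⟩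
    rw [← Set.ncard_eq_toFinset_card', hS.ncard_eq]
    exact ht.card_le_indepNum

lemma isIndepSet_sdiff_nbhd_union {G : SimpleGraph V} {S X : Set V} (hS : G.IsIndepSet S)
    (hX : G.IsIndepSet X) : G.IsIndepSet ((S \ nbhd G X) ∪ X) := by
  rintro u (hu | hu) v (hv | hv) huv hadj
  · exact hS hu.1 hv.1 huv hadj
  · exact hu.2 ⟨v, hv, hadj.symm⟩
  · exact hv.2 ⟨u, hu, hadj⟩
  · exact hX hu hv huv hadj

lemma ncard_sdiff_nbhd_union [Finite V] {G : SimpleGraph V} (S : Set V) {X : Set V}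
    (hX : G.IsIndepSet X) :
    ((S \ nbhd G X) ∪ X).ncard + (S ∩ nbhd G X).ncard = S.ncard + (X \ S).ncard := by
  have union_eq : (S \ nbhd G X) ∪ X = (S \ nbhd G X) ∪ (X \ S) := by
    ext v
    have notMem_nbhd : v ∈ X → v ∉ nbhd G X := fun hv ⟨u, hu, huv⟩ => hX hu hv huv.ne huv
    simp only [Set.mem_union, Set.mem_sdiff]
    tauto
  rw [union_eq, Set.ncard_union_eq (Set.disjoint_left.2 fun v hv hv' => hv'.2 hv.1),
    ← Set.ncard_inter_add_ncard_sdiff_eq_ncard S (nbhd G X)]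
  ring

lemma IsMaxIndep.ncard_sdiff_le [Finite V] {G : SimpleGraph V} {S X : Set V}
    (hS : IsMaxIndep G S) (hX : G.IsIndepSet X) : (X \ S).ncard ≤ (S ∩ nbhd G X).ncard := by
  have exchanged_le := ncard_le_indepNum (isIndepSet_sdiff_nbhd_union hS.indep hX)
  have exchanged_ncard := ncard_sdiff_nbhd_union S hX
  have max_ncard := hS.ncard_eq
  omega

lemma IsMaxIndep.sdiff_nbhd_union [Finite V] {G : SimpleGraph V} {S X : Set V}
    (hS : IsMaxIndep G S) (hX : G.IsIndepSet X) (hle : (S ∩ nbhd G X).ncard ≤ (X \ S).ncard) :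
    IsMaxIndep G ((S \ nbhd G X) ∪ X) := by
  have indep := isIndepSet_sdiff_nbhd_union hS.indep hX
  have exchanged_ncard := ncard_sdiff_nbhd_union S hX
  have max_ncard := hS.ncard_eq
  exact ⟨indep, le_antisymm (ncard_le_indepNum indep) (by omega)⟩

lemma IsCriticalIndep.inter_isMaxIndep [Finite V] {G : SimpleGraph V} {X S : Set V}
    (hX : IsCriticalIndep G X) (hS : IsMaxIndep G S) : IsCriticalIndep G (X ∩ S) := by
  rw [isCriticalIndep_iff] at hX ⊢
  refine ⟨hX.1.mono Set.inter_subset_left, ?_⟩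
  have nbhd_subset : nbhd G (X ∩ S) ⊆ nbhd G X \ S := by
    rintro v ⟨u, hu, huv⟩
    exact ⟨⟨u, hu.1, huv⟩, fun hv => hS.indep hu.2 hv huv.ne huv⟩
  have nbhd_ncard_le := Set.ncard_le_ncard nbhd_subset
  have split_X := Set.ncard_inter_add_ncard_sdiff_eq_ncard X S
  have split_nbhd := Set.ncard_inter_add_ncard_sdiff_eq_ncard (nbhd G X) S
  have sdiff_le := hS.ncard_sdiff_le hX.1
  have inter_le := diff_le_critDiff G (X ∩ S)
  have diff_X := hX.2
  rw [Set.inter_comm] at sdiff_le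
  unfold diff at *
  omega

lemma IsMaxIndep.kernel_subset [Finite V] {G : SimpleGraph V} {S : Set V}
    (hS : IsMaxIndep G S) : kernel G ⊆ S :=
  ((isCriticalIndep_kernel G).inter_isMaxIndep hS).kernel_subset.trans Set.inter_subset_right

lemma disjoint_corona_nbhd_kernel [Finite V] (G : SimpleGraph V) :
    Disjoint (corona G) (nbhd G (kernel G)) := by
  refine Set.disjoint_left.2 fun v hv ⟨u, hu, huv⟩ => ?_
  obtain ⟨S, hS, hvS⟩ := (mem_corona_iff G v).1 hv
  exact hS.indep (hS.kernel_subset hu) hvS huv.ne huv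

lemma ncard_kernel_add_ncard_corona_le [Finite V] (G : SimpleGraph V) :
    ((kernel G).ncard + (corona G).ncard : ℤ) ≤ critDiff G + Nat.card V := by
  have disjoint_le : (corona G).ncard + (nbhd G (kernel G)).ncard ≤ Nat.card V := by
    rw [← Set.ncard_univ, ← Set.ncard_union_eq (disjoint_corona_nbhd_kernel G)]
    exact Set.ncard_le_ncard (Set.subset_univ _)
  have diff_eq := diff_kernel G
  unfold diff at diff_eq
  omega

lemma ncard_kernel_add_ncard_corona_eq [Finite V] {G : SimpleGraph V}
    (h : (nbhd G (kernel G))ᶜ ⊆ corona G) :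
    ((kernel G).ncard + (corona G).ncard : ℤ) = critDiff G + Nat.card V := by
  refine le_antisymm (ncard_kernel_add_ncard_corona_le G) ?_
  have compl_le := Set.ncard_le_ncard h
  have diff_eq := diff_kernel G
  have card_compl := Set.ncard_add_ncard_compl (nbhd G (kernel G))
  unfold diff at diff_eq
  omega

/-! ### Matchings as involutions -/

/-- A matching encoded as an involution of the vertices: a saturated vertex is sent to its partner
and an unsaturated one to itself. -/
structure IsMatchingMap (G : SimpleGraph V) (f : V → V) : Prop where
  involutive : Function.Involutive f
  adj : ∀ v, f v ≠ v → G.Adj v (f v)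

/-- The vertices saturated by the matching encoded by `f`. -/
def saturated (f : V → V) : Set V := {v | f v ≠ v}

/-- Maximum matchings, encoded as involutions. They are compared by the number of saturated
vertices, which is twice the number of edges. -/
structure IsMaxMatchingMap (G : SimpleGraph V) (f : V → V) : Prop extends IsMatchingMap G f where
  ncard_le : ∀ g, IsMatchingMap G g → (saturated g).ncard ≤ (saturated f).ncard

/-- The involution `f` encodes the matching `M`. -/
structure Represents {G : SimpleGraph V} (M : G.Subgraph) (f : V → V) : Prop where
  verts_eq : M.verts = saturated f
  adj_iff : ∀ u v, M.Adj u v ↔ f u = v ∧ u ≠ v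

section MatchingMap

variable {G : SimpleGraph V} {M : G.Subgraph} {f g : V → V}

lemma isMatchingMap_id (G : SimpleGraph V) : IsMatchingMap G id :=
  ⟨fun _ => rfl, fun _ h => absurd rfl h⟩

lemma IsMatchingMap.injective (hf : IsMatchingMap G f) : Function.Injective f :=
  hf.involutive.injective

lemma IsMatchingMap.apply_eq_of_apply_eq (hf : IsMatchingMap G f) {a b : V} (h : f a = b) :
    f b = a := h ▸ hf.involutive a

lemma IsMatchingMap.apply_mem_saturated (hf : IsMatchingMap G f) {a : V} (h : a ∈ saturated f) :
    f a ∈ saturated f := fun h' => h (hf.injective h')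

/-- The matching encoded by an involution, as a subgraph. -/
def matchingSubgraph (G : SimpleGraph V) {f : V → V} (hf : IsMatchingMap G f) : G.Subgraph where
  verts := saturated f
  Adj u v := f u = v ∧ u ≠ v
  adj_sub := by
    rintro u _ ⟨rfl, h⟩
    exact hf.adj u h.symm
  edge_vert := by
    rintro u _ ⟨rfl, h⟩
    exact h.symm
  symm := ⟨by
    rintro u _ ⟨rfl, h⟩
    exact ⟨hf.involutive u, h.symm⟩⟩

lemma represents_matchingSubgraph (hf : IsMatchingMap G f) :
    Represents (matchingSubgraph G hf) f :=
  ⟨rfl, fun _ _ => Iff.rfl⟩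

lemma Represents.isMatching (h : Represents M f) : M.IsMatching := by
  intro v hv
  rw [h.verts_eq] at hv
  exact ⟨f v, (h.adj_iff _ _).2 ⟨rfl, Ne.symm hv⟩, fun w hw => ((h.adj_iff _ _).1 hw).1.symm⟩

lemma exists_represents (hM : M.IsMatching) : ∃ f, IsMatchingMap G f ∧ Represents M f := by
  classical
  have partner : ∀ v : V, ∃ w, (v ∈ M.verts → M.Adj v w) ∧ (v ∉ M.verts → w = v) := by
    intro v
    by_cases hv : v ∈ M.verts
    · obtain ⟨w, hw, -⟩ := hM hv
      exact ⟨w, fun _ => hw, fun h => absurd hv h⟩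
    · exact ⟨v, fun h => absurd h hv, fun _ => rfl⟩
  choose f adj_partner eq_self using partner
  have partner_eq : ∀ u v, M.Adj u v → f u = v := fun u v huv =>
    hM.eq_of_adj_left (adj_partner u (M.edge_vert huv)) huv
  have verts_eq : M.verts = saturated f := by
    ext v
    exact ⟨fun hv => (M.adj_sub (adj_partner v hv)).ne',
      fun hv => by_contra fun h => hv (eq_self v h)⟩
  refine ⟨f, ⟨fun v => ?_, fun v hv => ?_⟩, verts_eq,
    fun u v => ⟨fun h => ⟨partner_eq u v h, h.ne⟩, ?_⟩⟩
  · by_cases hv : v ∈ M.verts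
    · exact partner_eq _ _ (adj_partner v hv).symm
    · rw [eq_self v hv, eq_self v hv]
  · exact (adj_partner v (verts_eq ▸ hv)).adj_sub
  · rintro ⟨rfl, h⟩
    exact adj_partner u (verts_eq ▸ h.symm)

lemma two_mul_ncard_edgeSet [Finite V] (hM : M.IsMatching) :
    2 * M.edgeSet.ncard = M.verts.ncard := by
  classical
  have := Fintype.ofFinite V
  have degree_sum := M.coe.sum_degrees_eq_twice_card_edges
  have degree_eq_one : ∀ x : M.verts, M.coe.degree x = 1 := fun x => by
    rw [Subgraph.coe_degree]
    convert Subgraph.isMatching_iff_forall_degree.1 hM _ x.2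
  replace degree_sum := degree_sum.symm.trans
    (Finset.sum_congr rfl fun x _ => by convert degree_eq_one x)
  rw [Finset.sum_const, smul_eq_mul, mul_one, Finset.card_univ] at degree_sum
  rw [← Nat.card_coe_set_eq, ← Nat.card_coe_set_eq, Nat.card_eq_fintype_card (α := M.verts),
    ← degree_sum, ← SimpleGraph.card_edgeSet, ← Nat.card_eq_fintype_card,
    ← Subgraph.image_coe_edgeSet_coe, Nat.card_image_of_injective]
  exact Sym2.map.injective Subtype.val_injective

lemma Represents.two_mul_ncard_edgeSet [Finite V] (h : Represents M f) :
    2 * M.edgeSet.ncard = (saturated f).ncard := by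
  rw [BABGraph.two_mul_ncard_edgeSet h.isMatching, h.verts_eq]

lemma Represents.isMaximumMatching_iff [Finite V] (h : Represents M f) (hf : IsMatchingMap G f) :
    IsMaximumMatching G M ↔ IsMaxMatchingMap G f := by
  have ncard_M := h.two_mul_ncard_edgeSet
  constructor
  · refine fun hM => ⟨hf, fun g hg => ?_⟩
    have edges_le := hM.2 _ (represents_matchingSubgraph hg).isMatching
    have ncard_g := (represents_matchingSubgraph hg).two_mul_ncard_edgeSet
    omega
  · refine fun hmax => ⟨h.isMatching, fun M' hM' => ?_⟩
    obtain ⟨g, hg, hr⟩ := exists_represents hM'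
    have saturated_le := hmax.ncard_le _ hg
    have ncard_g := hr.two_mul_ncard_edgeSet
    omega

lemma exists_isMaxMatchingMap [Finite V] (G : SimpleGraph V) : ∃ f, IsMaxMatchingMap G f := by
  obtain ⟨f, hf, hmax⟩ := Set.exists_max_image {f : V → V | IsMatchingMap G f}
    (fun f => (saturated f).ncard) (Set.toFinite _) ⟨_, isMatchingMap_id G⟩
  exact ⟨f, hf, hmax⟩

lemma mem_geD_iff [Finite V] (G : SimpleGraph V) (v : V) :
    v ∈ geD G ↔ ∃ f, IsMaxMatchingMap G f ∧ f v = v := by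
  constructor
  · rintro ⟨M, hM, hv⟩
    obtain ⟨f, hf, hr⟩ := exists_represents hM.1
    rw [hr.verts_eq] at hv
    exact ⟨f, (hr.isMaximumMatching_iff hf).1 hM, not_not.1 hv⟩
  · rintro ⟨f, hf, hv⟩
    exact ⟨_, ((represents_matchingSubgraph hf.1).isMaximumMatching_iff hf.1).2 hf, not_not.2 hv⟩

lemma two_mul_matchingNum [Finite V] (hf : IsMaxMatchingMap G f) :
    2 * matchingNum G = (saturated f).ncard := by
  have hr := represents_matchingSubgraph hf.1
  have hM := (hr.isMaximumMatching_iff hf.1).2 hf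
  have isGreatest : IsGreatest {n | ∃ M : G.Subgraph, M.IsMatching ∧ M.edgeSet.ncard = n}
      (matchingSubgraph G hf.1).edgeSet.ncard :=
    ⟨⟨_, hM.1, rfl⟩, by rintro _ ⟨M', hM', rfl⟩; exact hM.2 M' hM'⟩
  rw [matchingNum, isGreatest.csSup_eq, hr.two_mul_ncard_edgeSet]

lemma IsMatchingMap.even_ncard_saturated [Finite V] (hf : IsMatchingMap G f) :
    Even (saturated f).ncard :=
  ⟨_, by rw [← two_mul]; exact (represents_matchingSubgraph hf).two_mul_ncard_edgeSet.symm⟩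

lemma IsMaxMatchingMap.ncard_eq (hf : IsMaxMatchingMap G f) (hg : IsMaxMatchingMap G g) :
    (saturated f).ncard = (saturated g).ncard :=
  le_antisymm (hg.2 _ hf.1) (hf.2 _ hg.1)

lemma IsMaxMatchingMap.of_ncard_le (hf : IsMaxMatchingMap G f) (hg : IsMatchingMap G g)
    (h : (saturated f).ncard ≤ (saturated g).ncard) : IsMaxMatchingMap G g :=
  ⟨hg, fun k hk => (hf.2 k hk).trans h⟩

lemma ncard_saturated_add_ncard_fixed [Finite V] (f : V → V) :
    (saturated f).ncard + {v | f v = v}.ncard = Nat.card V := by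
  rw [← Set.ncard_add_ncard_compl (saturated f)]
  simp only [saturated, Set.compl_ofPred, ne_eq, not_not]

lemma ncard_add_ncard_saturated_le [Finite V] (hf : Function.Injective f) {X Y : Set V}
    (hXY : ∀ v ∈ X, f v ≠ v → f v ∈ Y) :
    X.ncard + (saturated f).ncard ≤ Y.ncard + Nat.card V := by
  have saturated_le : (X ∩ saturated f).ncard ≤ Y.ncard :=
    Set.ncard_le_ncard_of_injOn f (fun v hv => hXY v hv.1 hv.2) hf.injOn
  have fixed_le : (X \ saturated f).ncard ≤ {v | f v = v}.ncard :=
    Set.ncard_le_ncard fun v hv => not_not.1 hv.2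
  have split_X := Set.ncard_inter_add_ncard_sdiff_eq_ncard X (saturated f)
  have card_V := ncard_saturated_add_ncard_fixed f
  omega

lemma IsMatchingMap.two_mul_ncard_add_le [Finite V] (hf : IsMatchingMap G f) {S : Set V}
    (hS : G.IsIndepSet S) : 2 * S.ncard + (saturated f).ncard ≤ 2 * Nat.card V := by
  have matched_out : ∀ v ∈ S, f v ≠ v → f v ∈ Sᶜ :=
    fun v hv hne h => hS hv h hne.symm (hf.adj v hne)
  have count := ncard_add_ncard_saturated_le hf.injective matched_out
  have card_V := Set.ncard_add_ncard_compl S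
  omega

lemma IsMatchingMap.diff_add_le [Finite V] (hf : IsMatchingMap G f) (X : Set V) :
    diff G X + (saturated f).ncard ≤ Nat.card V := by
  have count := ncard_add_ncard_saturated_le (Y := nbhd G X) hf.injective
    fun v hv hne => ⟨v, hv, hf.adj v hne⟩
  unfold diff
  omega

lemma indepNum_add_matchingNum_le [Finite V] (G : SimpleGraph V) :
    G.indepNum + matchingNum G ≤ Nat.card V := by
  obtain ⟨S, hS⟩ := exists_isMaxIndep G
  obtain ⟨f, hf⟩ := exists_isMaxMatchingMap G
  have indep_le := hf.two_mul_ncard_add_le hS.indep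
  have matching_ncard := two_mul_matchingNum hf
  have indep_ncard := hS.ncard_eq
  omega

lemma critDiff_add_two_mul_matchingNum_le [Finite V] (G : SimpleGraph V) :
    critDiff G + 2 * matchingNum G ≤ Nat.card V := by
  obtain ⟨X, hX⟩ := exists_diff_eq_critDiff G
  obtain ⟨f, hf⟩ := exists_isMaxMatchingMap G
  have diff_le := hf.diff_add_le X
  have matching_ncard := two_mul_matchingNum hf
  omega

end MatchingMap

section Gluing

variable {G : SimpleGraph V} {f g : V → V} {Q : Set V}

lemma IsMatchingMap.notMem_of_mapsTo (hf : IsMatchingMap G f) (hQ : ∀ v ∈ Q, f v ∈ Q) {v : V}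
    (hv : v ∉ Q) : f v ∉ Q := fun h => hv (hf.involutive v ▸ hQ _ h)

lemma IsMatchingMap.piecewise [∀ v, Decidable (v ∈ Q)] (hf : IsMatchingMap G f)
    (hg : IsMatchingMap G g) (hfQ : ∀ v ∈ Q, f v ∈ Q) (hgQ : ∀ v ∉ Q, g v ∉ Q) :
    IsMatchingMap G (Q.piecewise f g) := by
  refine ⟨fun v => ?_, fun v hv => ?_⟩ <;> by_cases h : v ∈ Q
  · rw [Set.piecewise_eq_of_mem _ _ _ h, Set.piecewise_eq_of_mem _ _ _ (hfQ v h), hf.involutive]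
  · rw [Set.piecewise_eq_of_notMem _ _ _ h, Set.piecewise_eq_of_notMem _ _ _ (hgQ v h),
      hg.involutive]
  · rw [Set.piecewise_eq_of_mem _ _ _ h] at hv ⊢
    exact hf.adj v hv
  · rw [Set.piecewise_eq_of_notMem _ _ _ h] at hv ⊢
    exact hg.adj v hv

lemma saturated_piecewise [∀ v, Decidable (v ∈ Q)] (f g : V → V) :
    saturated (Q.piecewise f g) = (saturated f ∩ Q) ∪ (saturated g \ Q) := by
  ext v
  by_cases h : v ∈ Q <;> simp [saturated, h]

lemma ncard_saturated_piecewise [Finite V] [∀ v, Decidable (v ∈ Q)] (f g : V → V) :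
    (saturated (Q.piecewise f g)).ncard = (saturated f ∩ Q).ncard + (saturated g \ Q).ncard := by
  rw [saturated_piecewise, Set.ncard_union_eq]
  exact Set.disjoint_left.2 fun v hv hv' => hv'.2 hv.2

end Gluing

section Augmenting

variable {G : SimpleGraph V} {f : V → V} {e u : V}

lemma isMatchingMap_swap [DecidableEq V] (h : G.Adj e u) : IsMatchingMap G (Equiv.swap e u) := by
  refine ⟨fun v => Equiv.swap_apply_self e u v, fun v hv => ?_⟩
  rcases Equiv.swap_apply_ne_self_iff.1 hv with ⟨-, rfl | rfl⟩
  · rwa [Equiv.swap_apply_left]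
  · rw [Equiv.swap_apply_right]
    exact h.symm

lemma saturated_swap [DecidableEq V] (h : e ≠ u) : saturated (Equiv.swap e u) = {e, u} := by
  ext v
  exact Equiv.swap_apply_ne_self_iff.trans (and_iff_right h)

lemma IsMatchingMap.exists_augment (hf : IsMatchingMap G f) (he : f e = e) (hu : f u = u)
    (h : G.Adj e u) :
    ∃ g, IsMatchingMap G g ∧ saturated g = {e, u} ∪ saturated f ∧ g e = u ∧ g u = e ∧
      ∀ v, v ≠ e → v ≠ u → g v = f v := by
  classical
  have fixed : ∀ v ∈ ({e, u} : Set V), f v = v := by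
    rintro v (rfl | rfl)
    exacts [he, hu]
  have swap_mapsTo : ∀ v ∈ ({e, u} : Set V), Equiv.swap e u v ∈ ({e, u} : Set V) := by
    rintro v (rfl | rfl) <;> simp
  have f_mapsTo : ∀ v ∈ ({e, u} : Set V), f v ∈ ({e, u} : Set V) := fun v hv =>
    (fixed v hv).symm ▸ hv
  refine ⟨({e, u} : Set V).piecewise (Equiv.swap e u) f,
    (isMatchingMap_swap h).piecewise hf swap_mapsTo fun v => hf.notMem_of_mapsTo f_mapsTo, ?_,
    by simp, by simp, fun v hve hvu => by simp [hve, hvu]⟩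
  have disjoint : Disjoint (saturated f) {e, u} :=
    Set.disjoint_left.2 fun v hv hv' => hv (fixed v hv')
  rw [saturated_piecewise, saturated_swap h.ne, Set.inter_self, disjoint.sdiff_eq_left]

lemma IsMaxMatchingMap.not_adj [Finite V] (hf : IsMaxMatchingMap G f) (he : f e = e)
    (hu : f u = u) : ¬ G.Adj e u := by
  intro h
  obtain ⟨g, hg, saturated_eq, -⟩ := hf.toIsMatchingMap.exists_augment he hu h
  have subset : saturated f ⊆ saturated g := saturated_eq ▸ Set.subset_union_right
  have mem : e ∈ saturated g := saturated_eq ▸ Or.inl (Or.inl rfl)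
  exact (Set.ncard_lt_ncard ((Set.ssubset_iff_of_subset subset).2 ⟨e, mem, not_not.2 he⟩)).not_ge
    (hf.ncard_le g hg)

end Augmenting

/-- For an unsaturated vertex `e` adjacent to `u` and the partner `x` of `u`, the matching obtained
from `f` by exchanging the edge `ux` for `ue`: it is `f` conjugated by the transposition of `e` and
`x`. -/
def exchange [DecidableEq V] (f : V → V) (e x : V) : V → V :=
  fun v => Equiv.swap e x (f (Equiv.swap e x v))

section Exchange

variable [DecidableEq V] {G : SimpleGraph V} {f : V → V} {e u x : V}

lemma exchange_apply_self (hx : f u = x) (hue : u ≠ e) (hux : u ≠ x) : exchange f e x u = e := by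
  simp only [exchange, Equiv.swap_apply_of_ne_of_ne hue hux, hx, Equiv.swap_apply_right]

lemma exchange_apply_left (hf : IsMatchingMap G f) (hx : f u = x) (hue : u ≠ e) (hux : u ≠ x) :
    exchange f e x e = u := by
  simp only [exchange, Equiv.swap_apply_left, hf.apply_eq_of_apply_eq hx,
    Equiv.swap_apply_of_ne_of_ne hue hux]

lemma exchange_apply_right (he : f e = e) : exchange f e x x = x := by
  simp only [exchange, Equiv.swap_apply_right, he, Equiv.swap_apply_left]

lemma exchange_apply_of_ne (hf : IsMatchingMap G f) (hx : f u = x) (he : f e = e) {v : V}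
    (hve : v ≠ e) (hvx : v ≠ x) (hvu : v ≠ u) : exchange f e x v = f v := by
  have image_ne_e : f v ≠ e := fun h => hve (hf.injective (h.trans he.symm))
  have image_ne_x : f v ≠ x := fun h => hvu (hf.injective (h.trans hx.symm))
  simp only [exchange, Equiv.swap_apply_of_ne_of_ne hve hvx,
    Equiv.swap_apply_of_ne_of_ne image_ne_e image_ne_x]

lemma isMatchingMap_exchange (hf : IsMatchingMap G f) (hx : f u = x) (he : f e = e) (hux : u ≠ x)
    (h : G.Adj e u) : IsMatchingMap G (exchange f e x) := by
  refine ⟨fun v => by simp only [exchange, Equiv.swap_apply_self, hf.involutive _],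
    fun v hv => ?_⟩
  rcases eq_or_ne v e with rfl | hve
  · rwa [exchange_apply_left hf hx h.ne' hux]
  rcases eq_or_ne v x with rfl | hvx
  · exact absurd (exchange_apply_right he) hv
  rcases eq_or_ne v u with rfl | hvu
  · rw [exchange_apply_self hx h.ne' hux]
    exact h.symm
  · rw [exchange_apply_of_ne hf hx he hve hvx hvu] at hv ⊢
    exact hf.adj v hv

lemma ncard_saturated_exchange (f : V → V) (e x : V) :
    (saturated (exchange f e x)).ncard = (saturated f).ncard := by
  have saturated_eq : saturated (exchange f e x) = Equiv.swap e x '' saturated f := by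
    ext v
    rw [Equiv.image_eq_preimage_symm, Equiv.symm_swap]
    simp only [saturated, exchange, Set.mem_ofPred_eq, Set.mem_preimage, ne_eq, not_iff_not]
    rw [Equiv.swap_apply_eq_iff]
  rw [saturated_eq, Set.ncard_image_of_injective _ (Equiv.injective _)]

lemma isMaxMatchingMap_exchange (hf : IsMaxMatchingMap G f) (hx : f u = x) (he : f e = e)
    (hux : u ≠ x) (h : G.Adj e u) : IsMaxMatchingMap G (exchange f e x) :=
  hf.of_ncard_le (isMatchingMap_exchange hf.toIsMatchingMap hx he hux h)
    (ncard_saturated_exchange f e x).ge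

end Exchange

/-! ### Matchings between two disjoint sets, and Hall's theorem with deficiency -/

lemma exists_injective_of_ncard_le_add {ι α : Type*} [Finite ι] [Finite α] {t : ι → Set α}
    {d : ℕ} (h : ∀ Y : Set ι, Y.ncard ≤ (⋃ a ∈ Y, t a).ncard + d) :
    ∃ (A₀ : Set ι) (m : A₀ → α), Function.Injective m ∧ (∀ a : A₀, m a ∈ t a) ∧
      A₀ᶜ.ncard ≤ d := by
  classical
  have := Fintype.ofFinite ι
  have := Fintype.ofFinite α
  -- `d` new elements, available to all, make Hall's condition hold.
  let t' : ι → Finset (α ⊕ Fin d) := fun a => (t a).toFinset.disjSum Finset.univ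
  have hall : ∀ s : Finset ι, s.card ≤ (s.biUnion t').card := by
    intro s
    rcases s.eq_empty_or_nonempty with rfl | ⟨a₀, ha₀⟩
    · simp
    have subset : (⋃ a ∈ s, t a).toFinset.disjSum (Finset.univ : Finset (Fin d)) ⊆
        s.biUnion t' := by
      rintro (x | x) hx
      · simpa [t'] using hx
      · exact Finset.mem_biUnion.2 ⟨a₀, ha₀, by simp [t']⟩
    have card_le := Finset.card_le_card subset
    have hs := h s
    rw [Finset.card_disjSum, Finset.card_univ, Fintype.card_fin,
      ← Set.ncard_eq_toFinset_card'] at card_le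
    rw [Set.ncard_coe_finset] at hs
    exact hs.trans card_le
  obtain ⟨φ, hφ, hφt⟩ := (Finset.all_card_le_biUnion_card_iff_exists_injective t').1 hall
  refine ⟨{a | (φ a).isLeft}, fun a => (φ a).getLeft a.2, fun a b hab => ?_, fun a => ?_, ?_⟩
  · refine Subtype.ext (hφ ?_)
    rw [← Sum.inl_getLeft (φ a) a.2, ← Sum.inl_getLeft (φ b) b.2]
    exact congrArg _ hab
  · have mem := hφt a
    rw [← Sum.inl_getLeft (φ a) a.2, Finset.inl_mem_disjSum, Set.mem_toFinset] at mem
    exact mem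
  · have maps_new : Set.MapsTo φ {a | (φ a).isLeft}ᶜ (Set.range Sum.inr) := fun a ha =>
      ⟨(φ a).getRight (by simpa using ha), Sum.inr_getRight _ _⟩
    refine (Set.ncard_le_ncard_of_injOn φ maps_new hφ.injOn).trans ?_
    rw [← Set.image_univ, Set.ncard_image_of_injective _ Sum.inr_injective, Set.ncard_univ,
      Nat.card_eq_fintype_card, Fintype.card_fin]

/-- Matchings (encoded as involutions) all of whose edges join `A` and `B`. -/
structure IsMatchingBetween (G : SimpleGraph V) (A B : Set V) (f : V → V) : Prop where
  isMatchingMap : IsMatchingMap G f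
  left : ∀ v ∈ A, f v ≠ v → f v ∈ B
  right : ∀ v ∈ B, f v ≠ v → f v ∈ A
  off : ∀ v, v ∉ A → v ∉ B → f v = v

section MatchingBetween

variable {G : SimpleGraph V} {A B : Set V} {f : V → V}

lemma IsMatchingBetween.symm (h : IsMatchingBetween G A B f) : IsMatchingBetween G B A f :=
  ⟨h.isMatchingMap, h.right, h.left, fun v hvB hvA => h.off v hvA hvB⟩

lemma IsMatchingBetween.saturated_subset (h : IsMatchingBetween G A B f) :
    saturated f ⊆ A ∪ B := by
  intro v hv
  by_contra hAB
  exact hv (h.off v (fun hA => hAB (Or.inl hA)) fun hB => hAB (Or.inr hB))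

lemma IsMatchingBetween.ncard_inter_saturated_le [Finite V] (h : IsMatchingBetween G A B f) :
    (A ∩ saturated f).ncard ≤ (B ∩ saturated f).ncard :=
  Set.ncard_le_ncard_of_injOn f (fun v hv =>
    ⟨h.left v hv.1 hv.2, h.isMatchingMap.apply_mem_saturated hv.2⟩) h.isMatchingMap.injective.injOn

lemma IsMatchingBetween.ncard_saturated [Finite V] (h : IsMatchingBetween G A B f)
    (hAB : Disjoint A B) : (saturated f).ncard = 2 * (A ∩ saturated f).ncard := by
  have same_ncard := le_antisymm h.ncard_inter_saturated_le h.symm.ncard_inter_saturated_le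
  have split : (A ∩ saturated f) ∪ (B ∩ saturated f) = saturated f := by
    rw [← Set.union_inter_distrib_right, Set.inter_eq_right.2 h.saturated_subset]
  rw [← split, Set.ncard_union_eq (hAB.mono Set.inter_subset_left Set.inter_subset_left),
    ← same_ncard, split, two_mul]

lemma IsMatchingBetween.ncard_le [Finite V] (h : IsMatchingBetween G A B f) {Y : Set V}
    (hY : Y ⊆ A) : Y.ncard + (A ∩ saturated f).ncard ≤ (nbhd G Y ∩ B).ncard + A.ncard := by
  have matched_le : (Y ∩ saturated f).ncard ≤ (nbhd G Y ∩ B).ncard :=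
    Set.ncard_le_ncard_of_injOn f (fun v hv => ⟨⟨v, hv.1, h.isMatchingMap.adj v hv.2⟩,
      h.left v (hY hv.1) hv.2⟩) h.isMatchingMap.injective.injOn
  have unmatched_le : (Y \ saturated f).ncard ≤ (A \ saturated f).ncard :=
    Set.ncard_le_ncard (Set.sdiff_subset_sdiff_left hY)
  have split_Y := Set.ncard_inter_add_ncard_sdiff_eq_ncard Y (saturated f)
  have split_A := Set.ncard_inter_add_ncard_sdiff_eq_ncard A (saturated f)
  omega

lemma isMatchingBetween_of_isMatchingMap_between (hAB : Disjoint A B)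
    (hf : IsMatchingMap (G.between A B) f) : IsMatchingBetween G A B f where
  isMatchingMap := ⟨hf.involutive, fun v hv => between_le (hf.adj v hv)⟩
  left v hvA hv := ((hf.adj v hv).2.resolve_right fun h => Set.disjoint_left.1 hAB hvA h.1).2
  right v hvB hv := ((hf.adj v hv).2.resolve_left fun h => Set.disjoint_left.1 hAB h.1 hvB).2
  off v hvA hvB := by
    by_contra hv
    exact (hf.adj v hv).2.elim (fun h => hvA h.1) fun h => hvB h.1

lemma exists_isMatchingBetween_of_injective (hAB : Disjoint A B) {A₀ : Set A} {m : A₀ → V}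
    (hm : Function.Injective m) (hB : ∀ a, m a ∈ B) (hadj : ∀ a : A₀, G.Adj a (m a)) :
    ∃ f, IsMatchingBetween G A B f ∧ A ∩ saturated f = Subtype.val '' A₀ := by
  have image_subset : Subtype.val '' A₀ ⊆ A := Subtype.coe_image_subset A A₀
  have range_subset : Set.range m ⊆ B := Set.range_subset_iff.2 hB
  have adj : ∀ v : (Subtype.val '' A₀ : Set V), (G.between A B).Adj v
      (Equiv.ofInjective m hm ((Equiv.Set.image _ A₀ Subtype.val_injective).symm v)) := by
    intro v
    obtain ⟨a, rfl⟩ := (Equiv.Set.image _ A₀ Subtype.val_injective).surjective v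
    rw [Equiv.symm_apply_apply]
    exact ⟨hadj a, Or.inl ⟨a.1.2, hB a⟩⟩
  obtain ⟨M, verts_eq, hM⟩ := Subgraph.IsMatching.exists_of_disjoint_sets_of_equiv
    (hAB.mono image_subset range_subset)
    ((Equiv.Set.image _ A₀ Subtype.val_injective).symm.trans (Equiv.ofInjective m hm)) adj
  obtain ⟨f, hf, hr⟩ := exists_represents hM
  refine ⟨f, isMatchingBetween_of_isMatchingMap_between hAB hf, ?_⟩
  rw [← hr.verts_eq, verts_eq, Set.inter_union_distrib_left, Set.inter_eq_right.2 image_subset,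
    (hAB.mono_right range_subset).inter_eq, Set.union_empty]

lemma exists_isMatchingBetween_of_ncard_le [Finite V] {d : ℕ} (hAB : Disjoint A B)
    (h : ∀ Y ⊆ A, Y.ncard ≤ (nbhd G Y ∩ B).ncard + d) :
    ∃ f, IsMatchingBetween G A B f ∧ A.ncard ≤ (A ∩ saturated f).ncard + d := by
  have hall : ∀ Y : Set A, Y.ncard ≤ (⋃ a ∈ Y, G.neighborSet a ∩ B).ncard + d := fun Y => by
    have image_le := h (Subtype.val '' Y) (Subtype.coe_image_subset A Y)
    have nbhd_eq : nbhd G (Subtype.val '' Y) ∩ B = ⋃ a ∈ Y, G.neighborSet a ∩ B := by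
      ext v
      constructor
      · rintro ⟨⟨_, ⟨a, ha, rfl⟩, hav⟩, hv⟩
        exact Set.mem_biUnion ha ⟨hav, hv⟩
      · simp only [Set.mem_iUnion]
        rintro ⟨a, ha, hav, hv⟩
        exact ⟨⟨a, ⟨a, ha, rfl⟩, hav⟩, hv⟩
    rwa [Set.ncard_image_of_injective _ Subtype.val_injective, nbhd_eq] at image_le
  obtain ⟨A₀, m, hm, hmem, compl_le⟩ := exists_injective_of_ncard_le_add hall
  obtain ⟨f, hf, inter_eq⟩ := exists_isMatchingBetween_of_injective hAB hm
    (fun a => (hmem a).2) fun a => (hmem a).1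
  refine ⟨f, hf, ?_⟩
  have card_A := Set.ncard_add_ncard_compl A₀
  rw [Nat.card_coe_set_eq] at card_A
  rw [inter_eq, Set.ncard_image_of_injective _ Subtype.val_injective]
  omega

lemma ncard_inter_nbhd_add_le [Finite V] (G : SimpleGraph V) (B X Y : Set V) :
    (nbhd G (X ∪ Y) ∩ B).ncard + (nbhd G (X ∩ Y) ∩ B).ncard ≤
      (nbhd G X ∩ B).ncard + (nbhd G Y ∩ B).ncard := by
  have subset : nbhd G (X ∩ Y) ∩ B ⊆ (nbhd G X ∩ B) ∩ (nbhd G Y ∩ B) :=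
    Set.subset_inter (Set.inter_subset_inter_left _ (nbhd_mono G Set.inter_subset_left))
      (Set.inter_subset_inter_left _ (nbhd_mono G Set.inter_subset_right))
  rw [nbhd_union, Set.union_inter_distrib_right,
    ← Set.ncard_union_add_ncard_inter (nbhd G X ∩ B)]
  exact Nat.add_le_add_left (Set.ncard_le_ncard subset) _

lemma exists_minimal_ncard_eq_add [Finite V] (G : SimpleGraph V) (A B : Set V) :
    ∃ (X : Set V) (d : ℕ), X ⊆ A ∧ X.ncard = (nbhd G X ∩ B).ncard + d ∧
      (∀ Y ⊆ A, Y.ncard ≤ (nbhd G Y ∩ B).ncard + d) ∧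
      ∀ Y ⊆ A, Y.ncard = (nbhd G Y ∩ B).ncard + d → X ⊆ Y := by
  let deficiency : Set V → ℤ := fun Y => (Y.ncard : ℤ) - (nbhd G Y ∩ B).ncard
  obtain ⟨X₀, hX₀, hmax⟩ := Set.exists_max_image {Y | Y ⊆ A} deficiency (Set.toFinite _)
    ⟨∅, Set.empty_subset _⟩
  obtain ⟨X, ⟨hXA, hX⟩, hmin⟩ := Set.exists_min_image
    {Y | Y ⊆ A ∧ deficiency Y = deficiency X₀} Set.ncard (Set.toFinite _) ⟨X₀, hX₀, rfl⟩
  have nonneg : 0 ≤ deficiency X₀ := by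
    simpa [deficiency, nbhd] using hmax ∅ (Set.empty_subset _)
  obtain ⟨d, hd⟩ := Int.eq_ofNat_of_zero_le nonneg
  have deficiency_le : ∀ Y ⊆ A, deficiency Y ≤ d := fun Y hY => hd ▸ hmax Y hY
  have eq_iff : ∀ Y, deficiency Y = d ↔ Y.ncard = (nbhd G Y ∩ B).ncard + d := fun Y => by
    simp only [deficiency]
    omega
  refine ⟨X, d, hXA, (eq_iff X).1 (hX.trans hd), fun Y hY => ?_, fun Y hY hYd => ?_⟩
  · have := deficiency_le Y hY
    simp only [deficiency] at this
    omega
  have card_sets := Set.ncard_union_add_ncard_inter X Y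
  have card_nbhds := ncard_inter_nbhd_add_le G B X Y
  have union_le := deficiency_le (X ∪ Y) (Set.union_subset hXA hY)
  have inter_le := deficiency_le (X ∩ Y) (Set.inter_subset_left.trans hXA)
  have inter_eq : deficiency (X ∩ Y) = deficiency X₀ := by
    simp only [deficiency] at *
    omega
  exact Set.inter_eq_left.1 (Set.eq_of_subset_of_ncard_le Set.inter_subset_left
    (hmin (X ∩ Y) ⟨Set.inter_subset_left.trans hXA, inter_eq⟩))

lemma IsMatchingBetween.of_sdiff_singleton {x : V} (h : IsMatchingBetween G (A \ {x}) B f)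
    (hxB : x ∉ B) : IsMatchingBetween G A B f := by
  have fixed : f x = x := h.off x (fun hx => hx.2 rfl) hxB
  refine ⟨h.isMatchingMap, fun v hvA hv => h.left v ⟨hvA, ?_⟩ hv, fun v hvB hv =>
    (h.right v hvB hv).1, fun v hvA => h.off v fun hv => hvA hv.1⟩
  rintro rfl
  exact hv fixed

lemma exists_isMatchingBetween_of_forall_mem [Finite V] {d : ℕ} (hAB : Disjoint A B)
    (h : ∀ Y ⊆ A, Y.ncard ≤ (nbhd G Y ∩ B).ncard + d) {x : V} (hxA : x ∈ A)
    (hx : ∀ Y ⊆ A, Y.ncard = (nbhd G Y ∩ B).ncard + d → x ∈ Y) :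
    ∃ f, IsMatchingBetween G A B f ∧ f x = x ∧ A.ncard ≤ (A ∩ saturated f).ncard + d := by
  have d_ne_zero : d ≠ 0 := by
    rintro rfl
    exact hx ∅ (Set.empty_subset _) (by simp [nbhd])
  have hall : ∀ Y ⊆ A \ {x}, Y.ncard ≤ (nbhd G Y ∩ B).ncard + (d - 1) := fun Y hY => by
    have le := h Y (hY.trans Set.sdiff_subset)
    have ne : Y.ncard ≠ (nbhd G Y ∩ B).ncard + d := fun heq =>
      (hY (hx Y (hY.trans Set.sdiff_subset) heq)).2 rfl
    omega
  obtain ⟨f, hf, ncard_le⟩ :=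
    exists_isMatchingBetween_of_ncard_le (hAB.mono_left Set.sdiff_subset) hall
  have hxB := Set.disjoint_left.1 hAB hxA
  refine ⟨f, hf.of_sdiff_singleton hxB, hf.off x (fun h => h.2 rfl) hxB, ?_⟩
  have ncard_A := Set.ncard_sdiff_singleton_add_one hxA
  have inter_le : (A \ {x} ∩ saturated f).ncard ≤ (A ∩ saturated f).ncard :=
    Set.ncard_le_ncard (Set.inter_subset_inter_left _ Set.sdiff_subset)
  omega

lemma exists_minimal_deficient [Finite V] (G : SimpleGraph V) (hAB : Disjoint A B) :
    ∃ (X : Set V) (d : ℕ), X ⊆ A ∧ X.ncard = (nbhd G X ∩ B).ncard + d ∧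
      (∀ Y ⊆ A, Y.ncard ≤ (nbhd G Y ∩ B).ncard + d) ∧
      (∃ f, IsMatchingBetween G A B f ∧ A.ncard = (A ∩ saturated f).ncard + d) ∧
      ∀ x ∈ X, ∃ f, IsMatchingBetween G A B f ∧ f x = x ∧
        A.ncard = (A ∩ saturated f).ncard + d := by
  obtain ⟨X, d, hXA, hX, hle, hmin⟩ := exists_minimal_ncard_eq_add G A B
  have saturated_le : ∀ f, IsMatchingBetween G A B f → (A ∩ saturated f).ncard + d ≤ A.ncard := by
    intro f hf
    have := hf.ncard_le hXA
    omega
  refine ⟨X, d, hXA, hX, hle, ?_, fun x hx => ?_⟩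
  · obtain ⟨f, hf, ncard_le⟩ := exists_isMatchingBetween_of_ncard_le hAB hle
    exact ⟨f, hf, le_antisymm ncard_le (saturated_le f hf)⟩
  · obtain ⟨f, hf, hfx, ncard_le⟩ := exists_isMatchingBetween_of_forall_mem hAB hle (hXA hx)
      fun Y hY hYd => hmin Y hY hYd hx
    exact ⟨f, hf, hfx, le_antisymm ncard_le (saturated_le f hf)⟩

end MatchingBetween

/-! ### Bipartite graphs -/

section Bipartite

variable {G : SimpleGraph V} {A B : Set V}

lemma exists_isBipartiteWith_compl (hG : G.IsBipartite) : ∃ A : Set V, G.IsBipartiteWith A Aᶜ := by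
  obtain ⟨A, B, h⟩ := hG.exists_isBipartiteWith
  refine ⟨A, disjoint_compl_right, fun u v huv => ?_⟩
  rcases h.mem_of_adj huv with ⟨hu, hv⟩ | ⟨hu, hv⟩
  · exact Or.inl ⟨hu, Set.disjoint_right.1 h.disjoint hv⟩
  · exact Or.inr ⟨Set.disjoint_right.1 h.disjoint hu, hv⟩

lemma nbhd_subset_of_isBipartiteWith (h : G.IsBipartiteWith A B) {X : Set V} (hX : X ⊆ A) :
    nbhd G X ⊆ B := fun _ ⟨_, hu, huv⟩ => h.mem_of_mem_adj (hX hu) huv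

lemma isIndepSet_of_isBipartiteWith (h : G.IsBipartiteWith A B) : G.IsIndepSet A :=
  fun _ hu _ hv _ huv => Set.disjoint_left.1 h.disjoint hv (h.mem_of_mem_adj hu huv)

lemma IsMatchingMap.isMatchingBetween {f : V → V} (hf : IsMatchingMap G f)
    (h : G.IsBipartiteWith A B) : IsMatchingBetween G A B f :=
  isMatchingBetween_of_isMatchingMap_between h.disjoint
    ⟨hf.involutive, fun v hv => ⟨hf.adj v hv, h.mem_of_adj (hf.adj v hv)⟩⟩

lemma exists_deficient_subset_geD [Finite V] (h : G.IsBipartiteWith A B) :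
    ∃ X ⊆ A, X ⊆ geD G ∧ X.ncard + matchingNum G = (nbhd G X).ncard + A.ncard ∧
      ∀ Y ⊆ A, Y.ncard + matchingNum G ≤ (nbhd G Y).ncard + A.ncard := by
  obtain ⟨X, d, hXA, hX, hle, ⟨f, hf, hfd⟩, hmissed⟩ := exists_minimal_deficient G h.disjoint
  have isMax : ∀ f, IsMatchingBetween G A B f → A.ncard = (A ∩ saturated f).ncard + d →
      IsMaxMatchingMap G f := by
    refine fun f hf hfd => ⟨hf.isMatchingMap, fun g hg => ?_⟩
    have hg' := hg.isMatchingBetween h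
    have ncard_le := hg'.ncard_le hXA
    rw [hf.ncard_saturated h.disjoint, hg'.ncard_saturated h.disjoint]
    omega
  have ncard_f := two_mul_matchingNum (isMax f hf hfd)
  rw [hf.ncard_saturated h.disjoint] at ncard_f
  have inter_eq : ∀ Y ⊆ A, nbhd G Y ∩ B = nbhd G Y := fun Y hY =>
    Set.inter_eq_left.2 (nbhd_subset_of_isBipartiteWith h hY)
  refine ⟨X, hXA, fun x hx => ?_, ?_, fun Y hY => ?_⟩
  · obtain ⟨g, hg, hgx, hgd⟩ := hmissed x hx
    exact (mem_geD_iff G x).2 ⟨g, isMax g hg hgd, hgx⟩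
  · rw [inter_eq X hXA] at hX
    omega
  · have := hle Y hY
    rw [inter_eq Y hY] at this
    omega

lemma isIndepSet_union_sdiff_nbhd (h : G.IsBipartiteWith A B) {X : Set V} (hX : X ⊆ A) :
    G.IsIndepSet (X ∪ (B \ nbhd G X)) := by
  rw [Set.union_comm]
  exact isIndepSet_sdiff_nbhd_union (isIndepSet_of_isBipartiteWith h.symm)
    ((isIndepSet_of_isBipartiteWith h).mono hX)

lemma ncard_union_sdiff_nbhd [Finite V] (h : G.IsBipartiteWith A B) {X : Set V} (hX : X ⊆ A) :
    (X ∪ (B \ nbhd G X)).ncard + (nbhd G X).ncard = X.ncard + B.ncard := by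
  rw [Set.ncard_union_eq (h.disjoint.mono hX Set.sdiff_subset), add_assoc,
    Set.ncard_sdiff_add_ncard_of_subset (nbhd_subset_of_isBipartiteWith h hX)]

lemma exists_isMaxIndep_inter_subset_geD [Finite V] (h : G.IsBipartiteWith A Aᶜ) :
    ∃ S, IsMaxIndep G S ∧ S.ncard + matchingNum G = Nat.card V ∧ S ∩ A ⊆ geD G := by
  obtain ⟨X, hXA, hXD, hX, -⟩ := exists_deficient_subset_geD h
  have indep := isIndepSet_union_sdiff_nbhd h hXA
  have ncard_eq := ncard_union_sdiff_nbhd h hXA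
  have card_A := Set.ncard_add_ncard_compl A
  have indepNum_le := indepNum_add_matchingNum_le G
  have le_indepNum := ncard_le_indepNum indep
  refine ⟨_, ⟨indep, by omega⟩, by omega, ?_⟩
  rintro v ⟨hv | hv, hvA⟩
  · exact hXD hv
  · exact absurd hvA hv.1

lemma exists_subset_geD_diff_eq_critDiff [Finite V] (hG : G.IsBipartite) :
    critDiff G + 2 * matchingNum G = Nat.card V ∧ ∃ Y ⊆ geD G, diff G Y = critDiff G := by
  obtain ⟨A, h⟩ := exists_isBipartiteWith_compl hG
  obtain ⟨X, hXA, hXD, hX, -⟩ := exists_deficient_subset_geD h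
  obtain ⟨Y, hYA, hYD, hY, -⟩ := exists_deficient_subset_geD h.symm
  have card_A := Set.ncard_add_ncard_compl A
  have ncard_union := Set.ncard_union_eq (h.disjoint.mono hXA hYA)
  have nbhd_le := Set.ncard_union_le (nbhd G X) (nbhd G Y)
  rw [← nbhd_union] at nbhd_le
  have critDiff_le := critDiff_add_two_mul_matchingNum_le G
  have le_critDiff := diff_le_critDiff G (X ∪ Y)
  unfold diff at le_critDiff
  refine ⟨by omega, X ∪ Y, Set.union_subset hXD hYD, ?_⟩
  unfold diff
  omega

lemma sdiff_nbhd_kernel_subset_corona [Finite V] (h : G.IsBipartiteWith A Aᶜ) :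
    Aᶜ \ nbhd G (kernel G) ⊆ corona G := by
  have inter_subset : kernel G ∩ A ⊆ A := Set.inter_subset_right
  have sdiff_subset : kernel G \ A ⊆ Aᶜ := fun v hv => hv.2
  obtain ⟨-, -, -, -, left_le⟩ := exists_deficient_subset_geD h
  obtain ⟨-, -, -, -, right_le⟩ := exists_deficient_subset_geD h.symm
  have inter_le := left_le _ inter_subset
  have sdiff_le := right_le _ sdiff_subset
  have split_kernel := Set.ncard_inter_add_ncard_sdiff_eq_ncard (kernel G) A
  have split_nbhd : (nbhd G (kernel G)).ncard =
      (nbhd G (kernel G ∩ A)).ncard + (nbhd G (kernel G \ A)).ncard := by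
    rw [← Set.ncard_union_eq (h.symm.disjoint.mono (nbhd_subset_of_isBipartiteWith h inter_subset)
      (nbhd_subset_of_isBipartiteWith h.symm sdiff_subset)), ← nbhd_union, Set.inter_union_sdiff]
  have diff_eq := diff_kernel G
  have critDiff_eq := (exists_subset_geD_diff_eq_critDiff h.isBipartite).1
  have card_A := Set.ncard_add_ncard_compl A
  have indep := isIndepSet_union_sdiff_nbhd h inter_subset
  have ncard_eq := ncard_union_sdiff_nbhd h inter_subset
  have le_indepNum := ncard_le_indepNum indep
  have indepNum_le := indepNum_add_matchingNum_le G
  unfold diff at diff_eq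
  rintro v ⟨hvA, hv⟩
  refine (mem_corona_iff G v).2 ⟨_, ⟨indep, by omega⟩, Or.inr ⟨hvA, fun hv' => hv ?_⟩⟩
  exact nbhd_mono G Set.inter_subset_left hv'

lemma compl_nbhd_kernel_subset_corona [Finite V] (hG : G.IsBipartite) :
    (nbhd G (kernel G))ᶜ ⊆ corona G := by
  obtain ⟨A, h⟩ := exists_isBipartiteWith_compl hG
  intro v hv
  by_cases hvA : v ∈ A
  · exact sdiff_nbhd_kernel_subset_corona (A := Aᶜ) (by rw [compl_compl]; exact h.symm)
      ⟨not_not.2 hvA, hv⟩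
  · exact sdiff_nbhd_kernel_subset_corona h ⟨hvA, hv⟩

lemma two_mul_indepNum_of_isBipartite [Finite V] (hG : G.IsBipartite) :
    (2 * G.indepNum : ℤ) = critDiff G + Nat.card V := by
  obtain ⟨A, h⟩ := exists_isBipartiteWith_compl hG
  obtain ⟨S, hS, ncard_eq, -⟩ := exists_isMaxIndep_inter_subset_geD h
  have critDiff_eq := (exists_subset_geD_diff_eq_critDiff hG).1
  have := hS.ncard_eq
  omega

end Bipartite

/-! ### Odd cycles -/

lemma isCycle_cons_of_even {G : SimpleGraph V} {u v : V} {p : G.Walk v u} (h : G.Adj u v)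
    (hp : p.IsPath) (he : Even p.length) : (Walk.cons h p).IsCycle := by
  have length_ne_zero : p.length ≠ 0 := fun h0 => h.ne (Walk.eq_of_length_eq_zero h0).symm
  refine Walk.isCycle_iff_isPath_tail_and_le_length.2 ⟨by simpa using hp, ?_⟩
  rw [Walk.length_cons]
  obtain ⟨n, hn⟩ := he
  omega

lemma even_length_bypass_iff [DecidableEq V] {G : SimpleGraph V} (hG : ∀ C, ¬ IsOddCycle G C)
    {u v : V} (p : G.Walk u v) : Even p.bypass.length ↔ Even p.length := by
  induction p with
  | nil => rfl
  | @cons u v w h p ih =>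
    rw [Walk.bypass, Walk.length_cons, Nat.even_add_one, ← ih]
    split_ifs with hs
    · have length_split := congrArg Walk.length (p.bypass.take_spec hs)
      rw [Walk.length_append] at length_split
      have odd_take : ¬ Even (p.bypass.takeUntil u hs).length := fun he =>
        hG _ ⟨u, _, isCycle_cons_of_even h (p.bypass_isPath.takeUntil hs) he,
          by rw [Walk.length_cons]; exact he.add_one, rfl⟩
      rw [← length_split, Nat.even_add]
      tauto
    · rw [Walk.length_cons, Nat.even_add_one]

lemma exists_coloring_of_forall_not_isOddCycle {G : SimpleGraph V}
    (hG : ∀ C, ¬ IsOddCycle G C) : ∃ col : V → Bool, ∀ u v, G.Adj u v → col u ≠ col v := by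
  classical
  have colorable : G.Colorable 2 := two_colorable_iff_forall_loop_even.2 fun u w => by
    rw [← even_length_bypass_iff hG w, (Walk.isPath_iff_nil.1 w.bypass_isPath).eq_nil]
    exact Even.zero
  obtain ⟨c⟩ := colorable
  exact ⟨fun v => finTwoEquiv (c v), fun u v huv h => c.valid huv (finTwoEquiv.injective h)⟩

lemma exists_saturated_eq_support {G : SimpleGraph V} : ∀ {u v : V} (p : G.Walk u v), p.IsPath →
    Odd p.length → ∃ f, IsMatchingMap G f ∧ saturated f = {x | x ∈ p.support} ∧
      ∀ x ∈ p.support, s(x, f x) ∈ p.edges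
  | _, _, .nil, _, hodd => absurd hodd Nat.not_odd_zero
  | u, v, .cons h .nil, _, _ => by
    classical
    refine ⟨Equiv.swap u v, isMatchingMap_swap h, ?_, ?_⟩
    · rw [saturated_swap h.ne]
      ext x
      simp
    · simp
  | u, _, .cons (v := a) h (.cons (v := b) h' q), hp, hodd => by
    rw [Walk.cons_isPath_iff, Walk.cons_isPath_iff] at hp
    obtain ⟨⟨hq, haq⟩, hu⟩ := hp
    rw [Walk.length_cons, Walk.length_cons, Nat.odd_add_one, Nat.odd_add_one, not_not] at hodd
    obtain ⟨f, hf, hfs, hfe⟩ := exists_saturated_eq_support q hq hodd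
    have huq : u ∉ q.support := fun hx => hu (List.mem_cons_of_mem _ hx)
    have fixed : ∀ x ∉ q.support, f x = x := fun x hx =>
      not_not.1 fun hne => hx (hfs.subset hne)
    obtain ⟨g, hg, hgs, hgu, hga, hgf⟩ := hf.exists_augment (fixed u huq) (fixed a haq) h
    refine ⟨g, hg, ?_, fun x hx => ?_⟩
    · rw [hgs, hfs]
      ext x
      simp [or_assoc]
    · rw [Walk.support_cons, Walk.support_cons, List.mem_cons, List.mem_cons] at hx
      rcases hx with rfl | rfl | hx
      · simp [hgu]
      · simp [hga, Sym2.eq_swap]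
      · rw [hgf x (by rintro rfl; exact huq hx) (by rintro rfl; exact haq hx)]
        exact List.mem_cons_of_mem _ (List.mem_cons_of_mem _ (hfe x hx))

section OddCycle

variable {G : SimpleGraph V} {C : G.Subgraph}

lemma IsOddCycle.map {W : Type*} {H : SimpleGraph W} (hC : IsOddCycle G C) {φ : G →g H}
    (hφ : Function.Injective φ) : IsOddCycle H (C.map φ) := by
  obtain ⟨v, c, hc, hodd, rfl⟩ := hC
  exact ⟨φ v, c.map φ, hc.map hφ, by rwa [Walk.length_map], Walk.toSubgraph_map φ c⟩

lemma exists_eq_cons_concat {v : V} {c : G.Walk v v} (hc : ¬ c.Nil) :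
    ∃ (a z : V) (h : G.Adj v a) (q : G.Walk a z) (h' : G.Adj z v),
      c = Walk.cons h (q.concat h') := by
  cases c with
  | nil => exact absurd Walk.Nil.nil hc
  | cons h p =>
    have not_nil : ¬ p.Nil := fun hn => h.ne hn.eq.symm
    exact ⟨_, _, h, p.dropLast, p.adj_penultimate not_nil, by rw [Walk.concat_dropLast]⟩

lemma IsOddCycle.exists_path (hC : IsOddCycle G C) {w : V} (hw : w ∈ C.verts) :
    ∃ (a z : V) (q : G.Walk a z), q.IsPath ∧ Odd q.length ∧ w ∉ q.support ∧
      C.Adj w a ∧ C.Adj z w ∧ (∀ x, x ∈ C.verts ↔ x = w ∨ x ∈ q.support) ∧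
      ∀ e ∈ q.edges, e ∈ C.edgeSet := by
  classical
  obtain ⟨v, c, hc, hodd, rfl⟩ := hC
  rw [Walk.mem_verts_toSubgraph] at hw
  replace hc := hc.rotate hw
  replace hodd : Odd (c.rotate w hw).length := by rwa [Walk.length_rotate]
  rw [← Walk.toSubgraph_rotate c hw]
  obtain ⟨a, z, h, q, h', eq_cons⟩ := exists_eq_cons_concat hc.not_nil
  rw [eq_cons] at hc hodd ⊢
  have path := (Walk.cons_isCycle_iff _ _).1 hc |>.1
  rw [Walk.concat_isPath_iff] at path
  rw [Walk.length_cons, Walk.length_concat, Nat.odd_add_one, Nat.odd_add_one, not_not] at hodd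
  refine ⟨a, z, q, path.1, hodd, path.2, ?_, ?_, fun x => ?_, fun e he => ?_⟩
  · simp
  · simp [Walk.adj_toSubgraph_iff_mem_edges, Walk.edges_concat]
  · simp only [Walk.mem_verts_toSubgraph, Walk.support_cons, Walk.support_concat,
      List.mem_cons, List.mem_append, List.not_mem_nil, or_false]
    tauto
  · simp [he]

lemma IsOddCycle.exists_nearPerfect (hC : IsOddCycle G C) {w : V} (hw : w ∈ C.verts) :
    ∃ f, IsMatchingMap G f ∧ saturated f = C.verts \ {w} ∧
      ∀ x ∈ C.verts, x ≠ w → C.Adj x (f x) := by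
  obtain ⟨a, z, q, hq, hodd, hwq, -, -, verts_iff, edges_mem⟩ := hC.exists_path hw
  obtain ⟨f, hf, hfs, hfe⟩ := exists_saturated_eq_support q hq hodd
  refine ⟨f, hf, ?_, fun x hx hxw =>
    edges_mem _ (hfe x (((verts_iff x).1 hx).resolve_left hxw))⟩
  rw [hfs]
  ext x
  rw [Set.mem_sdiff, verts_iff, Set.mem_singleton_iff]
  exact ⟨fun hx => ⟨Or.inr hx, fun hxw => hwq (hxw ▸ hx)⟩, fun hx => hx.1.resolve_left hx.2⟩

lemma IsOddCycle.nonempty (hC : IsOddCycle G C) : C.verts.Nonempty := by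
  obtain ⟨v, c, -, -, rfl⟩ := hC
  exact ⟨v, c.start_mem_verts_toSubgraph⟩

lemma IsOddCycle.exists_adj (hC : IsOddCycle G C) {w : V} (hw : w ∈ C.verts) :
    ∃ x, C.Adj w x := by
  obtain ⟨a, -, -, -, -, -, h, -⟩ := hC.exists_path hw
  exact ⟨a, h⟩

lemma IsOddCycle.exists_ne (hC : IsOddCycle G C) (w : V) : ∃ x ∈ C.verts, x ≠ w := by
  obtain ⟨v, hv⟩ := hC.nonempty
  rcases eq_or_ne v w with rfl | h
  · obtain ⟨x, hx⟩ := hC.exists_adj hv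
    exact ⟨x, hx.snd_mem, hx.ne.symm⟩
  · exact ⟨v, hv, h⟩

lemma IsOddCycle.ncard_edgeSet (hC : IsOddCycle G C) :
    C.edgeSet.ncard = C.verts.ncard := by
  classical
  obtain ⟨v, c, hc, -, rfl⟩ := hC
  have edgeSet_eq : c.toSubgraph.edgeSet = (c.edges.toFinset : Set (Sym2 V)) := by
    ext e
    simp
  have verts_eq : c.toSubgraph.verts = (c.support.tail.toFinset : Set V) := by
    ext x
    rw [Walk.mem_verts_toSubgraph, List.coe_toFinset, Set.mem_ofPred_eq]
    refine ⟨fun hx => ?_, List.mem_of_mem_tail⟩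
    rcases c.mem_support_iff.1 hx with rfl | hx
    exacts [Walk.end_mem_tail_support hc.not_nil, hx]
  rw [edgeSet_eq, verts_eq, Set.ncard_coe_finset, Set.ncard_coe_finset,
    List.toFinset_card_of_nodup hc.edges_nodup, List.toFinset_card_of_nodup hc.support_nodup,
    List.length_tail, Walk.length_support, Walk.length_edges, Nat.add_sub_cancel]

lemma IsOddCycle.odd_ncard [Finite V] (hC : IsOddCycle G C) : Odd C.verts.ncard := by
  obtain ⟨w, hw⟩ := hC.nonempty
  obtain ⟨f, hf, hfs, -⟩ := hC.exists_nearPerfect hw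
  rw [← Set.ncard_sdiff_singleton_add_one hw, ← hfs]
  exact hf.even_ncard_saturated.add_one

lemma IsOddCycle.ncard_le_nbhd [Finite V] (hC : IsOddCycle G C) {Y : Set V} (hY : Y ⊆ C.verts) :
    Y.ncard ≤ (nbhd G Y ∩ C.verts).ncard := by
  by_cases h : C.verts ⊆ Y
  · refine Set.ncard_le_ncard fun v hv => ?_
    obtain ⟨x, hx⟩ := hC.exists_adj (hY hv)
    exact ⟨⟨x, h hx.snd_mem, hx.adj_sub.symm⟩, hY hv⟩
  · obtain ⟨w, hw, hwY⟩ := Set.not_subset.1 h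
    obtain ⟨f, hf, -, hadj⟩ := hC.exists_nearPerfect hw
    refine Set.ncard_le_ncard_of_injOn f (fun v hv => ?_) hf.injective.injOn
    have adj := hadj v (hY hv) (by rintro rfl; exact hwY hv)
    exact ⟨⟨v, hv, adj.adj_sub⟩, adj.snd_mem⟩

end OddCycle

/-! ### Colourings of a graph with a unique odd cycle -/

section Coloring

variable {H : SimpleGraph V} {C : H.Subgraph}

lemma exists_coloring_off_edge (huniq : ∀ C', IsOddCycle H C' → C' = C) {e : Sym2 V}
    (he : e ∈ C.edgeSet) : ∃ f : V → Bool, ∀ x y, H.Adj x y → s(x, y) ≠ e → f x ≠ f y := by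
  have no_odd_cycle : ∀ C', ¬ IsOddCycle (H.deleteEdges {e}) C' := by
    rintro C' ⟨w, c, hc, hodd, -⟩
    have eq_C := huniq _ ⟨w, c.mapLe (H.deleteEdges_le {e}), hc.mapLe _, by simpa using hodd, rfl⟩
    rw [← eq_C, Walk.mem_edges_toSubgraph, Walk.edges_mapLe_eq_edges] at he
    have mem := c.edges_subset_edgeSet he
    rw [edgeSet_deleteEdges] at mem
    exact mem.2 rfl
  obtain ⟨f, hf⟩ := exists_coloring_of_forall_not_isOddCycle no_odd_cycle
  exact ⟨f, fun x y hxy hne => hf x y (deleteEdges_adj.2 ⟨hxy, hne⟩)⟩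

lemma exists_coloring_off_vertex (hC : IsOddCycle H C) (huniq : ∀ C', IsOddCycle H C' → C' = C)
    {w : V} (hw : w ∈ C.verts) :
    ∃ f : V → Bool, ∀ x y, H.Adj x y → x ≠ w → y ≠ w → f x ≠ f y := by
  obtain ⟨a, ha⟩ := hC.exists_adj hw
  obtain ⟨f, hf⟩ := exists_coloring_off_edge huniq (Subgraph.mem_edgeSet.2 ha)
  refine ⟨f, fun x y hxy hx hy => hf x y hxy fun h => ?_⟩
  rcases Sym2.mem_iff.1 (h ▸ Sym2.mem_mk_left w a : w ∈ s(x, y)) with rfl | rfl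
  exacts [hx rfl, hy rfl]

lemma eq_iff_even_length {f : V → Bool} {a z : V} (q : H.Walk a z)
    (hq : ∀ x y, s(x, y) ∈ q.edges → f x ≠ f y) : f a = f z ↔ Even q.length := by
  induction q with
  | nil => simp
  | @cons x y z h q ih =>
    have color_ne := hq x y (by simp)
    rw [Walk.length_cons, Nat.even_add_one, ← ih fun x' y' he => hq x' y' (by simp [he])]
    revert color_ne
    cases f x <;> cases f y <;> cases f z <;> decide

lemma eq_iff_even_length_of_coloring {f : V → Bool} {e : Sym2 V}
    (hf : ∀ x y, H.Adj x y → s(x, y) ≠ e → f x ≠ f y) {a z : V} (q : H.Walk a z)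
    (hq : e ∉ q.edges) : f a = f z ↔ Even q.length :=
  eq_iff_even_length q fun x y hxy => hf x y (q.adj_of_mem_edges hxy) fun h => hq (h ▸ hxy)

lemma xor_eq_xor_of_coloring {f₁ f₂ : V → Bool} {e₁ e₂ : Sym2 V}
    (hf₁ : ∀ x y, H.Adj x y → s(x, y) ≠ e₁ → f₁ x ≠ f₁ y)
    (hf₂ : ∀ x y, H.Adj x y → s(x, y) ≠ e₂ → f₂ x ≠ f₂ y) {a z : V} (q : H.Walk a z)
    (hq₁ : e₁ ∉ q.edges) (hq₂ : e₂ ∉ q.edges) : (f₁ a ^^ f₂ a) = (f₁ z ^^ f₂ z) := by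
  have parity := (eq_iff_even_length_of_coloring hf₁ q hq₁).trans
    (eq_iff_even_length_of_coloring hf₂ q hq₂).symm
  revert parity
  cases f₁ a <;> cases f₁ z <;> cases f₂ a <;> cases f₂ z <;> decide

lemma exists_separating (hC : IsOddCycle H C) (huniq : ∀ C', IsOddCycle H C' → C' = C) {w : V}
    (hw : w ∈ C.verts) :
    ∃ Z : Set V, Z ∩ C.verts = {w} ∧ ∀ x y, H.Adj x y → ¬ C.Adj x y → (x ∈ Z ↔ y ∈ Z) := by
  classical
  obtain ⟨a, z, q, -, hodd, hwq, hwa, hzw, verts_iff, -⟩ := hC.exists_path hw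
  -- Two colourings, each proper off one cycle edge at `w`, differ by the indicator of `Z`.
  obtain ⟨f₁, hf₁⟩ := exists_coloring_off_edge huniq (Subgraph.mem_edgeSet.2 hwa)
  obtain ⟨f₂, hf₂⟩ := exists_coloring_off_edge huniq (Subgraph.mem_edgeSet.2 hzw)
  have wa_notMem : s(w, a) ∉ q.edges := fun h => hwq (q.fst_mem_support_of_mem_edges h)
  have zw_notMem : s(z, w) ∉ q.edges := fun h => hwq (q.snd_mem_support_of_mem_edges h)
  have ends_ne₁ : f₁ a ≠ f₁ z := fun h => Nat.not_even_iff_odd.2 hodd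
    ((eq_iff_even_length_of_coloring hf₁ q wa_notMem).1 h)
  have a_ne_z : a ≠ z := fun h => ends_ne₁ (congrArg f₁ h)
  have edges_ne : s(w, a) ≠ s(z, w) := by
    rw [Sym2.eq_swap, Ne, Sym2.congr_left]
    exact a_ne_z
  have mem_Z : (f₁ w ^^ f₂ w) ≠ (f₁ a ^^ f₂ a) := by
    have wa_ne₂ := hf₂ w a hwa.adj_sub edges_ne
    have zw_ne₁ := hf₁ z w hzw.adj_sub edges_ne.symm
    revert wa_ne₂ zw_ne₁ ends_ne₁
    cases f₁ w <;> cases f₁ a <;> cases f₁ z <;> cases f₂ w <;> cases f₂ a <;> decide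
  refine ⟨{x | (f₁ x ^^ f₂ x) ≠ (f₁ a ^^ f₂ a)}, ?_, fun x y hxy hnot => ?_⟩
  · refine Set.Subset.antisymm (fun x hx => by_contra fun hxw => hx.1 ?_) ?_
    · have hxq := ((verts_iff x).1 hx.2).resolve_left hxw
      exact (xor_eq_xor_of_coloring hf₁ hf₂ (q.takeUntil x hxq)
        (fun h => wa_notMem (q.edges_takeUntil_subset_edges hxq h))
        fun h => zw_notMem (q.edges_takeUntil_subset_edges hxq h)).symm
    · rintro x rfl
      exact ⟨mem_Z, hw⟩
  · have xy_ne₁ := hf₁ x y hxy fun h => hnot (Subgraph.mem_edgeSet.1 (h ▸ hwa))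
    have xy_ne₂ := hf₂ x y hxy fun h => hnot (Subgraph.mem_edgeSet.1 (h ▸ hzw))
    rw [Set.mem_ofPred_eq, Set.mem_ofPred_eq, Bool.eq_not.2 xy_ne₁, Bool.eq_not.2 xy_ne₂,
      Bool.not_xor_not]

lemma exists_contracted_coloring (hC : IsOddCycle H C)
    (huniq : ∀ C', IsOddCycle H C' → C' = C) :
    ∃ A : Set V, Disjoint A C.verts ∧
      ∀ x y, H.Adj x y → ¬ C.Adj x y → (x ∈ A ↔ y ∉ A) := by
  classical
  choose! Z hZ hZadj using fun w (hw : w ∈ C.verts) => exists_separating hC huniq hw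
  obtain ⟨v, hv⟩ := hC.nonempty
  obtain ⟨a, ha⟩ := hC.exists_adj hv
  obtain ⟨f, hf⟩ := exists_coloring_off_edge huniq (Subgraph.mem_edgeSet.2 ha)
  -- Flip the colouring `f` on the branches that hang off the cycle vertices of colour `true`.
  refine ⟨{x | ¬ (f x = true ↔ ∃ w ∈ C.verts, x ∈ Z w ∧ f w = true)},
    Set.disjoint_left.2 fun x hxA hx => hxA ⟨fun h => ?_, ?_⟩, fun x y hxy hnot => ?_⟩
  · exact ⟨x, hx, ((hZ x hx).symm.subset rfl).1, h⟩
  · rintro ⟨w, hw, hxZ, hfw⟩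
    rwa [show x = w from (hZ w hw).subset ⟨hxZ, hx⟩]
  · have flip_iff : (∃ w ∈ C.verts, x ∈ Z w ∧ f w = true) ↔
        ∃ w ∈ C.verts, y ∈ Z w ∧ f w = true :=
      exists_congr fun w => and_congr_right fun hw => by rw [hZadj w hw x y hxy hnot]
    have color_ne := hf x y hxy fun h => hnot (Subgraph.mem_edgeSet.1 (h ▸ ha))
    rw [Set.mem_ofPred_eq, Set.mem_ofPred_eq, flip_iff]
    revert color_ne
    cases f x <;> cases f y <;> simp

end Coloring

/-! ### Blossoms and flowers in terms of matching maps -/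

/-- Blossoms for a matching map: `f` matches the vertices of `C` other than the base `b` along edges
of `C`. -/
structure IsBlossomMap {G : SimpleGraph V} (f : V → V) (C : G.Subgraph) (b : V) : Prop where
  mem : b ∈ C.verts
  base : ¬ C.Adj b (f b)
  adj : ∀ x ∈ C.verts, x ≠ b → C.Adj x (f x)

/-- Alternating walks for a matching map, when the last vertex is unsaturated: an edge is in the
matching iff the number of edges after it is odd. -/
def AlternatesTo {G : SimpleGraph V} (f : V → V) : ∀ {u v : V}, G.Walk u v → Prop
  | _, _, .nil => True
  | u, _, .cons (v := a) _ q => (f u = a ↔ Odd q.length) ∧ AlternatesTo f q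

/-- Flowers for a matching map: `C` is a blossom with stem `p`. -/
structure IsFlowerMap {G : SimpleGraph V} (f : V → V) (C : G.Subgraph) {b r : V} (p : G.Walk b r) :
    Prop where
  blossom : IsBlossomMap f C b
  path : p.IsPath
  alt : AlternatesTo f p
  even : Even p.length
  root : f r = r
  meet : ∀ v ∈ p.support, v ∈ C.verts → v = b

section Flowers

variable {G : SimpleGraph V} {f : V → V} {C : G.Subgraph}

lemma IsMatchingMap.exists_restrict_subgraph (hf : IsMatchingMap G f) (C : G.Subgraph) :
    ∃ h, IsMatchingMap G h ∧ saturated h = {x | C.Adj x (f x)} ∧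
      ∀ x, C.Adj x (f x) → h x = f x := by
  classical
  have mapsTo : ∀ x ∈ {x | C.Adj x (f x)}, f x ∈ {x | C.Adj x (f x)} := fun x (hx : C.Adj _ _) => by
    rw [Set.mem_ofPred_eq, hf.involutive]
    exact hx.symm
  refine ⟨_, hf.piecewise (isMatchingMap_id G) mapsTo fun _ hx => hx, ?_,
    fun x hx => Set.piecewise_eq_of_mem _ _ _ hx⟩
  rw [saturated_piecewise]
  ext x
  simp only [saturated, id, ne_eq, not_true_eq_false, Set.mem_union, Set.mem_inter_iff,
    Set.mem_sdiff, Set.mem_ofPred_eq, false_and, or_false, and_iff_right_iff_imp]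
  exact fun hx => hx.ne.symm

lemma IsMatchingMap.ncard_adj_lt [Finite V] (hf : IsMatchingMap G f) (hC : IsOddCycle G C) :
    {x | C.Adj x (f x)}.ncard < C.verts.ncard := by
  obtain ⟨h, hh, saturated_eq, -⟩ := hf.exists_restrict_subgraph C
  have even := hh.even_ncard_saturated
  rw [saturated_eq] at even
  refine (Set.ncard_le_ncard fun x (hx : C.Adj _ _) => hx.fst_mem).lt_of_ne fun h => ?_
  exact Nat.not_odd_iff_even.2 (h ▸ even) hC.odd_ncard

lemma IsMatchingMap.ncard_adj_eq [Finite V] (hf : IsMatchingMap G f) {M : G.Subgraph}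
    (hM : Represents M f) (C : G.Subgraph) :
    {x | C.Adj x (f x)}.ncard = 2 * (C.edgeSet ∩ M.edgeSet).ncard := by
  obtain ⟨h, hh, saturated_eq, h_eq⟩ := hf.exists_restrict_subgraph C
  have rep := represents_matchingSubgraph hh
  rw [← saturated_eq, ← rep.two_mul_ncard_edgeSet]
  congr 2
  ext ⟨x, y⟩
  have mem_saturated_iff : h x ≠ x ↔ C.Adj x (f x) := Set.ext_iff.1 saturated_eq x
  change (matchingSubgraph G hh).Adj x y ↔ C.Adj x y ∧ M.Adj x y
  rw [rep.adj_iff, hM.adj_iff]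
  constructor
  · rintro ⟨rfl, hne⟩
    have adj := mem_saturated_iff.1 hne.symm
    rw [h_eq x adj]
    exact ⟨adj, rfl, adj.ne⟩
  · rintro ⟨adj, rfl, hne⟩
    exact ⟨h_eq x adj, hne⟩

lemma isBlossom_iff [Finite V] (hf : IsMatchingMap G f) (hC : IsOddCycle G C) {M : G.Subgraph}
    (hM : Represents M f) (b : V) : IsBlossom M C b ↔ IsBlossomMap f C b := by
  have base_iff : (∀ w, C.Adj b w → ¬ M.Adj b w) ↔ ¬ C.Adj b (f b) := by
    refine ⟨fun h adj => h _ adj ((hM.adj_iff _ _).2 ⟨rfl, adj.ne⟩), fun h w hw hw' => h ?_⟩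
    rwa [((hM.adj_iff _ _).1 hw').1]
  have subset (hb : ¬ C.Adj b (f b)) : {x | C.Adj x (f x)} ⊆ C.verts \ {b} :=
    fun x (hx : C.Adj x (f x)) => ⟨hx.fst_mem, by rintro rfl; exact hb hx⟩
  rw [IsBlossom, base_iff, hC.ncard_edgeSet, ← hf.ncard_adj_eq hM]
  constructor
  · rintro ⟨-, card_eq, mem, base⟩
    have card_sdiff := Set.ncard_sdiff_singleton_add_one mem
    have adj_eq := Set.eq_of_subset_of_ncard_le (subset base) (by omega)
    exact ⟨mem, base, fun x hx hxb => adj_eq.ge ⟨hx, hxb⟩⟩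
  · rintro ⟨mem, base, adj⟩
    refine ⟨hC, ?_, mem, base⟩
    rw [(subset base).antisymm fun x hx => adj x hx.1 hx.2, Set.ncard_sdiff_singleton_add_one mem]

lemma isAltWalk_iff {M : G.Subgraph} (hM : Represents M f) (hf : IsMatchingMap G f) {v r : V}
    (p : G.Walk v r) (hr : f r = r) : IsAltWalk M p ↔ AlternatesTo f p := by
  have mem_edgeSet_iff : ∀ {x y : V}, G.Adj x y → (s(x, y) ∈ M.edgeSet ↔ f x = y) := by
    intro x y hxy
    rw [Subgraph.mem_edgeSet, hM.adj_iff]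
    exact and_iff_left hxy.ne
  unfold IsAltWalk
  induction p with
  | nil => simp [AlternatesTo]
  | @cons u a w h q ih =>
    cases q with
    | nil =>
      have : f u ≠ a := fun hu => h.ne (by rw [← hf.apply_eq_of_apply_eq hu, hr])
      simp [this, AlternatesTo]
    | @cons _ b _ h' q' =>
      have alt_iff := ih hr
      simp only [Walk.edges_cons, List.isChain_cons_cons] at alt_iff ⊢
      rw [mem_edgeSet_iff h, mem_edgeSet_iff h', AlternatesTo, Walk.length_cons, Nat.odd_add_one]
      exact (and_congr_right' alt_iff).trans (and_congr_left fun alt => by rw [alt.1])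

lemma isFlower_iff [Finite V] (hf : IsMatchingMap G f) (hC : IsOddCycle G C) {M : G.Subgraph}
    (hM : Represents M f) {b r : V} (p : G.Walk b r) : IsFlower M C p ↔ IsFlowerMap f C p := by
  have root_iff : r ∉ M.verts ↔ f r = r := by
    rw [hM.verts_eq]
    exact not_not
  rw [IsFlower, isBlossom_iff hf hC hM, root_iff]
  constructor
  · rintro ⟨blossom, path, alt, even, root, meet⟩
    exact ⟨blossom, path, (isAltWalk_iff hM hf p root).1 alt, even, root, meet⟩
  · rintro ⟨blossom, path, alt, even, root, meet⟩
    exact ⟨blossom, path, (isAltWalk_iff hM hf p root).2 alt, even, root, meet⟩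

lemma mem_reachSet_iff [Finite V] (hC : IsOddCycle G C) (v : V) :
    v ∈ reachSet G C ↔ ∃ (f : V → V) (b r : V) (p : G.Walk b r),
      IsMaxMatchingMap G f ∧ IsFlowerMap f C p ∧ (v ∈ C.verts ∨ v ∈ p.support) := by
  constructor
  · rintro ⟨M, b, r, p, hM, hp, hv⟩
    obtain ⟨f, hf, rep⟩ := exists_represents hM.1
    exact ⟨f, b, r, p, (rep.isMaximumMatching_iff hf).1 hM, (isFlower_iff hf hC rep p).1 hp, hv⟩
  · rintro ⟨f, b, r, p, hf, hp, hv⟩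
    have rep := represents_matchingSubgraph hf.1
    exact ⟨_, b, r, p, (rep.isMaximumMatching_iff hf.1).2 hf, (isFlower_iff hf.1 hC rep p).2 hp, hv⟩

/-! ### Switching along an alternating path -/

lemma AlternatesTo.of_append {u v w : V} {p : G.Walk u v} {q : G.Walk v w}
    (h : AlternatesTo f (p.append q)) : AlternatesTo f q := by
  induction p with
  | nil => exact h
  | cons h' p ih => exact ih h.2

lemma AlternatesTo.congr {g : V → V} {u v : V} {p : G.Walk u v} (hp : AlternatesTo f p)
    (h : ∀ x ∈ p.support, g x = f x) : AlternatesTo g p := by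
  induction p with
  | nil => trivial
  | cons h' p ih =>
    rw [Walk.support_cons] at h
    refine ⟨?_, ih hp.2 fun x hx => h x (List.mem_cons_of_mem _ hx)⟩
    rw [h _ List.mem_cons_self]
    exact hp.1

lemma exists_switch [Finite V] (hf : IsMaxMatchingMap G f) : ∀ {v r : V} (p : G.Walk v r),
    p.IsPath → AlternatesTo f p → Even p.length → f r = r →
    ∃ g, IsMaxMatchingMap G g ∧ g v = v ∧ ∀ x ∉ p.support, g x = f x
  | _, _, .nil, _, _, _, hr => ⟨f, hf, hr, fun _ _ => rfl⟩
  | _, _, .cons _ .nil, _, _, even, _ => by simp at even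
  | v, r, .cons (v := a) h (.cons (v := b) h' q), path, alt, even, hr => by
    classical
    rw [Walk.cons_isPath_iff, Walk.cons_isPath_iff] at path
    have q_even : Even q.length := by
      simpa only [Walk.length_cons, Nat.even_add_one, not_not] using even
    obtain ⟨g, hg, hgb, hoff⟩ := exists_switch hf q path.1.1 alt.2.2 q_even hr
    have hvq : v ∉ q.support := fun hv => path.2 (by simp [hv])
    have hva : f v = a := alt.1.2 (by rw [Walk.length_cons]; exact q_even.add_one)
    have hgv : g v = a := by rw [hoff v hvq, hva]
    have hga : g a = v := hg.1.apply_eq_of_apply_eq hgv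
    refine ⟨exchange g b v, isMaxMatchingMap_exchange hg hga hgb h.ne' h'.symm,
      exchange_apply_right hgb, fun x hx => ?_⟩
    simp only [Walk.support_cons, List.mem_cons, not_or] at hx
    rw [exchange_apply_of_ne hg.1 hga hgb (by rintro rfl; exact hx.2.2 q.start_mem_support)
      hx.1 hx.2.1, hoff x hx.2.2]

lemma IsFlowerMap.exists_base [Finite V] {b r : V} {p : G.Walk b r} (hp : IsFlowerMap f C p)
    (hf : IsMaxMatchingMap G f) : ∃ g, IsMaxMatchingMap G g ∧ IsBlossomMap g C b ∧ g b = b := by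
  obtain ⟨g, hg, hgb, hoff⟩ := exists_switch hf p hp.path hp.alt hp.even hp.root
  refine ⟨g, hg, ⟨hp.blossom.mem, ?_, fun x hx hxb => ?_⟩, hgb⟩
  · rw [hgb]
    exact fun h => h.ne rfl
  · rw [hoff x fun h => hxb (hp.meet x h hx)]
    exact hp.blossom.adj x hx hxb

lemma IsBlossomMap.mapsTo {b : V} (h : IsBlossomMap f C b) (hb : f b = b) :
    ∀ x ∈ C.verts, f x ∈ C.verts := by
  intro x hx
  rcases eq_or_ne x b with rfl | hxb
  · rwa [hb]
  · exact (h.adj x hx hxb).snd_mem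

lemma IsBlossomMap.saturated_inter {b : V} (h : IsBlossomMap f C b) (hb : f b = b) :
    saturated f ∩ C.verts = C.verts \ {b} := by
  ext x
  constructor
  · rintro ⟨x_sat, hx⟩
    exact ⟨hx, by rintro rfl; exact x_sat hb⟩
  · rintro ⟨hx, hxb⟩
    exact ⟨(h.adj x hx hxb).ne.symm, hx⟩

lemma IsBlossomMap.exists_rotate [Finite V] {b : V} (h : IsBlossomMap f C b) (hb : f b = b)
    (hf : IsMaxMatchingMap G f) (hC : IsOddCycle G C) {w : V} (hw : w ∈ C.verts) :
    ∃ g, IsMaxMatchingMap G g ∧ IsBlossomMap g C w ∧ g w = w ∧ ∀ x ∉ C.verts, g x = f x := by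
  classical
  obtain ⟨k, hk, k_saturated, k_adj⟩ := hC.exists_nearPerfect hw
  have hkw : k w = w := not_not.1 fun (h : w ∈ saturated k) => (k_saturated ▸ h).2 rfl
  have blossom : IsBlossomMap k C w := ⟨hw, by rw [hkw]; exact fun h => h.ne rfl, k_adj⟩
  have glued := hk.piecewise hf.1 (blossom.mapsTo hkw) fun v => hf.1.notMem_of_mapsTo (h.mapsTo hb)
  have glued_w : C.verts.piecewise k f w = w := (Set.piecewise_eq_of_mem _ _ _ hw).trans hkw
  refine ⟨C.verts.piecewise k f, hf.of_ncard_le glued ?_, ⟨hw, ?_, fun x hx hxw => ?_⟩, glued_w,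
    fun x hx => Set.piecewise_eq_of_notMem _ _ _ hx⟩
  · rw [ncard_saturated_piecewise, blossom.saturated_inter hkw,
      ← Set.ncard_inter_add_ncard_sdiff_eq_ncard (saturated f) C.verts, h.saturated_inter hb]
    have card_b := Set.ncard_sdiff_singleton_add_one h.mem
    have card_w := Set.ncard_sdiff_singleton_add_one hw
    omega
  · rw [glued_w]
    exact fun h => h.ne rfl
  · rw [Set.piecewise_eq_of_mem _ _ _ hx]
    exact k_adj x hx hxw

lemma IsMatchingMap.ncard_saturated_le [Finite V] (hf : IsMatchingMap G f) {O T : Set V}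
    (h : ∀ v ∈ saturated f, v ∉ O → f v ∉ O → v ∈ T) :
    (saturated f).ncard ≤ 2 * (O ∩ saturated f).ncard + T.ncard := by
  have subset : saturated f ⊆ (O ∩ saturated f) ∪ (f '' (O ∩ saturated f) ∪ T) := by
    intro v hv
    by_cases hO : v ∈ O
    · exact Or.inl ⟨hO, hv⟩
    · by_cases hfO : f v ∈ O
      · exact Or.inr (Or.inl ⟨f v, ⟨hfO, hf.apply_mem_saturated hv⟩, hf.involutive v⟩)
      · exact Or.inr (Or.inr (h v hv hO hfO))
  calc (saturated f).ncard
    _ ≤ (O ∩ saturated f).ncard + ((f '' (O ∩ saturated f)).ncard + T.ncard) :=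
      (Set.ncard_le_ncard subset).trans <| (Set.ncard_union_le _ _).trans <|
        Nat.add_le_add_left (Set.ncard_union_le _ _) _
    _ = 2 * (O ∩ saturated f).ncard + T.ncard := by
      rw [Set.ncard_image_of_injective _ hf.injective]
      ring

lemma exists_next_of_path {u r v : V} (p : G.Walk u r) (hp : p.IsPath) (hv : v ∈ p.support)
    (hvr : v ≠ r) : ∃ y ∈ p.support, y ≠ u ∧ s(v, y) ∈ p.edges := by
  induction p with
  | nil => exact absurd (List.mem_singleton.1 hv) hvr
  | @cons x a z h q ih =>
    rw [Walk.cons_isPath_iff] at hp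
    rcases List.mem_cons.1 (Walk.support_cons h q ▸ hv) with rfl | hv
    · exact ⟨a, by simp, h.ne', by simp⟩
    · obtain ⟨y, hy, -, he⟩ := ih hp.1 hv hvr
      exact ⟨y, by simp [hy], by rintro rfl; exact hp.2 hy, by simp [he]⟩

lemma IsFlowerMap.not_adj_of_mem_edges {b r : V} {p : G.Walk b r} (hp : IsFlowerMap f C p) {x y : V}
    (h : s(x, y) ∈ p.edges) : ¬ C.Adj x y := by
  intro adj
  have hx := hp.meet x (p.fst_mem_support_of_mem_edges h) adj.fst_mem
  have hy := hp.meet y (p.snd_mem_support_of_mem_edges h) adj.snd_mem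
  exact adj.ne (hx.trans hy.symm)

end Flowers

/-! ### Almost bipartite graphs covered by the reach set of their odd cycle -/

section Cycle

variable [Finite V] {H : SimpleGraph V} {C : H.Subgraph}

lemma exists_isIndepSet_subset_verts (hC : IsOddCycle H C)
    (huniq : ∀ C', IsOddCycle H C' → C' = C) {w x : V} (hw : w ∈ C.verts) (hx : x ∈ C.verts)
    (hxw : x ≠ w) : ∃ S ⊆ C.verts, H.IsIndepSet S ∧ w ∉ S ∧ x ∈ S ∧
      2 * S.ncard + 1 = C.verts.ncard := by
  obtain ⟨col, hcol⟩ := exists_coloring_off_vertex hC huniq hw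
  obtain ⟨k, hk, k_saturated, k_adj⟩ := hC.exists_nearPerfect hw
  have k_mem : ∀ y ∈ C.verts \ {w}, k y ∈ C.verts \ {w} := by
    rw [← k_saturated]
    exact fun y hy => hk.apply_mem_saturated hy
  have col_ne : ∀ y ∈ C.verts \ {w}, col y ≠ col (k y) := fun y hy =>
    hcol y _ (k_adj y hy.1 hy.2).adj_sub hy.2 (k_mem y hy).2
  let S : Set V := {y | y ∈ C.verts \ {w} ∧ col y = col x}
  have ncard_le : S.ncard ≤ ((C.verts \ {w}) \ S).ncard :=
    Set.ncard_le_ncard_of_injOn k (fun y hy => ⟨k_mem y hy.1, fun hky =>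
      col_ne y hy.1 (hy.2.trans hky.2.symm)⟩) hk.injective.injOn
  have ncard_ge : ((C.verts \ {w}) \ S).ncard ≤ S.ncard := by
    refine Set.ncard_le_ncard_of_injOn k (fun y hy => ⟨k_mem y hy.1, ?_⟩) hk.injective.injOn
    have y_ne : col y ≠ col x := fun h => hy.2 ⟨hy.1, h⟩
    exact (Bool.not_inj_iff.1
      ((Bool.not_eq.2 (col_ne y hy.1).symm).trans (Bool.not_eq.2 y_ne.symm).symm))
  have ncard_split := Set.ncard_sdiff_add_ncard_of_subset (s := S) (t := C.verts \ {w})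
    fun y hy => hy.1
  have ncard_cycle := Set.ncard_sdiff_singleton_add_one hw
  exact ⟨S, fun y hy => hy.1.1, fun a ha b hb _ hadj =>
    hcol a b hadj ha.1.2 hb.1.2 (ha.2.trans hb.2.symm), fun h => h.1.2 rfl, ⟨⟨hx, hxw⟩, rfl⟩,
    by omega⟩

lemma IsOddCycle.two_mul_ncard_inter_lt (hC : IsOddCycle H C) {S : Set V}
    (hS : H.IsIndepSet S) : 2 * (S ∩ C.verts).ncard < C.verts.ncard := by
  have nbhd_ncard := hC.ncard_le_nbhd (Y := S ∩ C.verts) Set.inter_subset_right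
  have disjoint : Disjoint (S ∩ C.verts) (nbhd H (S ∩ C.verts) ∩ C.verts) :=
    Set.disjoint_left.2 fun v hv ⟨⟨u, hu, huv⟩, _⟩ => hS hu.1 hv.1 huv.ne huv
  have union_le := Set.ncard_le_ncard
    (Set.union_subset Set.inter_subset_right Set.inter_subset_right :
      (S ∩ C.verts) ∪ (nbhd H (S ∩ C.verts) ∩ C.verts) ⊆ C.verts)
  rw [Set.ncard_union_eq disjoint] at union_le
  obtain ⟨m, hm⟩ := hC.odd_ncard
  omega

lemma IsMatchingMap.ncard_saturated_lt {f : V → V} (hf : IsMatchingMap H f)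
    (hC : IsOddCycle H C) {O : Set V}
    (hO : ∀ x y, H.Adj x y → ¬ C.Adj x y → x ∈ O ∨ y ∈ O) :
    (saturated f).ncard < C.verts.ncard + 2 * (O ∩ saturated f).ncard := by
  have covered := hf.ncard_saturated_le (O := O) (T := {x | C.Adj x (f x)})
    fun v hv hvO hfvO => by_contra fun h => (hO v _ (hf.adj v hv) h).elim hvO hfvO
  have on_cycle := hf.ncard_adj_lt hC
  omega

end Cycle

/-- `C` is the only odd cycle of `H`, its reach set is everything, and `A` is one side of a
bipartition of the graph obtained from `H` by contracting `C`, namely the side that does not contain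
`C`. It turns out to be the Gallai–Edmonds set `A(H)`. -/
structure IsReachGraph (H : SimpleGraph V) (C : H.Subgraph) (A : Set V) : Prop where
  odd : IsOddCycle H C
  uniq : ∀ C', IsOddCycle H C' → C' = C
  reach : reachSet H C = Set.univ
  disjoint_cycle : Disjoint A C.verts
  mem_iff_notMem : ∀ x y, H.Adj x y → ¬ C.Adj x y → (x ∈ A ↔ y ∉ A)

lemma exists_isReachGraph {H : SimpleGraph V} (hab : IsAlmostBipartite H)
    (hr : ∀ C, IsOddCycle H C → reachSet H C = Set.univ) :
    ∃ (C : H.Subgraph) (A : Set V), IsReachGraph H C A := by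
  obtain ⟨C, hC, huniq⟩ := hab
  obtain ⟨A, disjoint, mem_iff⟩ := exists_contracted_coloring hC huniq
  exact ⟨C, A, hC, huniq, hr C hC, disjoint, mem_iff⟩

/-- The vertices outside the cycle `C` on the same side as `C` of the bipartition with other
side `A`. -/
def evens {H : SimpleGraph V} (C : H.Subgraph) (A : Set V) : Set V := (A ∪ C.verts)ᶜ

namespace IsReachGraph

variable {H : SimpleGraph V} {C : H.Subgraph} {A : Set V}

lemma notMem_cycle (h : IsReachGraph H C A) {x : V} (hx : x ∈ A) : x ∉ C.verts :=
  Set.disjoint_left.1 h.disjoint_cycle hx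

lemma notMem (h : IsReachGraph H C A) {x : V} (hx : x ∈ C.verts) : x ∉ A :=
  Set.disjoint_right.1 h.disjoint_cycle hx

lemma disjoint_evens (C : H.Subgraph) (A : Set V) : Disjoint A (evens C A) :=
  Set.disjoint_left.2 fun _ hx hx' => hx' (Or.inl hx)

lemma mem_cases (C : H.Subgraph) (A : Set V) (x : V) : x ∈ A ∨ x ∈ evens C A ∨ x ∈ C.verts := by
  have := em (x ∈ A ∪ C.verts)
  rw [Set.mem_union] at this
  simp only [evens, Set.mem_compl_iff, Set.mem_union]
  tauto

lemma adj_evens (h : IsReachGraph H C A) {x y : V} (hx : x ∈ evens C A) (hxy : H.Adj x y) :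
    y ∈ A :=
  not_not.1 fun hy => hx (Or.inl ((h.mem_iff_notMem x y hxy fun h' =>
    hx (Or.inr h'.fst_mem)).2 hy))

lemma adj (h : IsReachGraph H C A) {x y : V} (hx : x ∈ A) (hxy : H.Adj x y) :
    y ∈ evens C A ∨ y ∈ C.verts :=
  (mem_cases C A y).resolve_left
    ((h.mem_iff_notMem x y hxy fun h' => h.notMem_cycle hx h'.fst_mem).1 hx)

lemma isIndepSet (h : IsReachGraph H C A) : H.IsIndepSet A := fun x hx y hy _ hadj =>
  (h.mem_iff_notMem x y hadj fun h' => h.notMem_cycle hx h'.fst_mem).1 hx hy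

lemma isIndepSet_evens_union (h : IsReachGraph H C A) {S : Set V} (hSC : S ⊆ C.verts)
    (hS : H.IsIndepSet S) : H.IsIndepSet (evens C A ∪ S) := by
  have notMem_of_mem : ∀ x ∈ evens C A ∪ S, x ∉ A := by
    rintro x (hx | hx) hxA
    · exact hx (Or.inl hxA)
    · exact h.notMem_cycle hxA (hSC hx)
  rintro x (hx | hx) y hy hxy hadj
  · exact notMem_of_mem y hy (h.adj_evens hx hadj)
  · rcases hy with hy | hy
    · exact notMem_of_mem x (Or.inr hx) (h.adj_evens hy hadj.symm)
    · exact hS hx hy hxy hadj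

lemma isIndepSet_evens (h : IsReachGraph H C A) : H.IsIndepSet (evens C A) := by
  simpa only [Set.union_empty] using
    h.isIndepSet_evens_union (Set.empty_subset _) (Set.pairwise_empty _)

lemma nbhd_evens (h : IsReachGraph H C A) : nbhd H (evens C A) ⊆ A :=
  fun _ ⟨_, hu, huv⟩ => h.adj_evens hu huv

lemma ncard_eq_add [Finite V] (h : IsReachGraph H C A) (Y : Set V) :
    Y.ncard = (Y ∩ A).ncard + (Y ∩ evens C A).ncard + (Y ∩ C.verts).ncard := by
  have split := Set.ncard_inter_add_ncard_sdiff_eq_ncard Y (A ∪ C.verts)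
  rw [Set.inter_union_distrib_left, Set.ncard_union_eq
    (h.disjoint_cycle.mono Set.inter_subset_right Set.inter_subset_right), Set.sdiff_eq] at split
  rw [evens]
  omega

lemma card_eq [Finite V] (h : IsReachGraph H C A) :
    A.ncard + (evens C A).ncard + C.verts.ncard = Nat.card V := by
  rw [← Set.ncard_univ, h.ncard_eq_add Set.univ, Set.univ_inter, Set.univ_inter, Set.univ_inter]

lemma even_length_iff (h : IsReachGraph H C A) {a z : V} (q : H.Walk a z)
    (hq : ∀ x y, s(x, y) ∈ q.edges → ¬ C.Adj x y) : Even q.length ↔ (a ∈ A ↔ z ∈ A) := by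
  classical
  rw [← eq_iff_even_length (f := fun x => decide (x ∈ A)) q fun x y hxy => ?_, decide_eq_decide]
  rw [Ne, decide_eq_decide, h.mem_iff_notMem x y (q.adj_of_mem_edges hxy) (hq x y hxy)]
  tauto

lemma mem_or_mem_of_adj (h : IsReachGraph H C A) {X : Set V}
    (hX : ∀ x ∈ X, ∀ y ∈ C.verts, ¬ H.Adj x y) {x y : V} (hxy : H.Adj x y) (hnot : ¬ C.Adj x y) :
    x ∈ (A \ X) ∪ (nbhd H X ∩ evens C A) ∨ y ∈ (A \ X) ∪ (nbhd H X ∩ evens C A) := by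
  have of_mem : ∀ x ∈ A, ∀ y, H.Adj x y →
      x ∈ (A \ X) ∪ (nbhd H X ∩ evens C A) ∨ y ∈ (A \ X) ∪ (nbhd H X ∩ evens C A) := by
    intro x hx y hxy
    by_cases hxX : x ∈ X
    · exact Or.inr (Or.inr ⟨⟨x, hxX, hxy⟩,
        (h.adj hx hxy).resolve_right fun hy => hX x hxX y hy hxy⟩)
    · exact Or.inl (Or.inl ⟨hx, hxX⟩)
  by_cases hx : x ∈ A
  · exact of_mem x hx y hxy
  · exact (of_mem y (not_not.1 fun hy => hx ((h.mem_iff_notMem x y hxy hnot).2 hy)) x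
      hxy.symm).symm

lemma root_notMem (h : IsReachGraph H C A) {f : V → V} {b r : V} {p : H.Walk b r}
    (hp : IsFlowerMap f C p) : r ∉ A := fun hr =>
  h.notMem hp.blossom.mem
    (((h.even_length_iff p fun _ _ hxy => hp.not_adj_of_mem_edges hxy).1 hp.even).2 hr)

variable [Finite V]

lemma exists_flower (h : IsReachGraph H C A) (v : V) :
    ∃ (f : V → V) (b r : V) (p : H.Walk b r),
      IsMaxMatchingMap H f ∧ IsFlowerMap f C p ∧ (v ∈ C.verts ∨ v ∈ p.support) := by
  rw [← mem_reachSet_iff h.odd, h.reach]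
  trivial

lemma exists_max_base (h : IsReachGraph H C A) {w : V} (hw : w ∈ C.verts) :
    ∃ g, IsMaxMatchingMap H g ∧ IsBlossomMap g C w ∧ g w = w := by
  obtain ⟨f, b, r, p, hf, hp, -⟩ := h.exists_flower w
  obtain ⟨g, hg, hb, hgb⟩ := hp.exists_base hf
  obtain ⟨k, hk, hkw, hkb, -⟩ := hb.exists_rotate hgb hg h.odd hw
  exact ⟨k, hk, hkw, hkb⟩

lemma mem_geD_of_notMem (h : IsReachGraph H C A) {v : V} (hv : v ∉ A) : v ∈ geD H := by
  classical
  obtain ⟨f, b, r, p, hf, hp, hvp⟩ := h.exists_flower v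
  by_cases hvC : v ∈ C.verts
  · obtain ⟨g, hg, -, hgv⟩ := h.exists_max_base hvC
    exact (mem_geD_iff H v).2 ⟨g, hg, hgv⟩
  · have hvs := hvp.resolve_left hvC
    have even : Even (p.dropUntil v hvs).length :=
      (h.even_length_iff _ fun x y hxy => hp.not_adj_of_mem_edges
        (p.edges_dropUntil_subset_edges hvs hxy)).2 (iff_of_false hv (h.root_notMem hp))
    have alt := hp.alt
    rw [← p.take_spec hvs] at alt
    obtain ⟨g, hg, hgv, -⟩ :=
      exists_switch hf _ (hp.path.dropUntil hvs) alt.of_append even hp.root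
    exact (mem_geD_iff H v).2 ⟨g, hg, hgv⟩

lemma exists_adj_evens (h : IsReachGraph H C A) {v : V} (hv : v ∈ A) :
    ∃ y ∈ evens C A, H.Adj v y := by
  obtain ⟨f, b, r, p, -, hp, hvp⟩ := h.exists_flower v
  have hvs := hvp.resolve_left (h.notMem_cycle hv)
  have v_ne_root : v ≠ r := by
    rintro rfl
    exact h.root_notMem hp hv
  obtain ⟨y, hy, hyb, he⟩ := exists_next_of_path p hp.path hvs v_ne_root
  have hadj := p.adj_of_mem_edges he
  exact ⟨y, (h.adj hv hadj).resolve_right fun hyC => hyb (hp.meet y hy hyC), hadj⟩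

lemma exists_extend (h : IsReachGraph H C A) {f : V → V}
    (hf : IsMatchingBetween H A (evens C A) f) {w : V} (hw : w ∈ C.verts) :
    ∃ g, IsMatchingMap H g ∧ g w = w ∧ (∀ x ∉ C.verts, g x = f x) ∧
      (saturated g).ncard + 1 = C.verts.ncard + 2 * (A ∩ saturated f).ncard := by
  classical
  obtain ⟨k, hk, k_saturated, k_adj⟩ := h.odd.exists_nearPerfect hw
  have hkw : k w = w := not_not.1 fun (h : w ∈ saturated k) => (k_saturated ▸ h).2 rfl
  have blossom : IsBlossomMap k C w := ⟨hw, by rw [hkw]; exact fun h => h.ne rfl, k_adj⟩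
  have f_cycle : ∀ x ∈ C.verts, f x = x := fun x hx =>
    hf.off x (h.notMem hx) fun hxE => hxE (Or.inr hx)
  have f_saturated : saturated f \ C.verts = saturated f :=
    (Set.disjoint_left.2 fun x (hx : f x ≠ x) hxC => hx (f_cycle x hxC)).sdiff_eq_left
  refine ⟨C.verts.piecewise k f, hk.piecewise hf.isMatchingMap (blossom.mapsTo hkw) fun x =>
    hf.isMatchingMap.notMem_of_mapsTo fun y hy => by rwa [f_cycle y hy],
    (Set.piecewise_eq_of_mem _ _ _ hw).trans hkw,
    fun x hx => Set.piecewise_eq_of_notMem _ _ _ hx, ?_⟩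
  rw [ncard_saturated_piecewise, blossom.saturated_inter hkw, f_saturated,
    hf.ncard_saturated (disjoint_evens C A), ← Set.ncard_sdiff_singleton_add_one hw]
  ring

lemma exists_isMaxMatchingMap_ncard_eq (h : IsReachGraph H C A) :
    ∃ f g, IsMaxMatchingMap H f ∧ IsMatchingBetween H A (evens C A) g ∧
      (saturated f).ncard + 1 = C.verts.ncard + 2 * (A ∩ saturated g).ncard := by
  classical
  obtain ⟨w, hw⟩ := h.odd.nonempty
  obtain ⟨f, hf, blossom, hfw⟩ := h.exists_max_base hw
  have isMatching : IsMatchingMap H (C.verts.piecewise id f) :=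
    (isMatchingMap_id H).piecewise hf.1 (fun _ hx => hx) fun _ =>
      hf.1.notMem_of_mapsTo (blossom.mapsTo hfw)
  have fixed : ∀ x ∈ C.verts, C.verts.piecewise id f x = x := fun x hx =>
    Set.piecewise_eq_of_mem _ _ _ hx
  have between : IsMatchingBetween H A (evens C A) (C.verts.piecewise id f) := by
    refine ⟨isMatching, fun x hx hne => ?_, fun x hx hne => h.adj_evens hx (isMatching.adj x hne),
      fun x hxA hxE => fixed x (((mem_cases C A x).resolve_left hxA).resolve_left hxE)⟩
    refine (h.adj hx (isMatching.adj x hne)).resolve_right fun hC => hne ?_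
    exact isMatching.injective (fixed _ hC)
  have ncard_piecewise := ncard_saturated_piecewise (Q := C.verts) id f
  rw [between.ncard_saturated (disjoint_evens C A),
    show saturated (id : V → V) = ∅ by simp [saturated], Set.empty_inter, Set.ncard_empty,
    zero_add] at ncard_piecewise
  have ncard_split := Set.ncard_inter_add_ncard_sdiff_eq_ncard (saturated f) C.verts
  rw [blossom.saturated_inter hfw] at ncard_split
  have ncard_cycle := Set.ncard_sdiff_singleton_add_one hw
  exact ⟨f, _, hf, between, by omega⟩

lemma isMaxMatchingMap_of_ncard_le (h : IsReachGraph H C A) {X : Set V} (hX : X ⊆ A) {g : V → V}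
    (hg : IsMatchingMap H g) (hle : C.verts.ncard + 2 * (A.ncard + (nbhd H X ∩ evens C A).ncard) ≤
      (saturated g).ncard + 1 + 2 * X.ncard) : IsMaxMatchingMap H g := by
  obtain ⟨f, f', hf, between, ncard_f⟩ := h.exists_isMaxMatchingMap_ncard_eq
  have deficiency := between.ncard_le hX
  exact hf.of_ncard_le hg (by omega)

lemma exists_isMatchingBetween (h : IsReachGraph H C A) :
    ∃ f, IsMatchingBetween H A (evens C A) f ∧ A ⊆ saturated f := by
  obtain ⟨X, d, hXA, hXd, -, ⟨f, hf, hfd⟩, avoid⟩ :=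
    exists_minimal_deficient H (disjoint_evens C A)
  obtain ⟨w, hw⟩ := h.odd.nonempty
  obtain ⟨m, hm, -, -, ncard_m⟩ := h.exists_extend hf hw
  -- A maximum matching missing both `x` and `y` shows that there is no edge from `X` to `C`.
  have not_adj_cycle : ∀ x ∈ X, ∀ y ∈ C.verts, ¬ H.Adj x y := by
    intro x hx y hy
    obtain ⟨k, hk, hkx, hkd⟩ := avoid x hx
    obtain ⟨g, hg, hgy, hgk, ncard_g⟩ := h.exists_extend hk hy
    exact (h.isMaxMatchingMap_of_ncard_le hXA hg (by omega)).not_adj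
      (by rw [hgk x (h.notMem_cycle (hXA hx)), hkx]) hgy
  let O : Set V := (A \ X) ∪ (nbhd H X ∩ evens C A)
  have covers : ∀ x y, H.Adj x y → ¬ C.Adj x y → x ∈ O ∨ y ∈ O := fun x y =>
    h.mem_or_mem_of_adj not_adj_cycle
  have X_empty : X = ∅ := by
    refine Set.eq_empty_iff_forall_notMem.2 fun x hx => ?_
    obtain ⟨y, hy, hxy⟩ := h.exists_adj_evens (hXA hx)
    obtain ⟨g, hg, hgy⟩ := (mem_geD_iff H y).1 (h.mem_geD_of_notMem fun hyA => hy (Or.inl hyA))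
    have missed : (O ∩ saturated g).ncard < O.ncard :=
      Set.ncard_lt_ncard (Set.inter_subset_left.ssubset_of_mem_notMem
        (Or.inr ⟨⟨x, hx, hxy⟩, hy⟩) fun h' => h'.2 hgy)
    have ncard_O : O.ncard = (A \ X).ncard + (nbhd H X ∩ evens C A).ncard :=
      Set.ncard_union_eq ((disjoint_evens C A).mono Set.sdiff_subset Set.inter_subset_right)
    have ncard_A := Set.ncard_sdiff_add_ncard_of_subset hXA
    have ncard_g := hg.1.ncard_saturated_lt h.odd covers
    have m_le := hg.2 m hm
    omega
  rw [X_empty, Set.ncard_empty] at hXd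
  exact ⟨f, hf, Set.inter_eq_left.1 (Set.eq_of_subset_of_ncard_le Set.inter_subset_left (by omega))⟩

lemma subset_saturated (h : IsReachGraph H C A) {g : V → V} (hg : IsMaxMatchingMap H g) :
    A ⊆ saturated g := by
  obtain ⟨f, hf, A_saturated⟩ := h.exists_isMatchingBetween
  obtain ⟨w, hw⟩ := h.odd.nonempty
  obtain ⟨m, hm, -, -, ncard_m⟩ := h.exists_extend hf hw
  rw [Set.inter_eq_left.2 A_saturated] at ncard_m
  have ncard_g := hg.1.ncard_saturated_lt h.odd (O := A) fun x y hxy hnot => by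
    have := h.mem_iff_notMem x y hxy hnot
    tauto
  have m_le := hg.2 m hm
  exact Set.inter_eq_left.1 (Set.eq_of_subset_of_ncard_le Set.inter_subset_left (by omega))

lemma mem_geD_iff (h : IsReachGraph H C A) (v : V) : v ∈ geD H ↔ v ∉ A := by
  refine ⟨fun hv hvA => ?_, h.mem_geD_of_notMem⟩
  obtain ⟨g, hg, hgv⟩ := (BABGraph.mem_geD_iff H v).1 hv
  exact h.subset_saturated hg hvA hgv

lemma geA_eq (h : IsReachGraph H C A) : geA H = A := by
  ext v
  refine ⟨fun hv => not_not.1 fun hvA => hv.1 ((h.mem_geD_iff v).2 hvA), fun hv => ?_⟩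
  obtain ⟨y, hy, hvy⟩ := h.exists_adj_evens hv
  exact ⟨fun hvD => (h.mem_geD_iff v).1 hvD hv, y,
    (h.mem_geD_iff y).2 fun hyA => hy (Or.inl hyA), hvy⟩

end IsReachGraph

/-! ### Independent sets, the critical difference and the corona -/
namespace IsReachGraph

variable {H : SimpleGraph V} {C : H.Subgraph} {A : Set V}

lemma exists_class (h : IsReachGraph H C A) {T₀ : Set V} (hT₀ : T₀ ⊆ A) {v : V} (hv : v ∈ T₀) :
    ∃ T ⊆ T₀, v ∈ T ∧ Disjoint (nbhd H T ∩ evens C A) (nbhd H (T₀ \ T) ∩ evens C A) ∧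
      ∃ w ∈ C.verts, ∀ t ∈ T, ∀ y ∈ C.verts, H.Adj t y → y = w := by
  -- Each component of the graph without the edges of `C` meets `C` in at most one vertex, and `T`
  -- is the part of `T₀` in a union of such components.
  choose! Z Z_inter Z_iff using fun w (hw : w ∈ C.verts) => exists_separating h.odd h.uniq hw
  have not_adj : ∀ t ∈ T₀, ∀ y, ¬ C.Adj t y := fun t ht y hty =>
    h.notMem_cycle (hT₀ ht) hty.fst_mem
  refine ⟨{t ∈ T₀ | ∀ w ∈ C.verts, t ∈ Z w ↔ v ∈ Z w}, fun t ht => ht.1,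
    ⟨hv, fun _ _ => Iff.rfl⟩, ?_, ?_⟩
  · refine Set.disjoint_left.2 ?_
    rintro y ⟨⟨t, ht, hty⟩, -⟩ ⟨⟨t', ht', hty'⟩, -⟩
    refine ht'.2 ⟨ht'.1, fun w hw => ?_⟩
    rw [← ht.2 w hw, Z_iff w hw t y hty (not_adj t ht.1 y),
      Z_iff w hw t' y hty' (not_adj t' ht'.1 y)]
  · by_cases hex : ∃ t ∈ T₀, (∀ w ∈ C.verts, t ∈ Z w ↔ v ∈ Z w) ∧ ∃ w ∈ C.verts, H.Adj t w
    · obtain ⟨t, ht, t_iff, w, hw, htw⟩ := hex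
      refine ⟨w, hw, fun t' ht' y hy hty => ?_⟩
      have w_mem : w ∈ Z w := (Z_inter w hw ▸ Set.mem_singleton w : w ∈ Z w ∩ C.verts).1
      have y_mem : y ∈ Z w := by
        rwa [← Z_iff w hw t' y hty (not_adj t' ht'.1 y), ht'.2 w hw, ← t_iff w hw,
          Z_iff w hw t w htw (not_adj t ht w)]
      exact (Z_inter w hw ▸ ⟨y_mem, hy⟩ : y ∈ ({w} : Set V))
    · obtain ⟨w, hw⟩ := h.odd.nonempty
      exact ⟨w, hw, fun t ht y hy hty => absurd ⟨t, ht.1, ht.2, y, hy, hty⟩ hex⟩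

variable [Finite V]

lemma ncard_le_ncard_nbhd_inter_evens (h : IsReachGraph H C A) {Y : Set V} (hY : Y ⊆ A) :
    Y.ncard ≤ (nbhd H Y ∩ evens C A).ncard := by
  obtain ⟨f, hf, A_saturated⟩ := h.exists_isMatchingBetween
  exact Set.ncard_le_ncard_of_injOn f (fun x hx =>
    ⟨⟨x, hx, hf.isMatchingMap.adj x (A_saturated (hY hx))⟩,
      hf.left x (hY hx) (A_saturated (hY hx))⟩) hf.isMatchingMap.injective.injOn

lemma two_mul_ncard_lt (h : IsReachGraph H C A) {S : Set V} (hS : H.IsIndepSet S) :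
    2 * S.ncard < 2 * (evens C A).ncard + C.verts.ncard := by
  have on_cycle := h.odd.two_mul_ncard_inter_lt hS
  have on_A := h.ncard_le_ncard_nbhd_inter_evens (Y := S ∩ A) Set.inter_subset_right
  have disjoint : Disjoint (S ∩ evens C A) (nbhd H (S ∩ A) ∩ evens C A) :=
    Set.disjoint_left.2 fun y hy ⟨⟨x, hx, hxy⟩, _⟩ => hS hx.1 hy.1 hxy.ne hxy
  have union_le := Set.ncard_le_ncard
    (Set.union_subset Set.inter_subset_right Set.inter_subset_right :
      (S ∩ evens C A) ∪ (nbhd H (S ∩ A) ∩ evens C A) ⊆ evens C A)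
  rw [Set.ncard_union_eq disjoint] at union_le
  have ncard_S := h.ncard_eq_add S
  omega

lemma ncard_evens_union (A : Set V) {S : Set V} (hSC : S ⊆ C.verts)
    (hS : 2 * S.ncard + 1 = C.verts.ncard) :
    2 * (evens C A ∪ S).ncard + 1 = 2 * (evens C A).ncard + C.verts.ncard := by
  have disjoint : Disjoint (evens C A) S :=
    Set.disjoint_left.2 fun x (hx : x ∉ A ∪ C.verts) hxS => hx (Or.inr (hSC hxS))
  rw [Set.ncard_union_eq disjoint]
  omega

lemma two_mul_indepNum (h : IsReachGraph H C A) :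
    2 * H.indepNum + 1 = 2 * (evens C A).ncard + C.verts.ncard := by
  obtain ⟨w, hw⟩ := h.odd.nonempty
  obtain ⟨x, hx, hxw⟩ := h.odd.exists_ne w
  obtain ⟨S, hSC, hS, -, -, ncard_S⟩ := exists_isIndepSet_subset_verts h.odd h.uniq hw hx hxw
  obtain ⟨T, hT⟩ := exists_isMaxIndep H
  have lower := ncard_le_indepNum (h.isIndepSet_evens_union hSC hS)
  have upper := h.two_mul_ncard_lt hT.indep
  have ncard_T := hT.ncard_eq
  have ncard_union := ncard_evens_union A hSC ncard_S
  omega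

lemma isMaxIndep_evens_union (h : IsReachGraph H C A) {S : Set V} (hSC : S ⊆ C.verts)
    (hS : H.IsIndepSet S) (ncard_S : 2 * S.ncard + 1 = C.verts.ncard) :
    IsMaxIndep H (evens C A ∪ S) := by
  have ncard_union := ncard_evens_union A hSC ncard_S
  have indepNum_eq := h.two_mul_indepNum
  exact ⟨h.isIndepSet_evens_union hSC hS, by omega⟩

lemma exists_isMaxIndep_disjoint (h : IsReachGraph H C A) {v : V} (hv : v ∉ A) :
    ∃ S, IsMaxIndep H S ∧ v ∈ S ∧ Disjoint S A := by
  obtain ⟨x, w, hx, hw, hxw, hvx⟩ :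
      ∃ x w, x ∈ C.verts ∧ w ∈ C.verts ∧ x ≠ w ∧ (v = x ∨ v ∈ evens C A) := by
    rcases (mem_cases C A v).resolve_left hv with hvE | hvC
    · obtain ⟨x, hx⟩ := h.odd.nonempty
      obtain ⟨w, hw, hwx⟩ := h.odd.exists_ne x
      exact ⟨x, w, hx, hw, hwx.symm, Or.inr hvE⟩
    · obtain ⟨w, hw, hwv⟩ := h.odd.exists_ne v
      exact ⟨v, w, hvC, hw, hwv.symm, Or.inl rfl⟩
  obtain ⟨S, hSC, hS, -, hxS, ncard_S⟩ := exists_isIndepSet_subset_verts h.odd h.uniq hw hx hxw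
  refine ⟨evens C A ∪ S, h.isMaxIndep_evens_union hSC hS ncard_S, ?_,
    (disjoint_evens C A).symm.union_left (h.disjoint_cycle.symm.mono_left hSC)⟩
  exact hvx.symm.imp_right fun hvx : v = x => hvx ▸ hxS

lemma diff_le (h : IsReachGraph H C A) (X : Set V) :
    diff H X ≤ (evens C A).ncard - A.ncard := by
  obtain ⟨f, hf, A_saturated⟩ := h.exists_isMatchingBetween
  have nbhd_le : ∀ Y ⊆ X, ∀ Q : Set V, (nbhd H Y ∩ Q).ncard ≤ (nbhd H X ∩ Q).ncard :=
    fun Y hY Q => Set.ncard_le_ncard (Set.inter_subset_inter_left _ (nbhd_mono H hY))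
  have on_A := h.ncard_le_ncard_nbhd_inter_evens (Y := X ∩ A) Set.inter_subset_right
  have on_A' := nbhd_le (X ∩ A) Set.inter_subset_left (evens C A)
  have on_evens := hf.symm.ncard_le (Y := X ∩ evens C A) Set.inter_subset_right
  have on_evens' := nbhd_le (X ∩ evens C A) Set.inter_subset_left A
  have on_cycle := h.odd.ncard_le_nbhd (Y := X ∩ C.verts) Set.inter_subset_right
  have on_cycle' := nbhd_le (X ∩ C.verts) Set.inter_subset_left C.verts
  have saturated_A := hf.ncard_saturated (disjoint_evens C A)
  have saturated_evens := hf.symm.ncard_saturated (disjoint_evens C A).symm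
  rw [Set.inter_eq_left.2 A_saturated] at saturated_A
  have ncard_X := h.ncard_eq_add X
  have ncard_nbhd := h.ncard_eq_add (nbhd H X)
  unfold diff
  omega

lemma critDiff_eq (h : IsReachGraph H C A) : critDiff H = (evens C A).ncard - A.ncard :=
  critDiff_eq_of_forall_le H h.diff_le
    ⟨evens C A, by have := Set.ncard_le_ncard h.nbhd_evens; unfold diff; omega⟩

lemma diff_evens (h : IsReachGraph H C A) : diff H (evens C A) = critDiff H := by
  have nbhd_le := Set.ncard_le_ncard h.nbhd_evens
  refine le_antisymm (diff_le_critDiff H _) ?_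
  rw [h.critDiff_eq, diff]
  omega

lemma kernel_subset_evens (h : IsReachGraph H C A) : kernel H ⊆ evens C A :=
  ((isCriticalIndep_iff H _).2 ⟨h.isIndepSet_evens, h.diff_evens⟩).kernel_subset

lemma two_mul_indepNum_add_one (h : IsReachGraph H C A) :
    (2 * H.indepNum + 1 : ℤ) = critDiff H + Nat.card V := by
  have indepNum_eq := h.two_mul_indepNum
  have critDiff_eq := h.critDiff_eq
  have card_eq := h.card_eq
  omega

lemma ncard_nbhd_sdiff_nbhd_kernel_le (h : IsReachGraph H C A) :
    (nbhd H (A \ nbhd H (kernel H)) ∩ evens C A).ncard ≤ (A \ nbhd H (kernel H)).ncard := by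
  have nbhd_kernel : nbhd H (kernel H) ⊆ A := (nbhd_mono H h.kernel_subset_evens).trans h.nbhd_evens
  have subset : nbhd H (A \ nbhd H (kernel H)) ∩ evens C A ⊆ evens C A \ kernel H :=
    fun y ⟨⟨t, ht, hty⟩, hyE⟩ => ⟨hyE, fun hyk => ht.2 ⟨y, hyk, hty.symm⟩⟩
  have ncard_evens := Set.ncard_sdiff_add_ncard_of_subset h.kernel_subset_evens
  have ncard_A := Set.ncard_sdiff_add_ncard_of_subset nbhd_kernel
  have ncard_le := Set.ncard_le_ncard subset
  have critical := diff_kernel H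
  rw [h.critDiff_eq, diff] at critical
  omega

lemma ncard_nbhd_le_of_disjoint (h : IsReachGraph H C A) {T T₀ : Set V} (hT : T ⊆ T₀)
    (hT₀ : T₀ ⊆ A) (hle : (nbhd H T₀ ∩ evens C A).ncard ≤ T₀.ncard)
    (hdisj : Disjoint (nbhd H T ∩ evens C A) (nbhd H (T₀ \ T) ∩ evens C A)) :
    (nbhd H T ∩ evens C A).ncard ≤ T.ncard := by
  have nbhd_sub : ∀ Y ⊆ T₀, nbhd H Y ∩ evens C A ⊆ nbhd H T₀ ∩ evens C A := fun Y hY =>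
    Set.inter_subset_inter_left _ (nbhd_mono H hY)
  have union_le := Set.ncard_le_ncard
    (Set.union_subset (nbhd_sub T hT) (nbhd_sub (T₀ \ T) Set.sdiff_subset))
  rw [Set.ncard_union_eq hdisj] at union_le
  have rest_le := h.ncard_le_ncard_nbhd_inter_evens (Set.sdiff_subset.trans hT₀ : T₀ \ T ⊆ A)
  have ncard_T₀ := Set.ncard_sdiff_add_ncard_of_subset hT
  omega

lemma mem_corona_of_mem (h : IsReachGraph H C A) {v : V} (hv : v ∈ A)
    (hvk : v ∉ nbhd H (kernel H)) : v ∈ corona H := by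
  obtain ⟨T, hT, hvT, disjoint, w, hw, contact⟩ := h.exists_class Set.sdiff_subset ⟨hv, hvk⟩
  have hTA : T ⊆ A := hT.trans Set.sdiff_subset
  obtain ⟨x, hx, hxw⟩ := h.odd.exists_ne w
  obtain ⟨S, hSC, hS, hwS, -, ncard_S⟩ := exists_isIndepSet_subset_verts h.odd h.uniq hw hx hxw
  have inter_nbhd : (evens C A ∪ S) ∩ nbhd H T ⊆ nbhd H T ∩ evens C A := by
    rintro y ⟨hyE | hyS, t, ht, hty⟩
    · exact ⟨⟨t, ht, hty⟩, hyE⟩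
    · exact absurd (contact t ht y (hSC hyS) hty ▸ hyS) hwS
  have sdiff_eq : T \ (evens C A ∪ S) = T :=
    (((disjoint_evens C A).mono_left hTA).union_right
      (h.disjoint_cycle.mono hTA hSC)).sdiff_eq_left
  have tight := h.ncard_nbhd_le_of_disjoint hT Set.sdiff_subset h.ncard_nbhd_sdiff_nbhd_kernel_le
    disjoint
  have exchanged := (h.isMaxIndep_evens_union hSC hS ncard_S).sdiff_nbhd_union
    (h.isIndepSet.mono hTA) (by rw [sdiff_eq]; exact (Set.ncard_le_ncard inter_nbhd).trans tight)
  exact (mem_corona_iff H v).2 ⟨_, exchanged, Or.inr hvT⟩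

theorem compl_nbhd_kernel_subset_corona (h : IsReachGraph H C A) :
    (nbhd H (kernel H))ᶜ ⊆ corona H := by
  intro v hv
  by_cases hvA : v ∈ A
  · exact h.mem_corona_of_mem hvA hv
  · obtain ⟨S, hS, hvS, -⟩ := h.exists_isMaxIndep_disjoint hvA
    exact (mem_corona_iff H v).2 ⟨S, hS, hvS⟩

end IsReachGraph

/-! ### Partitioned vertex sets -/

section Partition

variable {ι : Type*} {Q : ι → Set V}

/-- The set that meets each part `Q t` of a partition in the prescribed subset `S t`. -/
def unionParts (S : ∀ t, Set (Q t)) : Set V := ⋃ t, Subtype.val '' S t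

lemma mem_unionParts (S : ∀ t, Set (Q t)) {v : V} :
    v ∈ unionParts S ↔ ∃ t, ∃ h : v ∈ Q t, ⟨v, h⟩ ∈ S t := by
  simp [unionParts]

lemma preimage_unionParts (hQ : Pairwise (Function.onFun Disjoint Q)) (S : ∀ t, Set (Q t)) (t : ι) :
    Subtype.val ⁻¹' unionParts S = S t := by
  ext ⟨v, hv⟩
  rw [Set.mem_preimage, mem_unionParts]
  refine ⟨fun ⟨s, hs, hvS⟩ => ?_, fun hvS => ⟨t, hv, hvS⟩⟩
  obtain rfl | hst := eq_or_ne s t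
  · exact hvS
  · exact absurd hv (Set.disjoint_left.1 (hQ hst) hs)

lemma ncard_eq_sum [Finite V] [Fintype ι] (hQ : Pairwise (Function.onFun Disjoint Q))
    (hcov : ⋃ t, Q t = Set.univ) (Y : Set V) :
    Y.ncard = ∑ t, (Subtype.val ⁻¹' Y : Set (Q t)).ncard := by
  have disjoint : Pairwise (Function.onFun Disjoint
      fun t => Subtype.val '' (Subtype.val ⁻¹' Y : Set (Q t))) := fun _ _ hst =>
    (hQ hst).mono (Subtype.coe_image_subset _ _) (Subtype.coe_image_subset _ _)
  have union_eq : ⋃ t, Subtype.val '' (Subtype.val ⁻¹' Y : Set (Q t)) = Y := by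
    simp_rw [Subtype.image_preimage_coe]
    rw [← Set.iUnion_inter, hcov, Set.univ_inter]
  rw [← finsum_eq_sum_of_fintype]
  conv_lhs => rw [← union_eq]
  rw [Set.ncard_iUnion_of_finite (fun t => Set.toFinite _) disjoint]
  exact finsum_congr fun t => Set.ncard_image_of_injective _ Subtype.val_injective

variable (G : SimpleGraph V)

lemma isIndepSet_preimage_val {S : Set V} (hS : G.IsIndepSet S) (W : Set V) :
    (G.induce W).IsIndepSet (Subtype.val ⁻¹' S) := fun _ hu _ hv huv hadj =>
  hS hu hv (Subtype.coe_injective.ne huv) hadj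

lemma nbhd_induce_subset (Y W : Set V) :
    nbhd (G.induce W) (Subtype.val ⁻¹' Y) ⊆ Subtype.val ⁻¹' nbhd G Y :=
  fun _ ⟨u, hu, huv⟩ => ⟨u, hu, huv⟩

lemma isIndepSet_unionParts (S : ∀ t, Set (Q t)) (hS : ∀ t, (G.induce (Q t)).IsIndepSet (S t))
    (hcross : ∀ s t, s ≠ t → ∀ u ∈ S s, ∀ v ∈ S t, ¬ G.Adj u.1 v.1) :
    G.IsIndepSet (unionParts S) := by
  intro u hu v hv huv hadj
  obtain ⟨s, hs, huS⟩ := (mem_unionParts S).1 hu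
  obtain ⟨t, ht, hvS⟩ := (mem_unionParts S).1 hv
  obtain rfl | hst := eq_or_ne s t
  · exact hS s huS hvS (fun h => huv (congrArg Subtype.val h)) hadj
  · exact hcross s t hst _ huS _ hvS hadj

lemma preimage_nbhd_unionParts_subset (hQ : Pairwise (Function.onFun Disjoint Q))
    {Y : ∀ t, Set (Q t)} (hY : ∀ t, ∀ v ∈ Y t, v.1 ∉ boundary G (Q t)) (t : ι) :
    (Subtype.val ⁻¹' nbhd G (unionParts Y) : Set (Q t)) ⊆ nbhd (G.induce (Q t)) (Y t) := by
  rintro ⟨v, hv⟩ ⟨u, hu, huv⟩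
  obtain ⟨s, hs, huY⟩ := (mem_unionParts Y).1 hu
  obtain rfl | hst := eq_or_ne s t
  · exact ⟨_, huY, huv⟩
  · exact absurd ⟨hs, v, fun hvs => Set.disjoint_left.1 (hQ hst) hvs hv, huv⟩ (hY s _ huY)

variable [Finite V] [Fintype ι]

lemma diff_eq_sum_sub_sum (hQ : Pairwise (Function.onFun Disjoint Q))
    (hcov : ⋃ t, Q t = Set.univ) (Y : Set V) :
    diff G Y = ∑ t, ((Subtype.val ⁻¹' Y : Set (Q t)).ncard : ℤ) -
      ∑ t, ((Subtype.val ⁻¹' nbhd G Y : Set (Q t)).ncard : ℤ) := by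
  rw [diff, ncard_eq_sum hQ hcov Y, ncard_eq_sum hQ hcov (nbhd G Y), Nat.cast_sum, Nat.cast_sum]

lemma diff_le_sum (hQ : Pairwise (Function.onFun Disjoint Q))
    (hcov : ⋃ t, Q t = Set.univ) (Y : Set V) :
    diff G Y ≤ ∑ t, diff (G.induce (Q t)) (Subtype.val ⁻¹' Y) := by
  simp_rw [diff_eq_sum_sub_sum G hQ hcov Y, diff]
  rw [Finset.sum_sub_distrib]
  exact sub_le_sub_left (Finset.sum_le_sum fun t _ => Nat.cast_le.2
    (Set.ncard_le_ncard (nbhd_induce_subset G Y (Q t)))) _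

lemma critDiff_eq_sum (hQ : Pairwise (Function.onFun Disjoint Q)) (hcov : ⋃ t, Q t = Set.univ)
    (h : ∀ t, ∃ Y : Set (Q t), diff (G.induce (Q t)) Y = critDiff (G.induce (Q t)) ∧
      ∀ v ∈ Y, v.1 ∉ boundary G (Q t)) :
    critDiff G = ∑ t, critDiff (G.induce (Q t)) := by
  choose Y hY hY_boundary using h
  refine critDiff_eq_of_forall_le G (fun X => (diff_le_sum G hQ hcov X).trans
    (Finset.sum_le_sum fun t _ => diff_le_critDiff _ _)) ⟨unionParts Y, ?_⟩
  simp_rw [← hY, diff_eq_sum_sub_sum G hQ hcov, preimage_unionParts hQ, diff]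
  rw [Finset.sum_sub_distrib]
  exact sub_le_sub_left (Finset.sum_le_sum fun t _ => Nat.cast_le.2
    (Set.ncard_le_ncard (preimage_nbhd_unionParts_subset G hQ hY_boundary t))) _

lemma indepNum_le_sum (hQ : Pairwise (Function.onFun Disjoint Q)) (hcov : ⋃ t, Q t = Set.univ) :
    G.indepNum ≤ ∑ t, (G.induce (Q t)).indepNum := by
  obtain ⟨S, hS⟩ := exists_isMaxIndep G
  rw [← hS.ncard_eq, ncard_eq_sum hQ hcov S]
  exact Finset.sum_le_sum fun t _ => ncard_le_indepNum (isIndepSet_preimage_val G hS.indep _)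

lemma isMaxIndep_unionParts (hQ : Pairwise (Function.onFun Disjoint Q))
    (hcov : ⋃ t, Q t = Set.univ) {S : ∀ t, Set (Q t)}
    (hS : ∀ t, IsMaxIndep (G.induce (Q t)) (S t))
    (hcross : ∀ s t, s ≠ t → ∀ u ∈ S s, ∀ v ∈ S t, ¬ G.Adj u.1 v.1) :
    IsMaxIndep G (unionParts S) ∧ G.indepNum = ∑ t, (G.induce (Q t)).indepNum := by
  have ncard_union : (unionParts S).ncard = ∑ t, (G.induce (Q t)).indepNum := by
    simp_rw [ncard_eq_sum hQ hcov, preimage_unionParts hQ, fun t => (hS t).ncard_eq]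
  have indep := isIndepSet_unionParts G S (fun t => (hS t).indep) hcross
  have lower := ncard_le_indepNum indep
  have upper := indepNum_le_sum G hQ hcov
  exact ⟨⟨indep, by omega⟩, by omega⟩

lemma image_kernel_subset (hQ : Pairwise (Function.onFun Disjoint Q)) (hcov : ⋃ t, Q t = Set.univ)
    (hd : critDiff G = ∑ t, critDiff (G.induce (Q t))) (t : ι) :
    Subtype.val '' kernel (G.induce (Q t)) ⊆ kernel G := by
  have diff_le : ∀ s ∈ Finset.univ, diff (G.induce (Q s)) (Subtype.val ⁻¹' kernel G) ≤
      critDiff (G.induce (Q s)) := fun s _ => diff_le_critDiff _ _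
  have sum_le := diff_le_sum G hQ hcov (kernel G)
  rw [diff_kernel, hd] at sum_le
  have critical := (Finset.sum_eq_sum_iff_of_le diff_le).1
    (le_antisymm (Finset.sum_le_sum diff_le) sum_le) t (Finset.mem_univ t)
  rintro _ ⟨v, hv, rfl⟩
  exact ((isCriticalIndep_iff _ _).2
    ⟨isIndepSet_preimage_val G (isCriticalIndep_kernel G).1 _, critical⟩).kernel_subset hv

end Partition

/-! ### Odd cycles of induced subgraphs -/

section Induce

variable {W : Type*} {G : SimpleGraph V} {H : SimpleGraph W} {φ : G →g H}

lemma mem_verts_map_iff (hφ : Function.Injective φ) {C : G.Subgraph} {v : V} :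
    φ v ∈ (C.map φ).verts ↔ v ∈ C.verts :=
  hφ.mem_set_image

lemma map_adj_iff (hφ : Function.Injective φ) {C : G.Subgraph} {u v : V} :
    (C.map φ).Adj (φ u) (φ v) ↔ C.Adj u v := by
  refine ⟨?_, fun h => ⟨u, v, h, rfl, rfl⟩⟩
  rintro ⟨u', v', h, hu, hv⟩
  rwa [← hφ hu, ← hφ hv]

lemma subgraphMap_injective (hφ : Function.Injective φ) :
    Function.Injective (Subgraph.map φ) := by
  intro C C' h
  ext u v
  · rw [← mem_verts_map_iff hφ, h, mem_verts_map_iff hφ]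
  · rw [← map_adj_iff hφ, h, map_adj_iff hφ]

lemma induce_injective (G : SimpleGraph V) (Q : Set V) :
    Function.Injective (Embedding.induce Q : G.induce Q ↪g G).toHom :=
  Subtype.val_injective

lemma IsOddCycle.exists_induce {C : G.Subgraph} (hC : IsOddCycle G C) {Q : Set V}
    (hQ : C.verts ⊆ Q) :
    ∃ C', IsOddCycle (G.induce Q) C' ∧ C'.map (Embedding.induce Q).toHom = C := by
  obtain ⟨v, c, hc, hodd, rfl⟩ := hC
  have support_sub : ∀ x ∈ c.support, x ∈ Q := fun x hx =>
    hQ ((Walk.mem_verts_toSubgraph c).2 hx)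
  have map_induce := c.map_induce support_sub
  refine ⟨(c.induce Q support_sub).toSubgraph, ⟨_, c.induce Q support_sub, ?_, ?_, rfl⟩, ?_⟩
  · exact Walk.IsCycle.of_map (map_induce.symm ▸ hc)
  · rwa [← Walk.length_map (Embedding.induce Q).toHom, map_induce]
  · rw [← Walk.toSubgraph_map, map_induce]
    rfl

lemma exists_contracted_coloring_of_subset {P Z : Set V} (hPZ : P ⊆ Z)
    {C : (G.induce P).Subgraph} (hC : IsOddCycle (G.induce P) C)
    (huniq : ∀ D, IsOddCycle G D → D.verts ⊆ Z → D = C.map (Embedding.induce P).toHom) :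
    ∃ A : Set V, Disjoint (Subtype.val ⁻¹' A) C.verts ∧
      (∀ x y : P, G.Adj x.1 y.1 → ¬ C.Adj x y → (x.1 ∈ A ↔ y.1 ∉ A)) ∧
      ∀ u v, G.Adj u v → u ∈ Z → v ∈ Z → u ∉ P → (u ∈ A ↔ v ∉ A) := by
  let φ := (G.induceHomOfLE hPZ).toHom
  have φ_injective : Function.Injective φ := (G.induceHomOfLE hPZ).injective
  obtain ⟨A, disjoint, mem_iff⟩ := exists_contracted_coloring (hC.map φ_injective) fun D hD => by
    refine subgraphMap_injective (induce_injective G Z) ?_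
    rw [← Subgraph.map_comp]
    exact huniq _ (hD.map (induce_injective G Z)) (by rintro _ ⟨x, -, rfl⟩; exact x.2)
  have mem_image (x : Z) : x.1 ∈ Subtype.val '' A ↔ x ∈ A := Subtype.val_injective.mem_set_image
  refine ⟨Subtype.val '' A, ?_, fun x y hxy hC => ?_, fun u v huv hu hv huP => ?_⟩
  · exact Set.disjoint_left.2 fun x hx hxC => Set.disjoint_left.1 disjoint
      ((mem_image (φ x)).1 hx) ((mem_verts_map_iff φ_injective).2 hxC)
  · change (φ x).1 ∈ _ ↔ (φ y).1 ∉ _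
    rw [mem_image, mem_image]
    exact mem_iff _ _ hxy fun h => hC ((map_adj_iff φ_injective).1 h)
  · rw [mem_image ⟨u, hu⟩, mem_image ⟨v, hv⟩]
    refine mem_iff _ _ huv fun h => huP ?_
    obtain ⟨x, -, hx⟩ := h.fst_mem
    have hxu : x.1 = u := congrArg Subtype.val hx
    exact hxu ▸ x.2

end Induce

/-! ### BAB-graphs -/

section BAB

variable {G : SimpleGraph V} {k : ℕ} {B : Set V} {P : Fin k → Set V}

/-- The parts of a BAB-graph `(B, P 0, …, P (k - 1))` as one family, the bipartite part `B` being
the value at `none`. -/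
def babParts (B : Set V) (P : Fin k → Set V) : Option (Fin k) → Set V
  | none => B
  | some i => P i

lemma pairwise_disjoint_babParts (hB : ∀ i, Disjoint B (P i))
    (hP : ∀ i j, i ≠ j → Disjoint (P i) (P j)) :
    Pairwise (Function.onFun Disjoint (babParts B P)) := by
  rintro (_ | i) (_ | j) hij
  · exact absurd rfl hij
  · exact hB j
  · exact (hB i).symm
  · exact hP i j fun h => hij (congrArg some h)

lemma iUnion_babParts (B : Set V) (P : Fin k → Set V) : ⋃ t, babParts B P t = B ∪ ⋃ i, P i := by
  ext v
  simp [babParts, Option.exists]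

namespace IsBAB

lemma pairwise_disjoint (h : IsBAB G B P) : Pairwise (Function.onFun Disjoint (babParts B P)) :=
  pairwise_disjoint_babParts h.disjoint_base h.disjoint_parts

lemma iUnion_parts (h : IsBAB G B P) : ⋃ t, babParts B P t = Set.univ :=
  (iUnion_babParts B P).trans h.cover

lemma exists_isReachGraph (h : IsBAB G B P) (i : Fin k) :
    ∃ C A, IsReachGraph (G.induce (P i)) C A :=
  BABGraph.exists_isReachGraph (h.almostBipartite i) (h.reach i)

lemma notMem_boundary_base (h : IsBAB G B P) {v : B} (hv : v ∈ geD (G.induce B)) :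
    v.1 ∉ boundary G B := by
  intro hb
  rcases Subtype.val_injective.mem_set_image.1 (h.boundary_base hb) with hA | hC
  · exact hA.1 hv
  · exact hC (Or.inl hv)

lemma notMem_boundary_part (h : IsBAB G B P) {i : Fin k} {v : P i}
    (hv : v ∉ geA (G.induce (P i))) : v.1 ∉ boundary G (P i) := fun hb =>
  hv (Subtype.val_injective.mem_set_image.1 (h.boundary_parts i hb))

lemma not_adj_of_notMem_geA (h : IsBAB G B P) {i : Fin k} {t : Option (Fin k)} (hit : some i ≠ t)
    {u : P i} (hu : u ∉ geA (G.induce (P i))) (v : babParts B P t) : ¬ G.Adj u.1 v.1 := fun hadj =>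
  h.notMem_boundary_part hu
    ⟨u.2, v.1, fun hv => Set.disjoint_left.1 (h.pairwise_disjoint hit) hv v.2, hadj⟩

lemma exists_coloring (h : IsBAB G B P) (hodd : ∀ C, IsOddCycle G C → ∃ i, C.verts ⊆ P i)
    (i : Fin k) :
    ∃ C, ∃ A : Set V, IsReachGraph (G.induce (P i)) C (Subtype.val ⁻¹' A) ∧
      ∀ u v, G.Adj u v → u ∈ B → v ∈ B ∪ P i → (u ∈ A ↔ v ∉ A) := by
  obtain ⟨C, hC, huniq⟩ := h.almostBipartite i
  have eq_map (D : G.Subgraph) (hD : IsOddCycle G D) (hDZ : D.verts ⊆ B ∪ P i) :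
      D = C.map (Embedding.induce (P i)).toHom := by
    obtain ⟨j, hj⟩ := hodd D hD
    obtain rfl : j = i := by
      by_contra hne
      obtain ⟨x, hx⟩ := hD.nonempty
      rcases hDZ hx with hxB | hxP
      · exact Set.disjoint_left.1 (h.disjoint_base j) hxB (hj hx)
      · exact Set.disjoint_left.1 (h.disjoint_parts j i hne) (hj hx) hxP
    obtain ⟨C', hC', rfl⟩ := hD.exists_induce hj
    rw [huniq C' hC']
  obtain ⟨A, disjoint, mem_iff, mem_iff_base⟩ :=
    exists_contracted_coloring_of_subset Set.subset_union_right hC eq_map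
  exact ⟨C, A, ⟨hC, huniq, h.reach i C hC, disjoint, mem_iff⟩, fun u v huv hu hv =>
    mem_iff_base u v huv (Or.inl hu) hv (Set.disjoint_left.1 (h.disjoint_base i) hu)⟩

variable [Finite V]

lemma critDiff_eq (h : IsBAB G B P) : critDiff G = ∑ t, critDiff (G.induce (babParts B P t)) := by
  refine critDiff_eq_sum G h.pairwise_disjoint h.iUnion_parts ?_
  rintro (_ | i)
  · obtain ⟨-, Y, hY, hYd⟩ := exists_subset_geD_diff_eq_critDiff h.bipartite
    exact ⟨Y, hYd, fun v hv => h.notMem_boundary_base (hY hv)⟩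
  · obtain ⟨C, A, hr⟩ := h.exists_isReachGraph i
    refine ⟨evens C A, hr.diff_evens, fun v hv => h.notMem_boundary_part ?_⟩
    rw [hr.geA_eq]
    exact Set.disjoint_right.1 (IsReachGraph.disjoint_evens C A) hv

lemma exists_isMaxIndep_parts (h : IsBAB G B P) :
    ∃ S : ∀ i, Set (P i), ∀ i, IsMaxIndep (G.induce (P i)) (S i) ∧
      Disjoint (S i) (geA (G.induce (P i))) := by
  have exists_part (i : Fin k) : ∃ S, IsMaxIndep (G.induce (P i)) S ∧
      Disjoint S (geA (G.induce (P i))) := by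
    obtain ⟨C, A, hr⟩ := h.exists_isReachGraph i
    obtain ⟨v, hv⟩ := hr.odd.nonempty
    obtain ⟨S, hS, -, hSA⟩ := hr.exists_isMaxIndep_disjoint (hr.notMem hv)
    exact ⟨S, hS, hr.geA_eq ▸ hSA⟩
  choose S hS using exists_part
  exact ⟨S, hS⟩

lemma isMaxIndep_union (h : IsBAB G B P) {SB : Set B} (hSB : IsMaxIndep (G.induce B) SB)
    {S : ∀ i, Set (P i)} (hS : ∀ i, IsMaxIndep (G.induce (P i)) (S i))
    (hbase : ∀ i, ∀ u ∈ SB, ∀ v ∈ S i, ¬ G.Adj u.1 v.1)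
    (hparts : ∀ i j, i ≠ j → Disjoint (S i) (geA (G.induce (P i))) ∨
      Disjoint (S j) (geA (G.induce (P j)))) :
    IsMaxIndep G (Subtype.val '' SB ∪ ⋃ i, Subtype.val '' S i) ∧
      G.indepNum = ∑ t, (G.induce (babParts B P t)).indepNum := by
  let T : ∀ t, Set (babParts B P t) := fun | none => SB | some i => S i
  have unionParts_eq : unionParts T = Subtype.val '' SB ∪ ⋃ i, Subtype.val '' S i :=
    Set.iUnion_option _
  rw [← unionParts_eq]
  refine isMaxIndep_unionParts G h.pairwise_disjoint h.iUnion_parts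
    (by rintro (_ | i); exacts [hSB, hS i]) ?_
  rintro (_ | i) (_ | j) hij u hu v hv hadj
  · exact hij rfl
  · exact hbase j u hu v hv hadj
  · exact hbase i v hv u hu hadj.symm
  · rcases hparts i j fun hij' => hij (congrArg some hij') with hSA | hSA
    · exact h.not_adj_of_notMem_geA hij (Set.disjoint_left.1 hSA hu) v hadj
    · exact h.not_adj_of_notMem_geA hij.symm (Set.disjoint_left.1 hSA hv) u hadj.symm

lemma isMaxIndep_union_of_disjoint_geA (h : IsBAB G B P) {SB : Set B}
    (hSB : IsMaxIndep (G.induce B) SB) {S : ∀ i, Set (P i)}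
    (hS : ∀ i, IsMaxIndep (G.induce (P i)) (S i) ∧ Disjoint (S i) (geA (G.induce (P i)))) :
    IsMaxIndep G (Subtype.val '' SB ∪ ⋃ i, Subtype.val '' S i) ∧
      G.indepNum = ∑ t, (G.induce (babParts B P t)).indepNum :=
  h.isMaxIndep_union hSB (fun i => (hS i).1)
    (fun i u _ _ hv hadj => h.not_adj_of_notMem_geA (Option.some_ne_none i)
      (Set.disjoint_left.1 (hS i).2 hv) u hadj.symm)
    fun i _ _ => Or.inl (hS i).2

lemma indepNum_eq (h : IsBAB G B P) :
    G.indepNum = ∑ t, (G.induce (babParts B P t)).indepNum :=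
  have ⟨_, hSB⟩ := exists_isMaxIndep (G.induce B)
  have ⟨_, hS⟩ := h.exists_isMaxIndep_parts
  (h.isMaxIndep_union_of_disjoint_geA hSB hS).2

theorem two_mul_indepNum_add (h : IsBAB G B P) :
    ((2 * G.indepNum + k : ℕ) : ℤ) = critDiff G + (Nat.card V : ℤ) := by
  have card_eq : Nat.card V = ∑ t, Nat.card (babParts B P t) := by
    have := ncard_eq_sum h.pairwise_disjoint h.iUnion_parts Set.univ
    simpa only [Set.ncard_univ, Set.preimage_univ] using this
  have base := two_mul_indepNum_of_isBipartite h.bipartite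
  have part (i : Fin k) : (2 * (G.induce (P i)).indepNum + 1 : ℤ) =
      critDiff (G.induce (P i)) + Nat.card (P i) := by
    obtain ⟨C, A, hr⟩ := h.exists_isReachGraph i
    exact hr.two_mul_indepNum_add_one
  have parts := Finset.sum_congr (rfl : Finset.univ = Finset.univ) fun i _ => part i
  rw [Finset.sum_add_distrib, Finset.sum_add_distrib, ← Finset.mul_sum] at parts
  simp only [Finset.sum_const, Finset.card_univ, Fintype.card_fin, nsmul_eq_mul, mul_one] at parts
  rw [h.critDiff_eq, h.indepNum_eq, card_eq, Fintype.sum_option, Fintype.sum_option,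
    Fintype.sum_option]
  simp only [babParts]
  push_cast
  linarith

theorem ncard_kernel_add_ncard_corona_le (h : IsBAB G B P) :
    (kernel G).ncard + (corona G).ncard ≤ 2 * G.indepNum + k := by
  have le := BABGraph.ncard_kernel_add_ncard_corona_le G
  have eq := h.two_mul_indepNum_add
  omega

lemma exists_isMaxIndep_base (h : IsBAB G B P) (hodd : ∀ C, IsOddCycle G C → ∃ i, C.verts ⊆ P i)
    (i : Fin k) :
    ∃ S, IsMaxIndep (G.induce B) S ∧ ∀ u ∈ S, ∀ v : P i, ¬ G.Adj u.1 v.1 := by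
  obtain ⟨C, A, hr, hcol⟩ := h.exists_coloring hodd i
  have bipartite : (G.induce B).IsBipartiteWith (Subtype.val ⁻¹' Aᶜ) (Subtype.val ⁻¹' Aᶜ)ᶜ := by
    refine ⟨disjoint_compl_right, fun u v huv => ?_⟩
    have := hcol u.1 v.1 huv u.2 (Or.inl v.2)
    simp only [Set.mem_compl_iff, Set.mem_preimage, not_not]
    tauto
  obtain ⟨S, hS, -, hSD⟩ := exists_isMaxIndep_inter_subset_geD bipartite
  refine ⟨S, hS, fun u hu v huv => ?_⟩
  have hvA : v ∈ geA (G.induce (P i)) := by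
    by_contra hvA
    exact h.not_adj_of_notMem_geA (Option.some_ne_none i) hvA u huv.symm
  rw [hr.geA_eq] at hvA
  have huA : u.1 ∉ A := fun huA => (hcol u.1 v.1 huv u.2 (Or.inr v.2)).1 huA hvA
  exact h.notMem_boundary_base (hSD ⟨hu, huA⟩)
    ⟨u.2, v.1, fun hvB => Set.disjoint_left.1 (h.disjoint_base i) hvB v.2, huv⟩

lemma mem_corona_of_mem_base (h : IsBAB G B P) {v : B} (hv : v ∈ corona (G.induce B)) :
    v.1 ∈ corona G := by
  obtain ⟨SB, hSB, hvS⟩ := (mem_corona_iff _ v).1 hv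
  obtain ⟨S, hS⟩ := h.exists_isMaxIndep_parts
  exact (mem_corona_iff G v.1).2
    ⟨_, (h.isMaxIndep_union_of_disjoint_geA hSB hS).1, Or.inl ⟨v, hvS, rfl⟩⟩

lemma mem_corona_of_mem_part (h : IsBAB G B P) (hodd : ∀ C, IsOddCycle G C → ∃ i, C.verts ⊆ P i)
    {i : Fin k} {v : P i} (hv : v ∈ corona (G.induce (P i))) : v.1 ∈ corona G := by
  obtain ⟨Si, hSi, hvS⟩ := (mem_corona_iff _ v).1 hv
  obtain ⟨SB, hSB, hSB_adj⟩ := h.exists_isMaxIndep_base hodd i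
  obtain ⟨S, hS⟩ := h.exists_isMaxIndep_parts
  have disjoint_geA (j : Fin k) (hj : j ≠ i) :
      Disjoint (Function.update S i Si j) (geA (G.induce (P j))) := by
    rw [Function.update_of_ne hj]
    exact (hS j).2
  refine (mem_corona_iff G v.1).2 ⟨_, (h.isMaxIndep_union hSB (S := Function.update S i Si)
    ?_ ?_ ?_).1, Or.inr (Set.mem_iUnion.2 ⟨i, v, by rwa [Function.update_self], rfl⟩)⟩
  · exact (Function.forall_update_iff S fun j T => IsMaxIndep (G.induce (P j)) T).2
      ⟨hSi, fun j _ => (hS j).1⟩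
  · intro j u hu w hw huw
    obtain rfl | hj := eq_or_ne j i
    · exact hSB_adj u hu w huw
    · exact h.not_adj_of_notMem_geA (t := none) (Option.some_ne_none j)
        (Set.disjoint_left.1 (disjoint_geA j hj) hw) u huw.symm
  · intro j l hjl
    obtain rfl | hj := eq_or_ne j i
    · exact Or.inr (disjoint_geA l hjl.symm)
    · exact Or.inl (disjoint_geA j hj)

theorem compl_nbhd_kernel_subset_corona (h : IsBAB G B P)
    (hodd : ∀ C, IsOddCycle G C → ∃ i, C.verts ⊆ P i) : (nbhd G (kernel G))ᶜ ⊆ corona G := by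
  intro v hv
  have kernel_subset := image_kernel_subset G h.pairwise_disjoint h.iUnion_parts h.critDiff_eq
  have notMem (t) (hvt : v ∈ babParts B P t) : (⟨v, hvt⟩ : babParts B P t) ∉
      nbhd (G.induce (babParts B P t)) (kernel (G.induce (babParts B P t))) :=
    fun ⟨u, hu, huv⟩ => hv ⟨u, kernel_subset t ⟨u, hu, rfl⟩, huv⟩
  obtain ⟨t, hvt⟩ := Set.mem_iUnion.1 (h.iUnion_parts ▸ Set.mem_univ v)
  rcases t with _ | i
  · exact h.mem_corona_of_mem_base
      (BABGraph.compl_nbhd_kernel_subset_corona h.bipartite (notMem none hvt))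
  · obtain ⟨C, A, hr⟩ := h.exists_isReachGraph i
    exact h.mem_corona_of_mem_part hodd (hr.compl_nbhd_kernel_subset_corona (notMem (some i) hvt))

theorem ncard_kernel_add_ncard_corona_eq (h : IsBAB G B P)
    (hodd : ∀ C, IsOddCycle G C → ∃ i, C.verts ⊆ P i) :
    (kernel G).ncard + (corona G).ncard = 2 * G.indepNum + k := by
  have corona_eq := BABGraph.ncard_kernel_add_ncard_corona_eq
    (h.compl_nbhd_kernel_subset_corona hodd)
  have indepNum_eq := h.two_mul_indepNum_add
  omega

end IsBAB

end BAB

/-! ### Growing a reach set from an odd cycle -/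

section Growth

variable {G : SimpleGraph V} {f g : V → V} {C : G.Subgraph} {E O Q : Set V}

lemma AlternatesTo.concat_concat {b e u x : V} {p : G.Walk b e} (hp : AlternatesTo f p)
    (heu : G.Adj e u) (hux : G.Adj u x) (hfe : f e = u) (hfu : f u ≠ x) :
    AlternatesTo f ((p.concat heu).concat hux) := by
  induction p with
  | nil => exact ⟨by simp [hfe], by simp [hfu], trivial⟩
  | cons h p ih =>
    refine ⟨?_, ih hp.2 heu hfe⟩
    change f _ = _ ↔ Odd ((p.concat heu).concat hux).length
    rw [hp.1, Walk.length_concat, Walk.length_concat, Nat.odd_add_one, Nat.odd_add_one, not_not]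

lemma AlternatesTo.concat_congr {b o x y : V} {q : G.Walk b o} {hox : G.Adj o x}
    (hq : AlternatesTo f (q.concat hox)) (hoy : G.Adj o y) (hfo : f o ≠ y) :
    AlternatesTo f (q.concat hoy) := by
  induction q with
  | nil => exact ⟨by simp [hfo], trivial⟩
  | cons h q ih =>
    refine ⟨?_, ih hq.2 hoy hfo⟩
    have head_iff : _ ↔ Odd (q.concat hox).length := hq.1
    change f _ = _ ↔ Odd (q.concat hoy).length
    rw [head_iff, Walk.length_concat, Walk.length_concat]

lemma AlternatesTo.congr_of_isPath {b r : V} {p : G.Walk b r} (hp : AlternatesTo f p)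
    (path : p.IsPath) (h : ∀ x ∈ p.support, x ≠ r → g x = f x) : AlternatesTo g p := by
  induction p with
  | nil => trivial
  | cons h' p ih =>
    rw [Walk.cons_isPath_iff] at path
    rw [Walk.support_cons] at h
    refine ⟨?_, ih hp.2 path.1 fun x hx => h x (List.mem_cons_of_mem _ hx)⟩
    rw [h _ List.mem_cons_self fun h => path.2 (h ▸ p.end_mem_support)]
    exact hp.1

lemma IsBlossomMap.congr {b : V} (h : IsBlossomMap f C b) (hfg : ∀ v ∈ C.verts, g v = f v) :
    IsBlossomMap g C b := by
  refine ⟨h.mem, ?_, fun x hx hxb => ?_⟩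
  · rw [hfg b h.mem]
    exact h.base
  · rw [hfg x hx]
    exact h.adj x hx hxb

lemma IsFlowerMap.congr {b r : V} {p : G.Walk b r} (hp : IsFlowerMap f C p)
    (cycle_eq : ∀ v ∈ C.verts, g v = f v) (stem_eq : ∀ v ∈ p.support, g v = f v) :
    IsFlowerMap g C p :=
  ⟨hp.blossom.congr cycle_eq, hp.path, hp.alt.congr stem_eq, hp.even,
    (stem_eq r p.end_mem_support).trans hp.root, hp.meet⟩

open Classical in
lemma IsFlowerMap.exchange {b e u x : V} {p : G.Walk b e} (hp : IsFlowerMap f C p)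
    (hf : IsMatchingMap G f) (hfu : f u = x) (heu : G.Adj e u) (hux : G.Adj u x)
    (hu : u ∉ C.verts ∧ u ∉ p.support) (hx : x ∉ C.verts ∧ x ∉ p.support) :
    IsFlowerMap (exchange f e x) C ((p.concat heu).concat hux) := by
  have eq_of_ne {v : V} (hve : v ≠ e) (hvx : v ≠ x) (hvu : v ≠ u) :
      BABGraph.exchange f e x v = f v :=
    exchange_apply_of_ne hf hfu hp.root hve hvx hvu
  have apply_e : BABGraph.exchange f e x e = u := exchange_apply_left hf hfu heu.ne' hux.ne
  have apply_u : BABGraph.exchange f e x u = e := exchange_apply_self hfu heu.ne' hux.ne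
  have hxe : x ≠ e := by rintro rfl; exact hx.2 p.end_mem_support
  refine ⟨⟨hp.blossom.mem, ?_, fun v hv hvb => ?_⟩, ?_, ?_, ?_, exchange_apply_right hp.root, ?_⟩
  · rcases eq_or_ne b e with rfl | hbe
    · rw [apply_e]
      exact fun h => hu.1 h.snd_mem
    · rw [eq_of_ne hbe (by rintro rfl; exact hx.1 hp.blossom.mem)
        (by rintro rfl; exact hu.1 hp.blossom.mem)]
      exact hp.blossom.base
  · have hve : v ≠ e := by rintro rfl; exact hvb (hp.meet v p.end_mem_support hv)
    rw [eq_of_ne hve (by rintro rfl; exact hx.1 hv) (by rintro rfl; exact hu.1 hv)]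
    exact hp.blossom.adj v hv hvb
  · refine (hp.path.concat hu.2 heu).concat ?_ hux
    simp only [Walk.support_concat, List.mem_append, List.mem_singleton, not_or]
    exact ⟨hx.2, hux.ne'⟩
  · refine AlternatesTo.concat_concat (hp.alt.congr_of_isPath hp.path fun v hv hve => ?_) heu hux
      apply_e (apply_u.trans_ne hxe.symm)
    exact eq_of_ne hve (by rintro rfl; exact hx.2 hv) (by rintro rfl; exact hu.2 hv)
  · simpa only [Walk.length_concat, Nat.even_add_one, not_not] using hp.even
  · intro v hv hvC
    simp only [Walk.support_concat, List.mem_append, List.mem_singleton] at hv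
    rcases hv with (hv | rfl) | rfl
    · exact hp.meet v hv hvC
    · exact absurd hvC hu.1
    · exact absurd hvC hx.1

lemma IsMatchingMap.mapsTo_of_eq_off (hf : IsMatchingMap G f) (hg : IsMatchingMap G g)
    (hQ : ∀ v ∈ Q, f v ∈ Q) (hoff : ∀ v ∉ Q, g v = f v) : ∀ v ∈ Q, g v ∈ Q := by
  intro v hv
  by_contra hgv
  refine hf.notMem_of_mapsTo hQ hgv ?_
  rwa [← hoff _ hgv, hg.involutive]

open Classical in
lemma IsMaxMatchingMap.piecewise [Finite V] {f' : V → V} (hf : IsMaxMatchingMap G f)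
    (hf' : IsMaxMatchingMap G f') (hg : IsMaxMatchingMap G g) (hQ : ∀ v ∈ Q, f v ∈ Q)
    (hoff : ∀ v ∉ Q, g v = f v) (hon : ∀ v ∈ Q, f' v = f v) :
    IsMaxMatchingMap G (Q.piecewise g f') := by
  have f'_mapsTo : ∀ v ∈ Q, f' v ∈ Q := fun v hv => by rw [hon v hv]; exact hQ v hv
  have saturated_on : saturated f' ∩ Q = saturated f ∩ Q := by
    ext v
    refine and_congr_left fun hv => ?_
    change f' v ≠ v ↔ f v ≠ v
    rw [hon v hv]
  have saturated_off : saturated g \ Q = saturated f \ Q := by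
    ext v
    refine and_congr_left fun hv => ?_
    change g v ≠ v ↔ f v ≠ v
    rw [hoff v hv]
  refine hg.of_ncard_le (hg.1.piecewise hf'.1 (hf.1.mapsTo_of_eq_off hg.1 hQ hoff)
    fun v => hf'.1.notMem_of_mapsTo f'_mapsTo) ?_
  have card_eq := hf.ncard_eq hf'
  rw [← Set.ncard_inter_add_ncard_sdiff_eq_ncard (saturated f) Q,
    ← Set.ncard_inter_add_ncard_sdiff_eq_ncard (saturated f') Q, saturated_on] at card_eq
  rw [ncard_saturated_piecewise, ← Set.ncard_inter_add_ncard_sdiff_eq_ncard (saturated g) Q,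
    saturated_off]
  omega

/-- `p` is the stem, contained in `Q`, of a flower with blossom `C`, for some maximum matching that
agrees with `f` outside `Q`. -/
def IsStemIn (f : V → V) (C : G.Subgraph) (Q : Set V) {b r : V} (p : G.Walk b r) : Prop :=
  ∃ g, IsMaxMatchingMap G g ∧ (∀ v ∉ Q, g v = f v) ∧ IsFlowerMap g C p ∧ ∀ v ∈ p.support, v ∈ Q

namespace IsStemIn

variable {b r : V} {p : G.Walk b r}

lemma mono {Q' : Set V} (h : IsStemIn f C Q p) (hQ : Q ⊆ Q') : IsStemIn f C Q' p := by
  obtain ⟨g, hg, hoff, hp, support_subset⟩ := h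
  exact ⟨g, hg, fun v hv => hoff v fun hvQ => hv (hQ hvQ), hp,
    fun v hv => hQ (support_subset v hv)⟩

lemma mem_reachSet [Finite V] (h : IsStemIn f C Q p) (hC : IsOddCycle G C) {v : V}
    (hv : v ∈ p.support) : v ∈ reachSet G C := by
  obtain ⟨g, hg, -, hp, -⟩ := h
  exact (mem_reachSet_iff hC v).2 ⟨g, b, r, p, hg, hp, Or.inr hv⟩

lemma congr [Finite V] {f' : V → V} (h : IsStemIn f C Q p) (hf : IsMaxMatchingMap G f)
    (hf' : IsMaxMatchingMap G f') (hon : ∀ v ∈ Q, f' v = f v) (hQ : ∀ v ∈ Q, f v ∈ Q)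
    (hCQ : C.verts ⊆ Q) : IsStemIn f' C Q p := by
  classical
  obtain ⟨g, hg, hoff, hp, support_subset⟩ := h
  have glued_eq : ∀ v ∈ Q, Q.piecewise g f' v = g v := fun v => Set.piecewise_eq_of_mem _ _ _
  exact ⟨Q.piecewise g f', hf.piecewise hf' hg hQ hoff hon,
    fun v => Set.piecewise_eq_of_notMem _ _ _, hp.congr (fun v hv => glued_eq v (hCQ hv))
    fun v hv => glued_eq v (support_subset v hv), support_subset⟩

lemma extend [Finite V] {u : V} (h : IsStemIn f C Q p) (hf : IsMaxMatchingMap G f)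
    (hCQ : C.verts ⊆ Q) (hQ : ∀ v ∈ Q, f v ∈ Q) (hu : u ∉ Q) (hru : G.Adj r u) :
    ∃ hux : G.Adj u (f u),
      IsStemIn f C (insert u (insert (f u) Q)) ((p.concat hru).concat hux) := by
  classical
  obtain ⟨g, hg, hoff, hp, support_subset⟩ := h
  have hgu : g u = f u := hoff u hu
  have hfuQ : f u ∉ Q := hf.1.notMem_of_mapsTo hQ hu
  have hne : u ≠ f u := fun h => hg.not_adj hp.root (hgu.trans h.symm) hru
  have hux : G.Adj u (f u) := hf.1.adj u hne.symm
  have hrQ : r ∈ Q := support_subset r p.end_mem_support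
  refine ⟨hux, exchange g r (f u), isMaxMatchingMap_exchange hg hgu hp.root hne hru, fun v hv => ?_,
    hp.exchange hg.1 hgu hru hux ⟨fun h => hu (hCQ h), fun h => hu (support_subset u h)⟩
      ⟨fun h => hfuQ (hCQ h), fun h => hfuQ (support_subset _ h)⟩, fun v hv => ?_⟩
  · simp only [Set.mem_insert_iff, not_or] at hv
    rw [exchange_apply_of_ne hg.1 hgu hp.root (by rintro rfl; exact hv.2.2 hrQ) hv.2.1 hv.1,
      hoff v hv.2.2]
  · simp only [Walk.support_concat, List.mem_append, List.mem_singleton] at hv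
    rcases hv with (hv | rfl) | rfl
    · exact Or.inr (Or.inr (support_subset v hv))
    · exact Or.inl rfl
    · exact Or.inr (Or.inl rfl)

lemma concat_congr {o x y : V} {q : G.Walk b o} {hoy : G.Adj o y}
    (h : IsStemIn f C Q (q.concat hoy)) (hCQ : C.verts ⊆ Q) (hx : x ∉ Q) (hfx : f x = x)
    (hox : G.Adj o x) : IsStemIn f C (insert x Q) (q.concat hox) := by
  obtain ⟨g, hg, hoff, hp, support_subset⟩ := h
  have hgx : g x = x := (hoff x hx).trans hfx
  have mem_support {w : V} (hw : w ∈ q.support) : w ∈ (q.concat hoy).support := by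
    rw [Walk.support_concat]
    exact List.mem_append_left _ hw
  have hgo : g o ≠ x := fun h => hox.ne (by rw [← hg.1.apply_eq_of_apply_eq h, hgx])
  have hxq : x ∉ q.support := fun h => hx (support_subset x (mem_support h))
  refine ⟨g, hg, fun w hw => hoff w fun hwQ => hw (Or.inr hwQ),
    ⟨hp.blossom, ((Walk.concat_isPath_iff hoy).1 hp.path).1.concat hxq hox,
      hp.alt.concat_congr hox hgo, ?_, hgx, fun w hw hwC => ?_⟩, fun w hw => ?_⟩
  · have even := hp.even
    rwa [Walk.length_concat] at even ⊢
  all_goals simp only [Walk.support_concat, List.mem_append, List.mem_singleton] at hw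
  · rcases hw with hw | rfl
    · exact hp.meet w (mem_support hw) hwC
    · exact absurd (hCQ hwC) hx
  · rcases hw with hw | rfl
    · exact Or.inr (support_subset w (mem_support hw))
    · exact Or.inl rfl

end IsStemIn

/-- A part of the reach set grown from the odd cycle `C`: `E` holds the ends of stems, `O` the last
but one vertices of stems. The stems may belong to different maximum matchings, but all of these
agree with `f` outside `E ∪ O`. -/
structure IsReachPart (f : V → V) (C : G.Subgraph) (E O : Set V) : Prop where
  max : IsMaxMatchingMap G f
  base : ∃ b, IsBlossomMap f C b ∧ f b = b
  cycle : C.verts ⊆ E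
  disjoint : Disjoint E O
  mapsTo : ∀ o ∈ O, f o ∈ E
  closed : ∀ e ∈ E, f e ∈ E ∪ O
  even : ∀ e ∈ E, ∃ (b : V) (p : G.Walk b e), IsStemIn f C (E ∪ O) p
  odd : ∀ o ∈ O, ∃ (b x : V) (q : G.Walk b o) (h : G.Adj o x), IsStemIn f C (E ∪ O) (q.concat h)

lemma exists_isReachPart_verts [Finite V] (hC : IsOddCycle G C) (hne : (reachSet G C).Nonempty) :
    ∃ f, IsReachPart f C C.verts ∅ := by
  obtain ⟨v, hv⟩ := hne
  obtain ⟨f, b, r, p, hf, hp, -⟩ := (mem_reachSet_iff hC v).1 hv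
  obtain ⟨g, hg, hb, hgb⟩ := hp.exists_base hf
  refine ⟨g, hg, ⟨b, hb, hgb⟩, subset_rfl, Set.disjoint_empty _, fun _ ho => ho.elim,
    fun e he => Or.inl (hb.mapsTo hgb e he), fun e he => ?_, fun _ ho => ho.elim⟩
  obtain ⟨k, hk, hke, hkf, hoff⟩ := hb.exists_rotate hgb hg hC he
  exact ⟨e, .nil, k, hk, fun v hv => hoff v fun h => hv (Or.inl h),
    ⟨hke, Walk.IsPath.nil, trivial, by simp, hkf, by simp⟩, by simpa using he⟩

namespace IsReachPart

lemma verts_subset_union (h : IsReachPart f C E O) : C.verts ⊆ E ∪ O :=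
  h.cycle.trans Set.subset_union_left

lemma mapsTo_union (h : IsReachPart f C E O) : ∀ v ∈ E ∪ O, f v ∈ E ∪ O := by
  rintro v (hv | hv)
  · exact h.closed v hv
  · exact Or.inl (h.mapsTo v hv)

lemma subset_reachSet [Finite V] (h : IsReachPart f C E O) (hC : IsOddCycle G C) :
    E ∪ O ⊆ reachSet G C := by
  rintro v (hv | hv)
  · obtain ⟨b, p, hp⟩ := h.even v hv
    exact hp.mem_reachSet hC p.end_mem_support
  · obtain ⟨b, x, q, hvx, hq⟩ := h.odd v hv
    exact hq.mem_reachSet hC (by simp [Walk.support_concat])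

lemma insert_edge [Finite V] (h : IsReachPart f C E O) {e u : V} (he : e ∈ E) (hu : u ∉ E ∪ O)
    (heu : G.Adj e u) : IsReachPart f C (insert (f u) E) (insert u O) := by
  obtain ⟨b, p, hp⟩ := h.even e he
  obtain ⟨hux, stem⟩ := hp.extend h.max h.verts_subset_union h.mapsTo_union hu heu
  have hfu : f u ∉ E ∪ O := h.max.1.notMem_of_mapsTo h.mapsTo_union hu
  have insert_eq : insert u (insert (f u) (E ∪ O)) = insert (f u) E ∪ insert u O := by
    rw [Set.insert_union, Set.union_insert, Set.insert_comm]
  have subset : E ∪ O ⊆ insert (f u) E ∪ insert u O :=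
    Set.union_subset_union (Set.subset_insert _ _) (Set.subset_insert _ _)
  rw [insert_eq] at stem
  rw [Set.mem_union, not_or] at hu hfu
  refine ⟨h.max, h.base, h.cycle.trans (Set.subset_insert _ _), ?_, ?_, ?_, ?_, ?_⟩
  · rw [Set.disjoint_insert_left, Set.disjoint_insert_right, Set.mem_insert_iff, not_or]
    exact ⟨⟨hux.ne', hfu.2⟩, hu.1, h.disjoint⟩
  · rintro o (rfl | ho)
    · exact Or.inl rfl
    · exact Or.inr (h.mapsTo o ho)
  · rintro v (rfl | hv)
    · rw [h.max.1.involutive]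
      exact Or.inr (Or.inl rfl)
    · exact subset (h.closed v hv)
  · rintro v (rfl | hv)
    · exact ⟨b, _, stem⟩
    · obtain ⟨b', p', hp'⟩ := h.even v hv
      exact ⟨b', p', hp'.mono subset⟩
  · rintro v (rfl | hv)
    · exact ⟨b, _, _, hux, stem⟩
    · obtain ⟨b', x, q, hvx, hq⟩ := h.odd v hv
      exact ⟨b', x, q, hvx, hq.mono subset⟩

lemma congr [Finite V] (h : IsReachPart f C E O) (hg : IsMaxMatchingMap G g)
    (hon : ∀ v ∈ E ∪ O, g v = f v) : IsReachPart g C E O := by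
  have cycle_subset := h.verts_subset_union
  refine ⟨hg, ?_, h.cycle, h.disjoint, fun o ho => ?_, fun e he => ?_, fun e he => ?_,
    fun o ho => ?_⟩
  · obtain ⟨b, hb, hfb⟩ := h.base
    exact ⟨b, hb.congr fun v hv => hon v (cycle_subset hv), (hon b (cycle_subset hb.mem)).trans hfb⟩
  · rw [hon o (Or.inr ho)]
    exact h.mapsTo o ho
  · rw [hon e (Or.inl he)]
    exact h.closed e he
  · obtain ⟨b, p, hp⟩ := h.even e he
    exact ⟨b, p, hp.congr h.max hg hon h.mapsTo_union cycle_subset⟩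
  · obtain ⟨b, x, q, hox, hq⟩ := h.odd o ho
    exact ⟨b, x, q, hox, hq.congr h.max hg hon h.mapsTo_union cycle_subset⟩

lemma insert_vertex (h : IsReachPart f C E O) {o x : V} (ho : o ∈ O) (hx : x ∉ E ∪ O)
    (hox : G.Adj o x) (hfx : f x = x) : IsReachPart f C (insert x E) O := by
  have subset : E ∪ O ⊆ insert x E ∪ O := Set.union_subset_union_left _ (Set.subset_insert _ _)
  refine ⟨h.max, h.base, h.cycle.trans (Set.subset_insert _ _), ?_,
    fun v hv => Or.inr (h.mapsTo v hv), ?_, ?_, fun v hv => ?_⟩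
  · rw [Set.disjoint_insert_left]
    exact ⟨fun hxO => hx (Or.inr hxO), h.disjoint⟩
  · rintro v (rfl | hv)
    · exact Or.inl (Or.inl hfx)
    · exact subset (h.closed v hv)
  · rintro v (rfl | hv)
    · obtain ⟨b, y, q, hoy, stem⟩ := h.odd o ho
      rw [Set.insert_union]
      exact ⟨b, _, stem.concat_congr h.verts_subset_union hx hfx hox⟩
    · obtain ⟨b, p, hp⟩ := h.even v hv
      exact ⟨b, p, hp.mono subset⟩
  · obtain ⟨b, y, q, hvy, hq⟩ := h.odd v hv
    exact ⟨b, y, q, hvy, hq.mono subset⟩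

end IsReachPart

lemma exists_maximal_isReachPart [Finite V] (hC : IsOddCycle G C) (hne : (reachSet G C).Nonempty) :
    ∃ f E O, IsReachPart f C E O ∧ (∀ e ∈ E, ∀ u, G.Adj e u → u ∈ E ∪ O) ∧
      ∀ x ∉ E ∪ O, ∀ o ∈ O, G.Adj o x → ∀ g, IsMaxMatchingMap G g → (∀ v ∈ E ∪ O, g v = f v) →
        g x ≠ x := by
  obtain ⟨f₀, h₀⟩ := exists_isReachPart_verts hC hne
  obtain ⟨⟨f, E, O⟩, h, max⟩ := Set.exists_max_image
    {t : (V → V) × Set V × Set V | IsReachPart t.1 C t.2.1 t.2.2}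
    (fun t => t.2.1.ncard + t.2.2.ncard) (Set.toFinite _) ⟨(f₀, C.verts, ∅), h₀⟩
  replace h : IsReachPart f C E O := h
  have le_card (g : V → V) (E' O' : Set V) (h' : IsReachPart g C E' O') :
      E'.ncard + O'.ncard ≤ E.ncard + O.ncard := max (g, E', O') h'
  refine ⟨f, E, O, h, fun e he u heu => ?_, fun x hx o ho hox g hg hon hgx => ?_⟩
  · by_contra hu
    have le := le_card _ _ _ (h.insert_edge he hu heu)
    have card_insert := Set.ncard_insert_of_notMem (fun huO : u ∈ O => hu (Or.inr huO))
    have card_le := Set.ncard_le_ncard (Set.subset_insert (f u) E)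
    omega
  · have le := le_card _ _ _ ((h.congr hg hon).insert_vertex ho hx hox hgx)
    have card_insert := Set.ncard_insert_of_notMem (fun hxE : x ∈ E => hx (Or.inl hxE))
    omega

end Growth

/-! ### Restriction to induced subgraphs -/

section Restriction

variable {G : SimpleGraph V} {f : V → V} {W : Set V}

open Classical in
/-- The restriction of a matching map to `W`: only the edges with both ends in `W` are kept. -/
noncomputable def restrictMap (W : Set V) (f : V → V) : W → W :=
  fun v => if h : f v.1 ∈ W then ⟨f v.1, h⟩ else v

/-- The matching map of the whole graph that has the same edges as a matching map of `W`. -/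
noncomputable def extendMap (h : W → W) : V → V :=
  Function.extend Subtype.val (Subtype.val ∘ h) id

lemma extendMap_coe (h : W → W) (v : W) : extendMap h v.1 = (h v).1 :=
  Subtype.val_injective.extend_apply _ _ _

lemma extendMap_of_notMem (h : W → W) {v : V} (hv : v ∉ W) : extendMap h v = v :=
  Function.extend_apply' _ _ _ fun ⟨w, hw⟩ => hv (hw ▸ w.2)

lemma isMatchingMap_extendMap {h : W → W} (hh : IsMatchingMap (G.induce W) h) :
    IsMatchingMap G (extendMap h) := by
  constructor <;> intro v
  · by_cases hv : v ∈ W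
    · rw [extendMap_coe h ⟨v, hv⟩, extendMap_coe, hh.involutive]
    · rw [extendMap_of_notMem h hv, extendMap_of_notMem h hv]
  · intro hne
    by_cases hv : v ∈ W
    · rw [extendMap_coe h ⟨v, hv⟩] at hne ⊢
      exact hh.adj ⟨v, hv⟩ fun hfix => hne (congrArg Subtype.val hfix)
    · exact absurd (extendMap_of_notMem h hv) hne

lemma extendMap_mem (h : W → W) {v : V} (hv : v ∈ W) : extendMap h v ∈ W := by
  rw [extendMap_coe h ⟨v, hv⟩]
  exact (h _).2

lemma saturated_extendMap (h : W → W) : saturated (extendMap h) = Subtype.val '' saturated h := by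
  ext v
  by_cases hv : v ∈ W
  · rw [Subtype.val_injective.mem_set_image (a := ⟨v, hv⟩)]
    change extendMap h v ≠ v ↔ h ⟨v, hv⟩ ≠ ⟨v, hv⟩
    rw [extendMap_coe h ⟨v, hv⟩, ne_eq, ne_eq, Subtype.ext_iff]
  · refine iff_of_false (fun hsat => hsat (extendMap_of_notMem h hv)) ?_
    rintro ⟨w, -, rfl⟩
    exact hv w.2

lemma restrictMap_apply {v : W} (h : f v.1 ∈ W) : (restrictMap W f v).1 = f v.1 := by
  rw [restrictMap, dif_pos h]

lemma restrictMap_of_notMem {v : W} (h : f v.1 ∉ W) : restrictMap W f v = v :=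
  dif_neg h

lemma isMatchingMap_restrictMap (hf : IsMatchingMap G f) :
    IsMatchingMap (G.induce W) (restrictMap W f) := by
  constructor <;> intro v <;> by_cases h : f v.1 ∈ W
  · apply Subtype.ext
    rw [restrictMap_apply (by rw [restrictMap_apply h, hf.involutive]; exact v.2),
      restrictMap_apply h, hf.involutive]
  · rw [restrictMap_of_notMem h, restrictMap_of_notMem h]
  · intro hne
    rw [comap_adj, Function.Embedding.subtype_apply, Function.Embedding.subtype_apply,
      restrictMap_apply h]
    exact hf.adj _ fun hfix => hne (Subtype.ext (by rw [restrictMap_apply h, hfix]))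
  · exact absurd (restrictMap_of_notMem h)

lemma image_saturated_restrictMap (W : Set V) (f : V → V) :
    Subtype.val '' saturated (restrictMap W f) = {v | v ∈ saturated f ∧ v ∈ W ∧ f v ∈ W} := by
  ext v
  constructor
  · rintro ⟨w, hw, rfl⟩
    by_cases h : f w.1 ∈ W
    · exact ⟨fun hfix => hw (Subtype.ext (by rw [restrictMap_apply h, hfix])), w.2, h⟩
    · exact absurd (restrictMap_of_notMem h) hw
  · rintro ⟨hsat, hv, hfv⟩
    exact ⟨⟨v, hv⟩, fun hfix => hsat (by rw [← restrictMap_apply (v := ⟨v, hv⟩) hfv, hfix]), rfl⟩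

lemma isMaxMatchingMap_restrictMap [Finite V] (hf : IsMaxMatchingMap G f)
    (hW : ∀ v ∈ W, f v ∈ W) : IsMaxMatchingMap (G.induce W) (restrictMap W f) := by
  classical
  refine ⟨isMatchingMap_restrictMap hf.1, fun h hh => ?_⟩
  have saturated_inter : saturated f ∩ W = Subtype.val '' saturated (restrictMap W f) := by
    rw [image_saturated_restrictMap]
    ext v
    exact ⟨fun hv => ⟨hv.1, hv.2, hW v hv.2⟩, fun hv => ⟨hv.1, hv.2.1⟩⟩
  have le := hf.2 _ ((isMatchingMap_extendMap hh).piecewise hf.1 (fun _ => extendMap_mem h)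
    fun v => hf.1.notMem_of_mapsTo hW)
  rw [ncard_saturated_piecewise, ← Set.ncard_inter_add_ncard_sdiff_eq_ncard (saturated f) W,
    saturated_extendMap, Set.inter_eq_left.2 (Subtype.coe_image_subset _ _), saturated_inter,
    Set.ncard_image_of_injective _ Subtype.val_injective,
    Set.ncard_image_of_injective _ Subtype.val_injective] at le
  omega

lemma AlternatesTo.of_map {g : W → W} (hg : ∀ v, (g v).1 = f v.1) {u v : W}
    {p : (G.induce W).Walk u v} (h : AlternatesTo f (p.map (Embedding.induce W).toHom)) :
    AlternatesTo g p := by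
  induction p with
  | nil => trivial
  | @cons u a w _ p ih =>
    refine ⟨?_, ih h.2⟩
    have head_iff : f u.1 = a.1 ↔ Odd (p.map (Embedding.induce W).toHom).length := h.1
    rw [Subtype.ext_iff, hg, head_iff, Walk.length_map]

lemma IsBlossomMap.of_map {g : W → W} (hg : ∀ v, (g v).1 = f v.1) {b : W}
    {C : (G.induce W).Subgraph} (h : IsBlossomMap f (C.map (Embedding.induce W).toHom) b.1) :
    IsBlossomMap g C b := by
  have adj_iff (x : W) : (C.map (Embedding.induce W).toHom).Adj x.1 (f x.1) ↔ C.Adj x (g x) := by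
    rw [← hg]
    exact map_adj_iff (induce_injective G W)
  refine ⟨(mem_verts_map_iff (induce_injective G W)).1 h.mem, (adj_iff b).not.1 h.base,
    fun x hx hxb => (adj_iff x).1 (h.adj _ ?_ fun h => hxb (Subtype.ext h))⟩
  exact (mem_verts_map_iff (induce_injective G W)).2 hx

lemma IsFlowerMap.of_map {g : W → W} (hg : ∀ v, (g v).1 = f v.1) {b r : W}
    {p : (G.induce W).Walk b r} {C : (G.induce W).Subgraph}
    (h : IsFlowerMap f (C.map (Embedding.induce W).toHom) (p.map (Embedding.induce W).toHom)) :
    IsFlowerMap g C p where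
  blossom := h.blossom.of_map hg
  path := h.path.of_map
  alt := h.alt.of_map hg
  even := by simpa only [Walk.length_map] using h.even
  root := Subtype.ext ((hg r).trans h.root)
  meet v hv hvC := Subtype.ext <| h.meet v.1
    (by rw [Walk.support_map]; exact List.mem_map_of_mem hv)
    ((mem_verts_map_iff (induce_injective G W)).2 hvC)

end Restriction

section ReachPart

variable [Finite V] {G : SimpleGraph V} {f : V → V} {C : G.Subgraph} {E O Q : Set V}

lemma IsReachGraph.not_isKonigEgervary {H : SimpleGraph V} {C : H.Subgraph} {A : Set V}
    (h : IsReachGraph H C A) : ¬ IsKonigEgervary H := by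
  intro (konigEgervary : H.indepNum + matchingNum H = Nat.card V)
  obtain ⟨f, hf⟩ := exists_isMaxMatchingMap H
  have mem_or_mem (x y : V) (hxy : H.Adj x y) (hC : ¬ C.Adj x y) : x ∈ A ∨ y ∈ A :=
    or_iff_not_imp_right.2 (h.mem_iff_notMem x y hxy hC).2
  have saturated_lt := hf.1.ncard_saturated_lt h.odd mem_or_mem
  have inter_le := Set.ncard_le_ncard (Set.inter_subset_left : A ∩ saturated f ⊆ A)
  have indepNum_eq := h.two_mul_indepNum
  have matchingNum_eq := two_mul_matchingNum hf
  have card_eq := h.card_eq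
  omega

lemma IsStemIn.exists_induce {C' : (G.induce Q).Subgraph} {b r : V} {p : G.Walk b r}
    (hp : IsStemIn f (C'.map (Embedding.induce Q).toHom) Q p) (hf : IsMatchingMap G f)
    (hQ : ∀ v ∈ Q, f v ∈ Q) : ∃ (hs : ∀ v ∈ p.support, v ∈ Q) (g : Q → Q),
      IsMaxMatchingMap (G.induce Q) g ∧ IsFlowerMap g C' (p.induce Q hs) := by
  obtain ⟨g, hg, hoff, flower, support_subset⟩ := hp
  have mapsTo := hf.mapsTo_of_eq_off hg.1 hQ hoff
  refine ⟨support_subset, restrictMap Q g, isMaxMatchingMap_restrictMap hg mapsTo,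
    IsFlowerMap.of_map (fun v => restrictMap_apply (mapsTo v.1 v.2)) ?_⟩
  rwa [Walk.map_induce]

namespace IsReachPart

section Induced

variable {C : (G.induce (E ∪ O)).Subgraph}

lemma reachSet_induce (h : IsReachPart f (C.map (Embedding.induce (E ∪ O)).toHom) E O)
    (hC : IsOddCycle (G.induce (E ∪ O)) C) : reachSet (G.induce (E ∪ O)) C = Set.univ := by
  have mem_of_stem (v : ↥(E ∪ O)) (b r : V) (p : G.Walk b r) (hv : v.1 ∈ p.support)
      (hp : IsStemIn f (C.map (Embedding.induce (E ∪ O)).toHom) (E ∪ O) p) :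
      v ∈ reachSet (G.induce (E ∪ O)) C := by
    obtain ⟨hs, g, hg, flower⟩ := hp.exists_induce h.max.1 h.mapsTo_union
    refine (mem_reachSet_iff hC v).2 ⟨g, _, _, _, hg, flower, Or.inr ?_⟩
    rwa [Walk.support_induce, List.mem_attachWith]
  refine Set.eq_univ_of_forall fun ⟨v, hv⟩ => ?_
  rcases id hv with hvE | hvO
  · obtain ⟨b, p, hp⟩ := h.even v hvE
    exact mem_of_stem _ b v p p.end_mem_support hp
  · obtain ⟨b, x, q, hvx, hq⟩ := h.odd v hvO
    exact mem_of_stem _ b x _ (by simp [Walk.support_concat]) hq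

lemma eq_preimage (h : IsReachPart f (C.map (Embedding.induce (E ∪ O)).toHom) E O)
    {A : Set ↥(E ∪ O)} (hr : IsReachGraph (G.induce (E ∪ O)) C A) :
    A = Subtype.val ⁻¹' O := by
  ext ⟨v, hv⟩
  constructor
  · refine fun hvA => hv.resolve_left fun hvE => ?_
    obtain ⟨b, p, hp⟩ := h.even v hvE
    obtain ⟨hs, g, -, flower⟩ := hp.exists_induce h.max.1 h.mapsTo_union
    exact hr.root_notMem flower hvA
  · intro hvO
    obtain ⟨b, x, q, hvx, hq⟩ := h.odd v hvO
    obtain ⟨hs, g, -, flower⟩ := hq.exists_induce h.max.1 h.mapsTo_union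
    obtain ⟨g', -, -, flower', -⟩ := hq
    have hxQ : x ∈ E ∪ O := hs x (Walk.end_mem_support _)
    have not_adj : ¬ C.Adj ⟨v, hv⟩ ⟨x, hxQ⟩ := fun hadj =>
      flower'.not_adj_of_mem_edges (x := v) (y := x) (by simp [Walk.edges_concat])
        ((map_adj_iff (induce_injective G (E ∪ O))).2 hadj)
    exact (hr.mem_iff_notMem ⟨v, hv⟩ ⟨x, hxQ⟩ hvx not_adj).2 (hr.root_notMem flower)

end Induced

lemma exists_isReachGraph (h : IsReachPart f C E O) (hC : IsOddCycle G C)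
    (huniq : ∀ D, IsOddCycle G D → D.verts ⊆ E ∪ O → D = C) :
    ∃ C' : (G.induce (E ∪ O)).Subgraph, C'.map (Embedding.induce (E ∪ O)).toHom = C ∧
      IsReachGraph (G.induce (E ∪ O)) C' (Subtype.val ⁻¹' O) := by
  obtain ⟨C', hC', rfl⟩ := hC.exists_induce h.verts_subset_union
  have eq_of_isOddCycle (D) (hD : IsOddCycle (G.induce (E ∪ O)) D) : D = C' :=
    subgraphMap_injective (induce_injective G _)
      (huniq _ (hD.map (induce_injective G _)) (by rintro _ ⟨v, -, rfl⟩; exact v.2))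
  obtain ⟨C'', A, hr⟩ := BABGraph.exists_isReachGraph ⟨C', hC', eq_of_isOddCycle⟩ fun D hD => by
    rw [eq_of_isOddCycle D hD, h.reachSet_induce hC']
  obtain rfl := eq_of_isOddCycle C'' hr.odd
  exact ⟨C'', rfl, h.eq_preimage hr ▸ hr⟩

lemma two_mul_ncard_add_le (h : IsReachPart f C E O) :
    2 * O.ncard + C.verts.ncard ≤ (saturated f ∩ (E ∪ O)).ncard + 1 := by
  obtain ⟨b, hb, hfb⟩ := h.base
  have ncard_image : (f '' O).ncard = O.ncard := Set.ncard_image_of_injective _ h.max.1.injective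
  have disjoint_cycle : Disjoint O C.verts := h.disjoint.symm.mono_right h.cycle
  have subset : O ∪ (f '' O ∪ C.verts \ {b}) ⊆ saturated f ∩ (E ∪ O) := by
    have ne_self : ∀ v ∈ O, f v ≠ v := fun v hv hfv =>
      Set.disjoint_left.1 h.disjoint (hfv ▸ h.mapsTo v hv) hv
    rintro v (hv | ⟨w, hw, rfl⟩ | hv)
    · exact ⟨ne_self v hv, Or.inr hv⟩
    · exact ⟨h.max.1.apply_mem_saturated (ne_self w hw), Or.inl (h.mapsTo w hw)⟩
    · rw [← hb.saturated_inter hfb] at hv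
      exact ⟨hv.1, Or.inl (h.cycle hv.2)⟩
  have disjoint_image : Disjoint (f '' O) (C.verts \ {b}) := by
    rw [Set.disjoint_left]
    rintro _ ⟨w, hw, rfl⟩ ⟨hfw, -⟩
    have hwC := hb.mapsTo hfb _ hfw
    rw [h.max.1.involutive] at hwC
    exact Set.disjoint_left.1 disjoint_cycle hw hwC
  have disjoint_union : Disjoint O (f '' O ∪ C.verts \ {b}) := by
    rw [Set.disjoint_left]
    rintro v hv (⟨w, hw, rfl⟩ | ⟨hvC, -⟩)
    · exact Set.disjoint_left.1 h.disjoint (h.mapsTo w hw) hv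
    · exact Set.disjoint_left.1 disjoint_cycle hv hvC
  have ncard_le := Set.ncard_le_ncard subset
  have ncard_sdiff := Set.ncard_sdiff_singleton_add_one hb.mem
  rw [Set.ncard_union_eq disjoint_union, Set.ncard_union_eq disjoint_image, ncard_image] at ncard_le
  omega

end IsReachPart

end ReachPart

/-! ### `R`-disjoint graphs are BAB-graphs -/

section Family

variable {G : SimpleGraph V} {k : ℕ} {C : Fin k → G.Subgraph} {f : Fin k → V → V}
  {E O : Fin k → Set V} {B : Set V}

lemma exists_isMatchingMap_of_partition {ι : Type*} {Q : ι → Set V} {f : ι → V → V}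
    (hQ : Pairwise (Function.onFun Disjoint Q)) (hcov : ⋃ t, Q t = Set.univ)
    (hf : ∀ t, IsMatchingMap G (f t)) (hmaps : ∀ t, ∀ v ∈ Q t, f t v ∈ Q t) :
    ∃ F, IsMatchingMap G F ∧ ∀ t, ∀ v ∈ Q t, F v = f t v := by
  choose part hpart using Set.iUnion_eq_univ_iff.1 hcov
  have part_eq {t v} (hv : v ∈ Q t) : part v = t := by
    by_contra hne
    exact Set.disjoint_left.1 (hQ hne) (hpart v) hv
  refine ⟨fun v => f (part v) v, ⟨fun v => ?_, fun v hv => (hf (part v)).adj v hv⟩,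
    fun t v hv => congrArg (f · v) (part_eq hv)⟩
  rw [part_eq (hmaps _ _ (hpart v)), (hf _).involutive]

/-- A partition of the vertices of `G` into a set `B` and, for each odd cycle `C i`, a reach part
`E i ∪ O i` that cannot be enlarged: the last condition says that a vertex outside the part that is
adjacent to `O i` is saturated by every maximum matching that extends the one of the part. -/
structure IsReachPartition (B : Set V) (f : Fin k → V → V) (C : Fin k → G.Subgraph)
    (E O : Fin k → Set V) : Prop where
  disjoint_base : ∀ i, Disjoint B (E i ∪ O i)
  disjoint_parts : ∀ i j, i ≠ j → Disjoint (E i ∪ O i) (E j ∪ O j)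
  cover : B ∪ ⋃ i, (E i ∪ O i) = Set.univ
  isOddCycle : ∀ i, IsOddCycle G (C i)
  exists_eq : ∀ D, IsOddCycle G D → ∃ i, C i = D
  isReachPart : ∀ i, IsReachPart (f i) (C i) (E i) (O i)
  mem_of_adj : ∀ i, ∀ e ∈ E i, ∀ u, G.Adj e u → u ∈ E i ∪ O i
  apply_ne : ∀ i, ∀ x ∉ E i ∪ O i, ∀ o ∈ O i, G.Adj o x →
    ∀ g, IsMaxMatchingMap G g → (∀ v ∈ E i ∪ O i, g v = f i v) → g x ≠ x

namespace IsReachPartition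

lemma exists_isReachGraph [Finite V] (h : IsReachPartition B f C E O) (i : Fin k) :
    ∃ C', C'.map (Embedding.induce (E i ∪ O i)).toHom = C i ∧
      IsReachGraph (G.induce (E i ∪ O i)) C' (Subtype.val ⁻¹' O i) := by
  refine (h.isReachPart i).exists_isReachGraph (h.isOddCycle i) fun D hD hDi => ?_
  obtain ⟨j, rfl⟩ := h.exists_eq D hD
  obtain ⟨v, hv⟩ := hD.nonempty
  by_contra hne
  exact Set.disjoint_left.1 (h.disjoint_parts j i fun hji => hne (congrArg C hji))
    ((h.isReachPart j).verts_subset_union hv) (hDi hv)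

lemma adj_cycle [Finite V] (h : IsReachPartition B f C E O) {i : Fin k} {v w : V} (hv : v ∈ E i)
    (hw : w ∈ E i) (hvw : G.Adj v w) : (C i).Adj v w := by
  obtain ⟨C', hC', hr⟩ := h.exists_isReachGraph i
  by_contra not_adj
  have iff_not := hr.mem_iff_notMem ⟨v, Or.inl hv⟩ ⟨w, Or.inl hw⟩ hvw fun hadj =>
    not_adj (hC' ▸ (map_adj_iff (induce_injective G _)).2 hadj)
  have notMem_odd {x} (hx : x ∈ E i) : x ∉ O i := Set.disjoint_left.1 (h.isReachPart i).disjoint hx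
  exact notMem_odd hv (iff_not.2 (notMem_odd hw))

lemma ncard_saturated_le [Finite V] (h : IsReachPartition B f C E O) {g : V → V}
    (hg : IsMatchingMap G g) :
    (saturated g).ncard ≤ (saturated (restrictMap B g)).ncard +
      ∑ i, (saturated (f i) ∩ (E i ∪ O i)).ncard := by
  have cases_of_notMem (v : V) (hv : v ∉ ⋃ i, O i) : v ∈ B ∨ ∃ i, v ∈ E i := by
    rcases h.cover.ge (Set.mem_univ v) with hvB | hvP
    · exact Or.inl hvB
    · obtain ⟨i, hi⟩ := Set.mem_iUnion.1 hvP
      exact Or.inr ⟨i, hi.resolve_right fun hiO => hv (Set.mem_iUnion.2 ⟨i, hiO⟩)⟩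
  have mem_of_notMem (v) (hv : v ∈ saturated g) (hvO : v ∉ ⋃ i, O i) (hgO : g v ∉ ⋃ i, O i) :
      v ∈ Subtype.val '' saturated (restrictMap B g) ∪ ⋃ i, {v | (C i).Adj v (g v)} := by
    have mem_E_of_adj {i u w} (hu : u ∈ E i) (huw : G.Adj u w) (hw : w ∉ ⋃ i, O i) : w ∈ E i :=
      (h.mem_of_adj i u hu w huw).resolve_right fun hwO => hw (Set.mem_iUnion.2 ⟨i, hwO⟩)
    have hadj := hg.adj v hv
    by_cases hvE : ∃ i, v ∈ E i
    · obtain ⟨i, hi⟩ := hvE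
      exact Or.inr (Set.mem_iUnion.2 ⟨i, h.adj_cycle hi (mem_E_of_adj hi hadj hgO) hadj⟩)
    · refine Or.inl ?_
      rw [image_saturated_restrictMap]
      refine ⟨hv, (cases_of_notMem v hvO).resolve_right hvE,
        (cases_of_notMem _ hgO).resolve_right ?_⟩
      exact fun ⟨i, hi⟩ => hvE ⟨i, mem_E_of_adj hi hadj.symm hvO⟩
  have part_le (i) : 2 * (O i).ncard + {v | (C i).Adj v (g v)}.ncard ≤
      (saturated (f i) ∩ (E i ∪ O i)).ncard := by
    have := hg.ncard_adj_lt (h.isOddCycle i)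
    have := (h.isReachPart i).two_mul_ncard_add_le
    omega
  have sum_le := Finset.sum_le_sum fun i (_ : i ∈ Finset.univ) => part_le i
  rw [Finset.sum_add_distrib, ← Finset.mul_sum] at sum_le
  have ncard_le := hg.ncard_saturated_le mem_of_notMem
  have inter_le := Set.ncard_inter_le_ncard_left (⋃ i, O i) (saturated g)
  have odd_le := Set.ncard_iUnion_le_of_fintype O
  have union_le := Set.ncard_union_le (Subtype.val '' saturated (restrictMap B g))
    (⋃ i, {v | (C i).Adj v (g v)})
  have cycles_le := Set.ncard_iUnion_le_of_fintype fun i => {v | (C i).Adj v (g v)}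
  rw [Set.ncard_image_of_injective _ Subtype.val_injective] at union_le
  omega

lemma exists_isMaxMatchingMap [Finite V] (h : IsReachPartition B f C E O) {N : B → B}
    (hN : IsMaxMatchingMap (G.induce B) N) :
    ∃ F, IsMaxMatchingMap G F ∧ (∀ v, F v.1 = (N v).1) ∧ ∀ i, ∀ v ∈ E i ∪ O i, F v = f i v := by
  let Q := babParts B fun i => E i ∪ O i
  have hQ : Pairwise (Function.onFun Disjoint Q) :=
    pairwise_disjoint_babParts h.disjoint_base h.disjoint_parts
  have iUnion_eq : ⋃ t, Q t = Set.univ := (iUnion_babParts _ _).trans h.cover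
  obtain ⟨F, hF, F_eq⟩ := exists_isMatchingMap_of_partition hQ iUnion_eq
    (f := fun t => t.elim (extendMap N) f)
    (by rintro (_ | i); exacts [isMatchingMap_extendMap hN.1, (h.isReachPart i).max.1])
    (by rintro (_ | i); exacts [fun v => extendMap_mem N, (h.isReachPart i).mapsTo_union])
  have F_base (v : B) : F v.1 = (N v).1 := (F_eq none v.1 v.2).trans (extendMap_coe N v)
  have F_part (i) : ∀ v ∈ E i ∪ O i, F v = f i v := F_eq (some i)
  refine ⟨F, ⟨hF, fun g hg => ?_⟩, F_base, F_part⟩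
  have base_eq : (Subtype.val ⁻¹' saturated F : Set (Q none)) = saturated N := by
    ext v
    exact not_congr ((Eq.congr_left (F_base v)).trans Subtype.val_injective.eq_iff)
  have part_eq (i) : (Subtype.val ⁻¹' saturated F : Set (Q (some i))).ncard =
      (saturated (f i) ∩ (E i ∪ O i)).ncard := by
    rw [← Set.ncard_image_of_injective _ Subtype.val_injective, Subtype.image_preimage_coe,
      Set.inter_comm]
    congr 1
    ext v
    exact and_congr_left fun hv => not_congr (Eq.congr_left (F_part i v hv))
  rw [ncard_eq_sum hQ iUnion_eq (saturated F), Fintype.sum_option, base_eq]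
  simp_rw [part_eq]
  refine (h.ncard_saturated_le hg).trans ?_
  exact Nat.add_le_add_right (hN.ncard_le _ (isMatchingMap_restrictMap hg)) _

lemma boundary_base_subset [Finite V] (h : IsReachPartition B f C E O) :
    boundary G B ⊆ Subtype.val '' (geA (G.induce B) ∪ geC (G.induce B)) := by
  rintro x ⟨hx, w, hw, hadj⟩
  refine ⟨⟨x, hx⟩, ?_, rfl⟩
  by_contra notMem
  have mem_geD : ⟨x, hx⟩ ∈ geD (G.induce B) := by
    by_contra notMem_geD
    exact notMem (Or.inr fun hDA => hDA.elim notMem_geD fun hA => notMem (Or.inl hA))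
  obtain ⟨N, hN, hNx⟩ := (mem_geD_iff _ _).1 mem_geD
  obtain ⟨F, hF, F_base, F_part⟩ := h.exists_isMaxMatchingMap hN
  obtain ⟨i, hi⟩ := Set.mem_iUnion.1 ((h.cover.ge (Set.mem_univ w)).resolve_left hw)
  have hxi : x ∉ E i ∪ O i := Set.disjoint_left.1 (h.disjoint_base i) hx
  have hwO : w ∈ O i := hi.resolve_left fun hwE => hxi (h.mem_of_adj i w hwE x hadj.symm)
  exact h.apply_ne i x hxi w hwO hadj.symm F hF (F_part i) (by rw [F_base ⟨x, hx⟩, hNx])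

lemma isBipartite_base (h : IsReachPartition B f C E O) : (G.induce B).IsBipartite := by
  obtain ⟨col, hcol⟩ := exists_coloring_of_forall_not_isOddCycle (G := G.induce B) fun D hD => by
    obtain ⟨i, hi⟩ := h.exists_eq _ (hD.map (induce_injective G B))
    obtain ⟨v, hv⟩ := hD.nonempty
    have hvC : v.1 ∈ (C i).verts := hi ▸ Set.mem_image_of_mem _ hv
    exact Set.disjoint_left.1 (h.disjoint_base i) v.2 ((h.isReachPart i).verts_subset_union hvC)
  exact (Coloring.mk col fun {u v} huv => hcol u v huv).colorable

lemma isBAB [Finite V] (h : IsReachPartition B f C E O) : IsBAB G B fun i => E i ∪ O i := by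
  choose C' _ hr using h.exists_isReachGraph
  refine ⟨h.disjoint_base, h.disjoint_parts, h.cover, h.isBipartite_base,
    fun i => ⟨C' i, (hr i).odd, (hr i).uniq⟩, fun i => (hr i).not_isKonigEgervary,
    fun i D hD => ?_, h.boundary_base_subset, ?_⟩
  · rw [(hr i).uniq D hD, (hr i).reach]
  · rintro i v ⟨hv, w, hw, hadj⟩
    refine ⟨⟨v, hv⟩, ?_, rfl⟩
    rw [(hr i).geA_eq]
    exact hv.resolve_left fun hvE => hw (h.mem_of_adj i v hvE w hadj)

end IsReachPartition

lemma IsRDisjoint.exists_isReachPartition [Finite V] (hG : IsRDisjoint G)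
    (hk : numOddCycles G = k) :
    ∃ (B : Set V) (f : Fin k → V → V) (C : Fin k → G.Subgraph) (E O : Fin k → Set V),
      IsReachPartition B f C E O := by
  obtain ⟨-, nonempty, disjoint⟩ := hG
  let e := Finite.equivFinOfCardEq ((Nat.card_coe_set_eq {C | IsOddCycle G C}).trans hk)
  have isOddCycle (i : Fin k) : IsOddCycle G (e.symm i).1 := (e.symm i).2
  choose f E O part closed apply_ne using fun i =>
    exists_maximal_isReachPart (isOddCycle i) (nonempty _ (isOddCycle i))
  have disjoint_parts (i j) (hij : i ≠ j) : Disjoint (E i ∪ O i) (E j ∪ O j) :=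
    (disjoint _ _ (isOddCycle i) (isOddCycle j)
      fun h => hij (e.symm.injective (Subtype.ext h))).mono
      ((part i).subset_reachSet (isOddCycle i)) ((part j).subset_reachSet (isOddCycle j))
  exact ⟨(⋃ i, (E i ∪ O i))ᶜ, f, fun i => (e.symm i).1, E, O,
    fun i => Set.disjoint_compl_left_iff_subset.2 (Set.subset_iUnion (fun i => E i ∪ O i) i),
    disjoint_parts, Set.compl_union_self _, isOddCycle,
    fun D hD => ⟨e ⟨D, hD⟩, by simp⟩, part, closed, apply_ne⟩

lemma IsRDisjoint.exists_isBAB [Finite V] (hG : IsRDisjoint G) (hk : numOddCycles G = k) :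
    ∃ (B : Set V) (P : Fin k → Set V), IsBAB G B P ∧
      ∀ C, IsOddCycle G C → ∃ i, C.verts ⊆ P i := by
  obtain ⟨B, f, C, E, O, h⟩ := hG.exists_isReachPartition hk
  refine ⟨B, _, h.isBAB, fun D hD => ?_⟩
  obtain ⟨i, rfl⟩ := h.exists_eq D hD
  exact ⟨i, (h.isReachPart i).verts_subset_union⟩

end Family

/-! ### Disjoint unions of triangles -/

section Triangles

variable {κ : Type*} {β : V → κ}

/-- The disjoint union of complete graphs on the fibres of `β`. -/
def fibreGraph (β : V → κ) : SimpleGraph V where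
  Adj u v := u ≠ v ∧ β u = β v
  symm := ⟨fun _ _ h => ⟨h.1.symm, h.2.symm⟩⟩
  loopless := ⟨fun _ h => h.1 rfl⟩

/-- The complete graph on a fibre of `β`, as a subgraph of the disjoint union. -/
def fibreSubgraph (β : V → κ) (t : κ) : (fibreGraph β).Subgraph :=
  (⊤ : (fibreGraph β).Subgraph).induce {v | β v = t}

lemma eq_of_mem_support_fibreGraph {u v x : V} (p : (fibreGraph β).Walk u v)
    (hx : x ∈ p.support) : β x = β u := by
  induction p with
  | nil => rw [List.mem_singleton.1 hx]
  | cons h p ih =>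
    rw [Walk.support_cons, List.mem_cons] at hx
    rcases hx with rfl | hx
    · rfl
    · rw [ih hx, h.2]

lemma reachSet_fibreSubgraph_subset (t : κ) :
    reachSet (fibreGraph β) (fibreSubgraph β t) ⊆ {v | β v = t} := by
  rintro v ⟨M, b, r, p, -, hp, hv | hv⟩
  · exact hv
  · exact (eq_of_mem_support_fibreGraph p hv).trans hp.1.2.2.1

variable [Finite V]

lemma IsOddCycle.eq_fibreSubgraph (hβ : ∀ t, {v | β v = t}.ncard = 3)
    {C : (fibreGraph β).Subgraph} (hC : IsOddCycle (fibreGraph β) C) :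
    ∃ t, C = fibreSubgraph β t := by
  obtain ⟨w, c, hc, -, rfl⟩ := hC
  have neighborSet_eq (u : V) (hu : u ∈ c.support) :
      c.toSubgraph.neighborSet u = {v | β v = β w} \ {u} := by
    have hu' := eq_of_mem_support_fibreGraph c hu
    refine Set.eq_of_subset_of_ncard_le
      (fun v hv => ⟨(hv.adj_sub.2.symm.trans hu'), hv.adj_sub.1.symm⟩) ?_
    rw [hc.ncard_neighborSet_toSubgraph_eq_two hu,
      Set.ncard_sdiff_singleton_of_mem (Set.mem_ofPred_eq ▸ hu'), hβ]
  have mem_support_iff (v : V) : v ∈ c.support ↔ β v = β w := by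
    refine ⟨eq_of_mem_support_fibreGraph c, fun hv => ?_⟩
    by_cases hvw : v = w
    · exact hvw ▸ c.start_mem_support
    · have adj : v ∈ c.toSubgraph.neighborSet w :=
        (neighborSet_eq w c.start_mem_support).ge ⟨hv, hvw⟩
      exact c.mem_verts_toSubgraph.1 adj.snd_mem
  refine ⟨β w, Subgraph.ext (Set.ext fun v => c.mem_verts_toSubgraph.trans (mem_support_iff v)) ?_⟩
  ext u v
  constructor
  · exact fun huv => ⟨(mem_support_iff u).1 (c.mem_verts_toSubgraph.1 huv.fst_mem),
      (mem_support_iff v).1 (c.mem_verts_toSubgraph.1 huv.snd_mem), huv.adj_sub⟩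
  · rintro ⟨hu, hv, huv⟩
    exact (neighborSet_eq u ((mem_support_iff u).2 hu)).ge ⟨hv, huv.adj_sub.ne'⟩

lemma isOddCycle_fibreSubgraph (hβ : ∀ t, {v | β v = t}.ncard = 3) (t : κ) :
    IsOddCycle (fibreGraph β) (fibreSubgraph β t) := by
  obtain ⟨a, b, c, hab, hac, hbc, fibre_eq⟩ := Set.ncard_eq_three.1 (hβ t)
  have ha : β a = t := fibre_eq.ge (by simp)
  have hb : β b = t := fibre_eq.ge (by simp)
  have hc : β c = t := fibre_eq.ge (by simp)
  have adj_ab : (fibreGraph β).Adj a b := ⟨hab, ha.trans hb.symm⟩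
  have adj_bc : (fibreGraph β).Adj b c := ⟨hbc, hb.trans hc.symm⟩
  have adj_ca : (fibreGraph β).Adj c a := ⟨hac.symm, hc.trans ha.symm⟩
  have triangle : IsOddCycle (fibreGraph β)
      (Walk.cons adj_ab (.cons adj_bc (.cons adj_ca .nil))).toSubgraph := by
    refine ⟨a, _, ?_, ⟨1, rfl⟩, rfl⟩
    rw [Walk.cons_isCycle_iff]
    simp [hab, hbc, hac, hab.symm, hac.symm]
  obtain ⟨s, hs⟩ := triangle.eq_fibreSubgraph hβ
  have mem_fibre : a ∈ (fibreSubgraph β s).verts := hs ▸ Walk.start_mem_verts_toSubgraph _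
  obtain rfl : s = t := Eq.trans (Eq.symm mem_fibre) ha
  exact hs ▸ triangle

lemma fibreSubgraph_injective (hβ : ∀ t, {v | β v = t}.ncard = 3) :
    Function.Injective (fibreSubgraph β) := by
  intro s t hst
  obtain ⟨v, hv⟩ := (isOddCycle_fibreSubgraph hβ s).nonempty
  have hv' : v ∈ (fibreSubgraph β t).verts := hst ▸ hv
  exact Eq.trans (Eq.symm hv) hv'

lemma numOddCycles_fibreGraph (hβ : ∀ t, {v | β v = t}.ncard = 3) :
    numOddCycles (fibreGraph β) = Nat.card κ := by
  have eq_range : {C | IsOddCycle (fibreGraph β) C} = Set.range (fibreSubgraph β) := by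
    ext C
    constructor
    · intro hC
      obtain ⟨t, rfl⟩ := IsOddCycle.eq_fibreSubgraph hβ hC
      exact ⟨t, rfl⟩
    · rintro ⟨t, rfl⟩
      exact isOddCycle_fibreSubgraph hβ t
  rw [numOddCycles, eq_range, ← Set.image_univ,
    Set.ncard_image_of_injective _ (fibreSubgraph_injective hβ), Set.ncard_univ]

lemma exists_unsaturated_mem_fibre (hβ : ∀ t, {v | β v = t}.ncard = 3) {f : V → V}
    (hf : IsMatchingMap (fibreGraph β) f) (t : κ) :
    ∃ b, β b = t ∧ f b = b := by
  by_contra! saturates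
  have even := (isMatchingMap_restrictMap (W := {v | β v = t}) hf).even_ncard_saturated
  rw [← Set.ncard_image_of_injective _ Subtype.val_injective, image_saturated_restrictMap] at even
  have fibre_eq : {v | v ∈ saturated f ∧ v ∈ {v | β v = t} ∧ f v ∈ {v | β v = t}} =
      {v | β v = t} := by
    ext v
    exact ⟨fun h => h.2.1,
      fun h => ⟨saturates v h, h, (hf.adj v (saturates v h)).2.symm.trans h⟩⟩
  rw [fibre_eq, hβ] at even
  exact absurd even (by decide)

lemma reachSet_fibreSubgraph_nonempty (hβ : ∀ t, {v | β v = t}.ncard = 3) (t : κ) :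
    (reachSet (fibreGraph β) (fibreSubgraph β t)).Nonempty := by
  obtain ⟨f, hf⟩ := exists_isMaxMatchingMap (fibreGraph β)
  obtain ⟨b, hb, hfb⟩ := exists_unsaturated_mem_fibre hβ hf.1 t
  have blossom : IsBlossomMap f (fibreSubgraph β t) b := by
    refine ⟨hb, fun h => h.ne hfb.symm, fun x hx hxb => ?_⟩
    have saturates : f x ≠ x := fun hfx => hf.not_adj hfx hfb ⟨hxb, Eq.trans hx hb.symm⟩
    have adj := hf.1.adj x saturates
    exact ⟨hx, adj.2.symm.trans hx, adj⟩
  exact ⟨b, (mem_reachSet_iff (isOddCycle_fibreSubgraph hβ t) b).2 ⟨f, b, b, .nil, hf,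
    ⟨blossom, Walk.IsPath.nil, trivial, by simp, hfb, by simp⟩, Or.inl hb⟩⟩

lemma isRDisjoint_fibreGraph [Nonempty κ] (hβ : ∀ t, {v | β v = t}.ncard = 3) :
    IsRDisjoint (fibreGraph β) := by
  refine ⟨⟨_, isOddCycle_fibreSubgraph hβ (Classical.arbitrary κ)⟩, fun C hC => ?_,
    fun C C' hC hC' hne => ?_⟩
  · obtain ⟨t, rfl⟩ := IsOddCycle.eq_fibreSubgraph hβ hC
    exact reachSet_fibreSubgraph_nonempty hβ t
  · obtain ⟨s, rfl⟩ := IsOddCycle.eq_fibreSubgraph hβ hC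
    obtain ⟨t, rfl⟩ := IsOddCycle.eq_fibreSubgraph hβ hC'
    refine Set.disjoint_left.2 fun v hv hv' => hne (congrArg _ ?_)
    exact Eq.trans (Eq.symm (reachSet_fibreSubgraph_subset s hv))
      (reachSet_fibreSubgraph_subset t hv')

end Triangles

lemma exists_isRDisjoint {k : ℕ} (hk : 1 ≤ k) : ∃ (n : ℕ) (G : SimpleGraph (Fin n)),
    IsRDisjoint G ∧ numOddCycles G = k := by
  have ncard_fibre (t : Fin k) :
      {v : Fin (k * 3) | (finProdFinEquiv.symm v).1 = t}.ncard = 3 := by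
    have fibre_eq : {v : Fin (k * 3) | (finProdFinEquiv.symm v).1 = t} =
        Set.range fun i : Fin 3 => finProdFinEquiv (t, i) := by
      ext v
      constructor
      · rintro rfl
        exact ⟨_, finProdFinEquiv.apply_symm_apply v⟩
      · rintro ⟨i, rfl⟩
        exact congrArg Prod.fst (finProdFinEquiv.symm_apply_apply (t, i))
    rw [fibre_eq, ← Set.image_univ, Set.ncard_image_of_injective, Set.ncard_univ, Nat.card_fin]
    exact finProdFinEquiv.injective.comp (Prod.mk_right_injective t)
  have : Nonempty (Fin k) := ⟨⟨0, hk⟩⟩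
  exact ⟨k * 3, _, isRDisjoint_fibreGraph ncard_fibre,
    (numOddCycles_fibreGraph ncard_fibre).trans (Nat.card_fin k)⟩

end BABGraph

theorem mainTheorem6 :
    (∀ {V : Type*} [Finite V] (G : SimpleGraph V) (k : ℕ) (B : Set V) (P : Fin k → Set V),
      BABGraph.IsBAB G B P →
        (BABGraph.kernel G).ncard + (BABGraph.corona G).ncard ≤ 2 * G.indepNum + k ∧
        ((2 * G.indepNum + k : ℕ) : ℤ) = BABGraph.critDiff G + (Nat.card V : ℤ)) ∧
    (∀ {V : Type*} [Finite V] (G : SimpleGraph V) (k : ℕ),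
      BABGraph.IsRDisjoint G → BABGraph.numOddCycles G = k →
        (∃ (B : Set V) (P : Fin k → Set V), BABGraph.IsBAB G B P) ∧
        (BABGraph.kernel G).ncard + (BABGraph.corona G).ncard = 2 * G.indepNum + k) ∧
    (∀ k : ℕ, 1 ≤ k → ∃ (n : ℕ) (G : SimpleGraph (Fin n)),
      BABGraph.IsRDisjoint G ∧ BABGraph.numOddCycles G = k) := by
  refine ⟨fun G k B P h => ⟨h.ncard_kernel_add_ncard_corona_le, h.two_mul_indepNum_add⟩,
    fun G k hG hk => ?_, fun k hk => BABGraph.exists_isRDisjoint hk⟩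
  obtain ⟨B, P, h, hodd⟩ := hG.exists_isBAB hk
  exact ⟨⟨B, P, h⟩, h.ncard_kernel_add_ncard_corona_eq hodd⟩
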